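/- Let $k$ be a commutative ring with $\mathbb{Q}\subseteq k$, let $A$ be an associative unital $k$-algebra, let $K\subseteq A$ be a (not necessarily commutative) $k$-subalgebra, and let $(E,p,i)$ be a cleft extension of $A$: $E$ is a $k$-algebra and $p\colon E\to A$, $i\colon A\to E$ are morphisms of $k$-algebras with $p\circ i=\mathrm{id}_A$. Put $M=\ker p$ and identify $A$ with $i(A)$, so that $E=A\oplus M$ as $K$-bimodules. For $x,y\in A\cup M$ let $x\triangledown y$ be the product of $E$ if $x,y\in M$ and $0$ otherwise, and let $x\cdot y$ be the product of $E$ if $x\in A$ or $y\in A$, and $0$ if $x,y\in M$; extend both bilinearly to $E$. Notation. For a $k$-algebra $C$ containing $K$, write $\otimes=\otimes_K$, $\overline{C}=C/K$, and $C\otimes\overline{C}^{\otimes n}\otimes$ for the quotient of $C\otimes\overline{C}^{\otimes n}$ by its commutators with $K$. The normalized mixed complex of the $K$-algebra $C$ is $(C\otimes\overline{C}^{\otimes *}\otimes,b,B)$, with $b$ the Hochschild boundary and $B(c_0\otimes\cdots\otimes c_n)=\sum_{j=0}^n(-1)^{jn}\,1\otimes c_j\otimes\cdots\otimes c_n\otimes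 c_0\otimes\cdots\otimes c_{j-1}$. For a mixed complex $(Y,b,B)$, let $\mathrm{BP}$ be the double complex with columns $Yu^j$, $j\in\mathbb{Z}$ ($u$ of degree $2$), with maps $b(yu^j)=b(y)u^j$ and $B(yu^j)=B(y)u^{j-1}$; let $\mathrm{BC}$ be its quotient consisting of the columns with $j\ge 0$ and $\mathrm{BN}$ its subcomplex consisting of the columns with $j\le 0$. The Hochschild, cyclic, periodic and negative homologies of $(Y,b,B)$ are the homologies of $(Y,b)$, $\mathrm{Tot}(\mathrm{BC})$, $\mathrm{Tot}(\mathrm{BP})$ and $\mathrm{Tot}(\mathrm{BN})$, where $\mathrm{Tot}$ is formed with direct products. Let $\mathrm{HH}^K_*(E,M)$, $\mathrm{HC}^K_*(E,M)$, $\mathrm{HP}^K_*(E,M)$ and $\mathrm{HN}^K_*(E,M)$ be these homologies of the kernel of the morphism from the normalized mixed complex of the $K$-algebra $E$ to that of $A$ induced by $p$. The diagram. For $v,w\ge 0$ and $n=v+w$ let $X_{vw}\subseteq E\otimes\overline{E}^{\otimes n}\otimes$ be spanned by the tensors $x_0\otimes\cdots\otimes x_n$ such that $x_0\in M$, exactly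 $w$ of $x_1,\dots,x_n$ lie in $M$, and the others lie in $A$; put $X_{vw}=0$ otherwise. On such tensors let $$b=\sum_{j=0}^{n}\mu_j,\qquad d'=\sum_{j=0}^{n-1}\varrho_j,\qquad d=d'+\varrho_n,\qquad N=\sum_{l=0}^{w}t^l,$$ where, for $0\le j<n$, $\mu_j$ and $\varrho_j$ replace $x_j\otimes x_{j+1}$ by $(-1)^j x_j\cdot x_{j+1}$ and $(-1)^j x_j\triangledown x_{j+1}$, respectively; $\mu_n(x_0\otimes\cdots\otimes x_n)=(-1)^n (x_n\cdot x_0)\otimes x_1\otimes\cdots\otimes x_{n-1}$ and $\varrho_n(x_0\otimes\cdots\otimes x_n)=(-1)^n (x_n\triangledown x_0)\otimes x_1\otimes\cdots\otimes x_{n-1}$; and $t(x_0\otimes\cdots\otimes x_n)=(-1)^{jn}x_j\otimes\cdots\otimes x_n\otimes x_0\otimes\cdots\otimes x_{j-1}$ with $j$ the last index such that $x_j\in M$. Thus $b\colon X_{vw}\to X_{v-1,w}$, $d,d'\colon X_{vw}\to X_{v,w-1}$ and $t,N\colon X_{vw}\to X_{vw}$. Let $\mathcal{X}$ be the triple diagram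 with $X_{vw}$ in position $(u,v,w)$ for all $u\in\mathbb{Z}$, whose face in column $u$ is $(X,b,d)$ for $u$ even and $(X,-b,-d')$ for $u$ odd, and whose map from column $u+1$ to column $u$ is $\mathrm{id}-t$ for $u$ even and $N$ for $u$ odd. Let $\tau^l(\mathcal{X})$ be the subdiagram of the columns $u\le l$, $\tau_0(\mathcal{X})=\mathcal{X}/\tau^{-1}(\mathcal{X})$ and $\tau_0^1(\mathcal{X})=\tau^1(\mathcal{X})/\tau^{-1}(\mathcal{X})$. Theorem. $\mathcal{X}$ is a triple complex (its three differentials have square zero and anticommute). Moreover, for every $n\in\mathbb{Z}$ there are isomorphisms of $k$-modules $$\mathrm{HH}^K_n(E,M)\cong \mathrm{H}_n(\mathrm{Tot}(\tau_0^1(\mathcal{X}))),\qquad \mathrm{HC}^K_n(E,M)\cong \mathrm{H}_n(\mathrm{Tot}(\tau_0(\mathcal{X}))),$$ $$\mathrm{HP}^K_n(E,M)\cong \mathrm{H}_n(\mathrm{Tot}(\mathcal{X})),\qquad \mathrm{HN}^K_n(E,M)\cong \mathrm{H}_n(\mathrm{Tot}(\tau^1(\mathcal{X}))),$$ where $\mathrm{Tot}$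 is the total complex formed with direct products. -/

import Mathlib

open scoped TensorProduct

noncomputable section

namespace Cleft

variable {k C : Type*} [CommRing k] [Ring C] [Algebra k C]

/-- The relations that cut `C ⊗_K C̄ ⊗_K ⋯ ⊗_K C̄ ⊗_K` (one factor `C`, then `n` factors
`C̄ = C / K`, the tensor product being closed up cyclically) out of the `(n + 1)`-fold tensor
power of `C` over `k`: elements of `K` may be moved across each tensor sign, also cyclically from
the last factor to the first one (`j + 1` is computed modulo `n + 1`), and a simple tensor with an
entry of `K` in one of the positions `1, …, n` is zero. -/
def tensorRel (K : Subalgebra k C) (n : ℕ) : Submodule k (⨂[k] _ : Fin (n + 1), C) :=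
  Submodule.span k
    ({z | ∃ (x : Fin (n + 1) → C) (j : Fin (n + 1)) (c : C), c ∈ K ∧
        z = PiTensorProduct.tprod k (Function.update x j (x j * c)) -
          PiTensorProduct.tprod k (Function.update x (j + 1) (c * x (j + 1)))} ∪
      {z | ∃ (x : Fin (n + 1) → C) (j : Fin (n + 1)), j ≠ 0 ∧ x j ∈ K ∧
        z = PiTensorProduct.tprod k x})

/-- `C ⊗ C̄^{⊗ n} ⊗`, where `⊗ = ⊗_K` and `C̄ = C / K`. The ring `K` need not be commutative. -/
abbrev CycTensor (K : Subalgebra k C) (n : ℕ) : Type _ :=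
  (⨂[k] _ : Fin (n + 1), C) ⧸ tensorRel K n

/-- The class `x₀ ⊗ ⋯ ⊗ xₙ` in `C ⊗ C̄^{⊗ n} ⊗`. -/
def cls (K : Subalgebra k C) (n : ℕ) :
    MultilinearMap k (fun _ : Fin (n + 1) => C) (CycTensor K n) :=
  (tensorRel K n).mkQ.compMultilinearMap (PiTensorProduct.tprod k)

section lift
variable {K : Subalgebra k C} {n : ℕ}

lemma cls_update (x : Fin (n + 1) → C) (j : Fin (n + 1)) {c : C} (hc : c ∈ K) :
    cls K n (Function.update x j (x j * c)) =
      cls K n (Function.update x (j + 1) (c * x (j + 1))) := by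
  refine (Submodule.Quotient.eq _).2 (Submodule.subset_span (Or.inl ⟨x, j, c, hc, rfl⟩))

lemma cls_degen (x : Fin (n + 1) → C) {j : Fin (n + 1)} (hj : j ≠ 0) (hx : x j ∈ K) :
    cls K n x = 0 :=
  (Submodule.Quotient.mk_eq_zero _).2 (Submodule.subset_span (Or.inr ⟨x, j, hj, hx, rfl⟩))

lemma cls_balanced (a : Fin (n + 1)) {c : C} (hc : c ∈ K) (x y z : Fin (n + 1) → C)
    (hy : ∀ l, y l = if l = a then x a * c else x l)
    (hz : ∀ l, z l = if l = a + 1 then c * x (a + 1) else x l) :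
    cls K n y = cls K n z := by
  have h1 : y = Function.update x a (x a * c) := by
    funext l; rw [hy, Function.update_apply]
  have h2 : z = Function.update x (a + 1) (c * x (a + 1)) := by
    funext l; rw [hz, Function.update_apply]
  rw [h1, h2, cls_update x a hc]

variable {V : Type*} [AddCommGroup V] [Module k V]

/-- A `k`-multilinear map on `C^{n+1}` that respects the relations of `C ⊗ C̄^{⊗ n} ⊗`. -/
structure Descends (K : Subalgebra k C) (f : MultilinearMap k (fun _ : Fin (n + 1) => C) V) :
    Prop where
  balanced : ∀ (x : Fin (n + 1) → C) (j : Fin (n + 1)) (c : C), c ∈ K →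
    f (Function.update x j (x j * c)) = f (Function.update x (j + 1) (c * x (j + 1)))
  degen : ∀ (x : Fin (n + 1) → C) (j : Fin (n + 1)), j ≠ 0 → x j ∈ K → f x = 0

/-- The linear map on `C ⊗ C̄^{⊗ n} ⊗` given on simple tensors by `f`. -/
def descend (f : MultilinearMap k (fun _ : Fin (n + 1) => C) V) (hf : Descends K f) :
    CycTensor K n →ₗ[k] V :=
  (tensorRel K n).liftQ (PiTensorProduct.lift f) <| by
    refine Submodule.span_le.2 ?_
    rintro z (⟨x, j, c, hc, rfl⟩ | ⟨x, j, hj, hx, rfl⟩)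
    · simp [hf.balanced x j c hc]
    · simp [hf.degen x j hj hx]

@[simp] lemma descend_cls (f : MultilinearMap k (fun _ : Fin (n + 1) => C) V)
    (hf : Descends K f) (x : Fin (n + 1) → C) : descend f hf (cls K n x) = f x := by
  change (PiTensorProduct.lift f) (PiTensorProduct.tprod k x) = f x
  simp

lemma span_cls : Submodule.span k (Set.range (cls K n)) = ⊤ := by
  have h := congrArg (Submodule.map (tensorRel K n).mkQ)
    (PiTensorProduct.span_tprod_eq_top (R := k) (s := fun _ : Fin (n + 1) => C))
  rw [Submodule.map_span, Submodule.map_top, Submodule.range_mkQ, ← Set.range_comp] at h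
  exact h

end lift

section face

/-- `(x₀, …, xₙ₊₁) ↦ (x₀, …, xⱼ₋₁, μ(xⱼ, xⱼ₊₁), xⱼ₊₂, …, xₙ₊₁)`. -/
def contr (μ : C →ₗ[k] C →ₗ[k] C) {n : ℕ} (j : Fin (n + 1)) (x : Fin (n + 2) → C) :
    Fin (n + 1) → C := fun l =>
  if l < j then x l.castSucc else if l = j then μ (x l.castSucc) (x l.succ) else x l.succ

lemma contr_update (μ : C →ₗ[k] C →ₗ[k] C) {n : ℕ} (j : Fin (n + 1)) (x : Fin (n + 2) → C)
    (i : Fin (n + 2)) : ∃ (a : Fin (n + 1)) (f : C →ₗ[k] C),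
      ∀ v, contr μ j (Function.update x i v) = Function.update (contr μ j x) a (f v) := by
  obtain h | h | h | h : (i : ℕ) < j ∨ (i : ℕ) = j ∨ (i : ℕ) = j + 1 ∨ (j : ℕ) + 1 < i := by omega
  · refine ⟨⟨i, by omega⟩, LinearMap.id, fun v => funext fun l => ?_⟩
    simp only [contr, Function.update_apply, Fin.ext_iff, Fin.lt_def, Fin.val_castSucc, Fin.val_succ,
      LinearMap.id_apply]
    grind
  · refine ⟨j, μ.flip (x j.succ), fun v => funext fun l => ?_⟩
    simp only [contr, Function.update_apply, Fin.ext_iff, Fin.lt_def, Fin.val_castSucc, Fin.val_succ,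
      LinearMap.flip_apply]
    grind
  · refine ⟨j, μ (x j.castSucc), fun v => funext fun l => ?_⟩
    simp only [contr, Function.update_apply, Fin.ext_iff, Fin.lt_def, Fin.val_castSucc, Fin.val_succ]
    grind
  · refine ⟨⟨i - 1, by omega⟩, LinearMap.id, fun v => funext fun l => ?_⟩
    simp only [contr, Function.update_apply, Fin.ext_iff, Fin.lt_def, Fin.val_castSucc, Fin.val_succ,
      LinearMap.id_apply]
    grind

/-- `x₀ ⊗ ⋯ ⊗ xₙ₊₁ ↦ x₀ ⊗ ⋯ ⊗ μ(xⱼ, xⱼ₊₁) ⊗ ⋯ ⊗ xₙ₊₁`, as a multilinear map. -/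
def face (K : Subalgebra k C) (μ : C →ₗ[k] C →ₗ[k] C) (n : ℕ) (j : Fin (n + 1)) :
    MultilinearMap k (fun _ : Fin (n + 2) => C) (CycTensor K n) where
  toFun x := cls K n (contr μ j x)
  map_update_add' {inst} x i v w := by
    obtain rfl : inst = instDecidableEqFin _ := Subsingleton.elim _ _
    obtain ⟨a, f, h⟩ := contr_update μ j x i
    rw [h, h, h, map_add, MultilinearMap.map_update_add]
  map_update_smul' {inst} x i c v := by
    obtain rfl : inst = instDecidableEqFin _ := Subsingleton.elim _ _
    obtain ⟨a, f, h⟩ := contr_update μ j x i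
    rw [h, h, map_smul, MultilinearMap.map_update_smul]

/-- `(x₀, …, xₙ) ↦ (xᵢ, …, xₙ, x₀, …, xᵢ₋₁)` -/
def rot {X : Type*} {n : ℕ} (i : Fin (n + 1)) (x : Fin (n + 1) → X) : Fin (n + 1) → X := fun l => x (l + i)

/-- `μ` is a `K`-balanced map of `K`-bimodules which, as soon as one argument is in `K`, is `e` times
the multiplication of `C`. (Only used to check that maps are well defined.) -/
structure IsProd (K : Subalgebra k C) (μ : C →ₗ[k] C →ₗ[k] C) (e : k) : Prop where
  mid : ∀ c ∈ K, ∀ x y, μ (x * c) y = μ x (c * y)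
  left : ∀ c ∈ K, ∀ x y, μ (c * x) y = c * μ x y
  right : ∀ c ∈ K, ∀ x y, μ x (y * c) = μ x y * c
  one_left : ∀ c ∈ K, ∀ y, μ c y = e • (c * y)
  one_right : ∀ c ∈ K, ∀ y, μ y c = e • (y * c)

lemma val_add_one' {n : ℕ} (a : Fin (n + 1)) :
    ((a + 1 : Fin (n + 1)) : ℕ) = if (a : ℕ) = n then 0 else (a : ℕ) + 1 := by
  rw [Fin.val_add_one]; simp [Fin.ext_iff]

lemma exists_nat_ext {X : Type*} {n : ℕ} (x : Fin (n + 1) → X) :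
    ∃ y : ℕ → X, x = fun l : Fin (n + 1) => y l :=
  ⟨fun m => x (Fin.ofNat (n + 1) m), by funext l; simp⟩

lemma face_balanced {K : Subalgebra k C} {μ : C →ₗ[k] C →ₗ[k] C} {e : k} (hμ : IsProd K μ e)
    {n : ℕ} (l : Fin (n + 1)) (x : Fin (n + 2) → C) (j : Fin (n + 2)) (c : C) (hc : c ∈ K) :
    cls K n (contr μ l (Function.update x j (x j * c))) =
      cls K n (contr μ l (Function.update x (j + 1) (c * x (j + 1)))) := by
  have hj := val_add_one' j
  generalize hj' : j + 1 = j' at *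
  obtain ⟨y, rfl⟩ := exists_nat_ext x
  have hl := hμ.left c hc
  have hr := hμ.right c hc
  have hm := hμ.mid c hc
  obtain h | h | h : (j : ℕ) < l ∨ (j : ℕ) = l ∨ (l : ℕ) + 1 ≤ j := by omega
  · have ha := val_add_one' (⟨j, by omega⟩ : Fin (n + 1))
    refine cls_balanced ⟨j, by omega⟩ hc (contr μ l fun l => y l) _ _ (fun m => ?_) (fun m => ?_) <;>
    simp only [contr, Function.update_apply, Fin.ext_iff, Fin.lt_def, Fin.val_castSucc,
        Fin.val_succ, ha, hj] <;> grind
  · congr 1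
    funext m
    simp only [contr, Function.update_apply, Fin.ext_iff, Fin.lt_def, Fin.val_castSucc,
        Fin.val_succ, hj]
    grind
  · have ha := val_add_one' (⟨j - 1, by omega⟩ : Fin (n + 1))
    refine cls_balanced ⟨j - 1, by omega⟩ hc (contr μ l fun l => y l) _ _ (fun m => ?_) (fun m => ?_) <;>
    simp only [contr, Function.update_apply, Fin.ext_iff, Fin.lt_def, Fin.val_castSucc,
        Fin.val_succ, ha, hj] <;> grind

lemma rot_update {X : Type*} {n : ℕ} (i j : Fin (n + 1)) (x : Fin (n + 1) → X) (v : X) :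
    rot i (Function.update x j v) = Function.update (rot i x) (j - i) v := by
  funext l
  simp only [rot, Function.update_apply, eq_sub_iff_add_eq]

lemma rot_face_balanced {K : Subalgebra k C} {μ : C →ₗ[k] C →ₗ[k] C} {e : k} (hμ : IsProd K μ e)
    {n : ℕ} (i : Fin (n + 2)) (l : Fin (n + 1)) (x : Fin (n + 2) → C) (j : Fin (n + 2)) (c : C)
    (hc : c ∈ K) :
    cls K n (contr μ l (rot i (Function.update x j (x j * c)))) =
      cls K n (contr μ l (rot i (Function.update x (j + 1) (c * x (j + 1))))) := by
  have h := face_balanced hμ l (rot i x) (j - i) c hc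
  rw [rot_update, rot_update]
  have h1 : rot i x (j - i) = x j := by simp [rot]
  have h2 : rot i x (j - i + 1) = x (j + 1) := by
    simp only [rot]; congr 1; abel
  rw [h1, h2] at h
  rw [h]; congr 3; abel

/-- The Hochschild type boundary of the product `μ`,
`∑_{j ≤ n} (-1)^j x₀ ⊗ ⋯ ⊗ μ(xⱼ, xⱼ₊₁) ⊗ ⋯ ⊗ xₙ₊₁ + (-1)^{n+1} μ(xₙ₊₁, x₀) ⊗ x₁ ⊗ ⋯ ⊗ xₙ`;
see `hochMul_apply`. -/
def hochMul (K : Subalgebra k C) (μ : C →ₗ[k] C →ₗ[k] C) (n : ℕ) :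
    MultilinearMap k (fun _ : Fin (n + 2) => C) (CycTensor K n) :=
  (∑ j : Fin (n + 1), (-1 : k) ^ (j : ℕ) • face K μ n j) +
    (-1 : k) ^ (n + 1) • (face K μ n 0).domDomCongr (Equiv.addRight (Fin.last (n + 1)))

/-- The sum `∑_{j ≤ n} (-1)^j x₀ ⊗ ⋯ ⊗ μ(xⱼ, xⱼ₊₁) ⊗ ⋯ ⊗ xₙ₊₁`, without the cyclic term. -/
def hochMul' (K : Subalgebra k C) (μ : C →ₗ[k] C →ₗ[k] C) (n : ℕ) :
    MultilinearMap k (fun _ : Fin (n + 2) => C) (CycTensor K n) :=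
  ∑ j : Fin (n + 1), (-1 : k) ^ (j : ℕ) • face K μ n j

lemma hochMul'_apply (K : Subalgebra k C) (μ : C →ₗ[k] C →ₗ[k] C) (n : ℕ) (x : Fin (n + 2) → C) :
    hochMul' K μ n x = ∑ j : Fin (n + 1), (-1 : k) ^ (j : ℕ) • cls K n (contr μ j x) := by
  simp [hochMul', face]

lemma hochMul_apply (K : Subalgebra k C) (μ : C →ₗ[k] C →ₗ[k] C) (n : ℕ) (x : Fin (n + 2) → C) :
    hochMul K μ n x = (∑ j : Fin (n + 1), (-1 : k) ^ (j : ℕ) • cls K n (contr μ j x)) +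
      (-1 : k) ^ (n + 1) • cls K n (contr μ 0 (rot (Fin.last (n + 1)) x)) := by
  simp [hochMul, face]
  rfl

lemma val_add_last {n : ℕ} (a : Fin (n + 1)) :
    ((a + Fin.last n : Fin (n + 1)) : ℕ) = if (a : ℕ) = 0 then n else (a : ℕ) - 1 := by
  rw [Fin.val_add, Fin.val_last]
  split_ifs with h
  · simp [h]
  · rw [show (a : ℕ) + n = (a - 1) + (n + 1) by omega, Nat.add_mod_right, Nat.mod_eq_of_lt]; omega

lemma cls_contr_smul {K : Subalgebra k C} {μ : C →ₗ[k] C →ₗ[k] C} {e : k} {n : ℕ}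
    (l : Fin (n + 1)) (x : Fin (n + 2) → C)
    (h : μ (x l.castSucc) (x l.succ) = e • (x l.castSucc * x l.succ)) :
    cls K n (contr μ l x) = e • cls K n (contr (LinearMap.mul k C) l x) := by
  have h1 : contr (LinearMap.mul k C) l x =
      Function.update (contr μ l x) l (x l.castSucc * x l.succ) := by
    funext m; simp only [contr, Function.update_apply, LinearMap.mul_apply']; grind
  have h2 : contr μ l x = Function.update (contr μ l x) l (e • (x l.castSucc * x l.succ)) := by
    funext m; simp only [contr, Function.update_apply]; grind
  rw [h1, ← MultilinearMap.map_update_smul, ← h2]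

lemma cls_contr_degen {K : Subalgebra k C} (μ : C →ₗ[k] C →ₗ[k] C) {n : ℕ}
    (l : Fin (n + 1)) (x : Fin (n + 2) → C) {j : Fin (n + 2)} (hj : j ≠ 0) (hx : x j ∈ K)
    (h1 : (j : ℕ) ≠ l) (h2 : (j : ℕ) ≠ l + 1) : cls K n (contr μ l x) = 0 := by
  have hj0 : (j : ℕ) ≠ 0 := fun h => hj (Fin.ext h)
  obtain ⟨y, rfl⟩ := exists_nat_ext x
  obtain h | h : (j : ℕ) < l ∨ (l : ℕ) + 1 < j := by omega
  · refine cls_degen _ (j := ⟨j, by omega⟩) (fun h' => hj0 (congrArg Fin.val h')) ?_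
    simpa [contr, Fin.lt_def, h] using hx
  · refine cls_degen _ (j := ⟨j - 1, by omega⟩) (fun h' => by have := congrArg Fin.val h'; simp at this; omega) ?_
    have e1 : ¬ ((j : ℕ) - 1 < l) := by omega
    have e2 : ¬ ((j : ℕ) - 1 = l) := by omega
    have e3 : (j : ℕ) - 1 + 1 = j := by omega
    simpa [contr, Fin.lt_def, Fin.ext_iff, e1, e2, e3] using hx

lemma hochMul'_descends {K : Subalgebra k C} {μ : C →ₗ[k] C →ₗ[k] C} (hμ : IsProd K μ 0)
    (n : ℕ) : Descends K (hochMul' K μ n) where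
  balanced x j c hc := by
    simp only [hochMul'_apply, face_balanced hμ _ x j c hc]
  degen x j hj hx := by
    rw [hochMul'_apply]
    refine Finset.sum_eq_zero fun l _ => ?_
    by_cases h1 : (j : ℕ) = l
    · obtain rfl : j = l.castSucc := Fin.ext h1
      rw [cls_contr_smul l x (hμ.one_left _ hx _), zero_smul, smul_zero]
    by_cases h2 : (j : ℕ) = l + 1
    · obtain rfl : j = l.succ := Fin.ext h2
      rw [cls_contr_smul l x (hμ.one_right _ hx _), zero_smul, smul_zero]
    rw [cls_contr_degen μ l x hj hx h1 h2, smul_zero]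

lemma hochMul_descends {K : Subalgebra k C} {μ : C →ₗ[k] C →ₗ[k] C} {e : k} (hμ : IsProd K μ e)
    (n : ℕ) : Descends K (hochMul K μ n) where
  balanced x j c hc := by
    simp only [hochMul_apply, face_balanced hμ _ x j c hc, rot_face_balanced hμ _ _ x j c hc]
  degen x j hj hx := by
    rw [hochMul_apply]
    have hj0 : (j : ℕ) ≠ 0 := fun h => hj (Fin.ext h)
    obtain ⟨a, rfl⟩ : ∃ a : Fin (n + 1), j = a.succ := ⟨j.pred hj, by simp⟩
    have hA := cls_contr_smul (K := K) a x (hμ.one_right _ hx _)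
    have hrot : ∀ l : Fin (n + 2), rot (Fin.last (n + 1)) x l =
        x (if (l : ℕ) = 0 then Fin.last _ else ⟨l - 1, by omega⟩) := by
      intro l; simp only [rot]; congr 1; apply Fin.ext; rw [val_add_last]; split_ifs <;> rfl
    by_cases ha : (a : ℕ) = n
    · -- the entry is the last one
      obtain rfl : a = Fin.last n := Fin.ext ha
      rw [Finset.sum_eq_single (Fin.last n), hA]
      · have h0 := hrot 0
        have h1 := hrot 1
        simp only [Fin.coe_ofNat_eq_mod, Nat.zero_mod, if_true] at h0
        have hB := cls_contr_smul (K := K) (μ := μ) (e := e) 0 (rot (Fin.last (n + 1)) x) (by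
          rw [Fin.castSucc_zero, h0]; exact hμ.one_left _ hx _)
        rw [hB]
        have : cls K n (contr (LinearMap.mul k C) (Fin.last n) x) =
            cls K n (contr (LinearMap.mul k C) 0 (rot (Fin.last (n + 1)) x)) := by
          have hv := val_add_one' (Fin.last n)
          refine cls_balanced (Fin.last n) hx (fun l => x l.castSucc) _ _ (fun m => ?_) (fun m => ?_)
          · have := m.2
            simp only [contr, LinearMap.mul_apply']
            split_ifs with h1 h2
            · exact absurd h1 (by simp [h2])
            · rfl
            · rw [‹m = _›]
            · exact absurd (Fin.le_last m) (by rw [not_le]; exact lt_of_le_of_ne (not_lt.1 ‹_›) (Ne.symm ‹_›))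
          · simp only [contr, LinearMap.mul_apply', hrot]
            obtain ⟨y, rfl⟩ := exists_nat_ext x
            simp only [Fin.lt_def, Fin.ext_iff, Fin.val_succ, Fin.val_castSucc, hv, Fin.val_last,
              Fin.val_zero, if_true]
            grind
        rw [this, Fin.val_last, ← add_smul, pow_succ]
        simp
      · intro l _ hl
        rw [cls_contr_degen μ l x hj hx _ _, smul_zero]
        · have := l.2; simp only [Fin.val_succ, Fin.val_last]; omega
        · have hl' : (l : ℕ) ≠ n := fun h => hl (Fin.ext h)
          simp only [Fin.val_succ, Fin.val_last]; omega
      · simp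
    · -- an interior entry
      have ha' : (a : ℕ) + 1 < n + 1 := by omega
      obtain ⟨b, hb⟩ : ∃ b : Fin (n + 1), (b : ℕ) = a + 1 := ⟨⟨a + 1, ha'⟩, rfl⟩
      have hba : b.castSucc = a.succ := Fin.ext hb
      have hB := cls_contr_smul (K := K) (μ := μ) (e := e) b x (by
          rw [hba]; exact hμ.one_left _ hx _)
      have hw : cls K n (contr μ 0 (rot (Fin.last (n + 1)) x)) = 0 := by
        refine cls_degen _ (j := b) (fun h => by rw [h] at hb; simp at hb) ?_
        have hb0 : ¬ (b < 0) := by simp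
        have hb1 : b ≠ 0 := fun h => by rw [h] at hb; simp at hb
        simp only [contr, hb0, hb1, if_false, hrot]
        rw [if_neg (by simp)]
        convert hx using 2
        exact Fin.ext (by simpa using hb)
      have hab : a ≠ b := fun h => by rw [h] at hb; omega
      rw [hw, smul_zero, add_zero, Finset.sum_eq_add a b hab, hA, hB]
      · have : cls K n (contr (LinearMap.mul k C) a x) =
            cls K n (contr (LinearMap.mul k C) b x) := by
          have hv := val_add_one' a
          refine cls_balanced a hx
            (fun l => if l ≤ a then x l.castSucc else x l.succ) _ _ (fun m => ?_) (fun m => ?_) <;>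
          · obtain ⟨y, rfl⟩ := exists_nat_ext x
            simp only [contr, LinearMap.mul_apply', Fin.lt_def, Fin.ext_iff, Fin.val_succ,
              Fin.val_castSucc, hv, hb, Fin.le_def]
            grind
        rw [this, hb, ← add_smul, pow_succ]
        simp
      · intro l _ hl
        have h1 : (l : ℕ) ≠ a := fun h => hl.1 (Fin.ext h)
        have h2 : (l : ℕ) ≠ b := fun h => hl.2 (Fin.ext h)
        rw [cls_contr_degen μ l x hj hx _ _, smul_zero]
        · simp only [Fin.val_succ]; omega
        · simp only [Fin.val_succ]; omega
      · simp
      · simp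

end face

section normalized

/-- `x₀ ⊗ ⋯ ⊗ xₙ ↦ ∑ᵢ (-1)^{i n} 1 ⊗ xᵢ ⊗ ⋯ ⊗ xₙ ⊗ x₀ ⊗ ⋯ ⊗ xᵢ₋₁`; see `connesMul_apply`. -/
def connesMul (K : Subalgebra k C) (n : ℕ) :
    MultilinearMap k (fun _ : Fin (n + 1) => C) (CycTensor K (n + 1)) :=
  ∑ i : Fin (n + 1), (-1 : k) ^ ((i : ℕ) * n) •
    ((cls K (n + 1)).curryLeft 1).domDomCongr (Equiv.addRight i)

lemma connesMul_apply (K : Subalgebra k C) (n : ℕ) (x : Fin (n + 1) → C) :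
    connesMul K n x = ∑ i : Fin (n + 1), (-1 : k) ^ ((i : ℕ) * n) •
      cls K (n + 1) (Fin.cons 1 (rot i x)) := by
  simp [connesMul]
  rfl

lemma cons_one_balanced {K : Subalgebra k C} {n : ℕ} (y : Fin (n + 1) → C) (j : Fin (n + 1))
    (c : C) (hc : c ∈ K) :
    cls K (n + 1) (Fin.cons 1 (Function.update y j (y j * c))) =
      cls K (n + 1) (Fin.cons 1 (Function.update y (j + 1) (c * y (j + 1)))) := by
  have key : ∀ (a : Fin (n + 2)), cls K (n + 1) (Function.update (Fin.cons 1 y : Fin (n + 2) → C) a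
      ((Fin.cons 1 y : Fin (n + 2) → C) a * c)) = _ := fun a => cls_update _ a hc
  by_cases hj : j = Fin.last n
  · subst hj
    have h1 := key (Fin.last (n + 1))
    have h2 := key 0
    rw [Fin.last_add_one] at h1 ⊢
    rw [← Fin.succ_last, Fin.cons_succ, ← Fin.cons_update] at h1
    rw [h1]
    simp only [Fin.cons_zero, one_mul, mul_one] at h2 ⊢
    rw [h2, zero_add, ← Fin.succ_zero_eq_one, Fin.cons_succ, Fin.cons_update]
  · have h1 := key j.succ
    have h3 : j.succ + 1 = (j + 1).succ := by
      apply Fin.ext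
      have : (j : ℕ) ≠ n := fun h => hj (Fin.ext h)
      rw [val_add_one', Fin.val_succ, Fin.val_succ, val_add_one', if_neg this, if_neg (by omega)]
    rw [h3, Fin.cons_succ, Fin.cons_succ, ← Fin.cons_update, ← Fin.cons_update] at h1
    exact h1

lemma connesMul_descends (K : Subalgebra k C) (n : ℕ) : Descends K (connesMul K n) where
  balanced x j c hc := by
    simp only [connesMul_apply]
    refine Finset.sum_congr rfl fun i _ => ?_
    congr 1
    have h := cons_one_balanced (rot i x) (j - i) c hc
    have h1 : rot i x (j - i) = x j := by simp [rot]
    have h2 : rot i x (j - i + 1) = x (j + 1) := by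
      simp only [rot]; congr 1; abel
    rw [h1, h2] at h
    rw [rot_update, rot_update, h]; congr 3; abel
  degen x j hj hx := by
    rw [connesMul_apply]
    refine Finset.sum_eq_zero fun i _ => ?_
    rw [cls_degen _ (Fin.succ_ne_zero (j - i)), smul_zero]
    simpa [rot] using hx

lemma isProd_mul (K : Subalgebra k C) : IsProd K (LinearMap.mul k C) 1 where
  mid c _ x y := by simp [mul_assoc]
  left c _ x y := by simp [mul_assoc]
  right c _ x y := by simp [mul_assoc]
  one_left c _ y := by simp
  one_right c _ y := by simp

/-- A graded `k`-module `(Xₙ)_{n ≥ 0}` with maps `b` of degree `-1` and `B` of degree `+1`. It is a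
mixed complex if `b² = 0`, `B² = 0` and `bB + Bb = 0`. -/
structure MixedDiagram (k : Type*) [CommRing k] where
  X : ℕ → Type*
  [addCommGroup : ∀ n, AddCommGroup (X n)]
  [module : ∀ n, Module k (X n)]
  b : ∀ n, X (n + 1) →ₗ[k] X n
  B : ∀ n, X n →ₗ[k] X (n + 1)

attribute [instance] MixedDiagram.addCommGroup MixedDiagram.module

/-- The Hochschild boundary of the normalized mixed complex of the `K`-algebra `C`. -/
def hochschild (K : Subalgebra k C) (n : ℕ) : CycTensor K (n + 1) →ₗ[k] CycTensor K n :=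
  descend (hochMul K (LinearMap.mul k C) n) (hochMul_descends (isProd_mul K) n)

/-- The Connes operator of the normalized mixed complex of the `K`-algebra `C`. -/
def connes (K : Subalgebra k C) (n : ℕ) : CycTensor K n →ₗ[k] CycTensor K (n + 1) :=
  descend (connesMul K n) (connesMul_descends K n)

variable {D : Type*} [Ring D] [Algebra k D]

/-- The multilinear form of the map induced by `f`. -/
def mapMul (L : Subalgebra k D) (f : C →ₐ[k] D) (n : ℕ) :
    MultilinearMap k (fun _ : Fin (n + 1) => C) (CycTensor L n) :=
  (cls L n).compLinearMap fun _ => f.toLinearMap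

lemma mapMul_descends {K : Subalgebra k C} {L : Subalgebra k D} (f : C →ₐ[k] D)
    (hf : ∀ c ∈ K, f c ∈ L) (n : ℕ) : Descends K (mapMul L f n) where
  balanced x j c hc := by
    refine cls_balanced j (hf c hc) (fun l => f (x l)) _ _ (fun l => ?_) (fun l => ?_) <;>
    · simp only [AlgHom.toLinearMap_apply, Function.update_apply]
      split_ifs <;> simp
  degen x j hj hx := cls_degen _ hj (hf _ hx)

/-- The map `C ⊗ C̄^{⊗ n} ⊗ → D ⊗ D̄^{⊗ n} ⊗` induced by `f : C → D`. -/
def mapCyc {K : Subalgebra k C} {L : Subalgebra k D} (f : C →ₐ[k] D)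
    (hf : ∀ c ∈ K, f c ∈ L) (n : ℕ) : CycTensor K n →ₗ[k] CycTensor L n :=
  descend (mapMul L f n) (mapMul_descends f hf n)

lemma cyc_hom_ext {K : Subalgebra k C} {n : ℕ} {V : Type*} [AddCommGroup V] [Module k V]
    {f g : CycTensor K n →ₗ[k] V} (h : ∀ x, f (cls K n x) = g (cls K n x)) : f = g := by
  refine LinearMap.ext_on (span_cls (K := K) (n := n)) ?_
  rintro _ ⟨x, rfl⟩
  exact h x

lemma mapCyc_cls {K : Subalgebra k C} {L : Subalgebra k D} (f : C →ₐ[k] D)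
    (hf : ∀ c ∈ K, f c ∈ L) (n : ℕ) (x : Fin (n + 1) → C) :
    mapCyc f hf n (cls K n x) = cls L n (fun l => f (x l)) := by
  rw [mapCyc, descend_cls]; rfl

lemma mapCyc_b {K : Subalgebra k C} {L : Subalgebra k D} (f : C →ₐ[k] D)
    (hf : ∀ c ∈ K, f c ∈ L) (n : ℕ) :
    mapCyc f hf n ∘ₗ hochschild K n = hochschild L n ∘ₗ mapCyc f hf (n + 1) := by
  refine cyc_hom_ext fun x => ?_
  have h : ∀ (j : Fin (n + 1)) (x : Fin (n + 2) → C),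
      (fun l => f (contr (LinearMap.mul k C) j x l)) =
        contr (LinearMap.mul k D) j (fun l => f (x l)) := by
    intro j x; funext l; simp only [contr]; split_ifs <;> simp
  simp only [LinearMap.comp_apply, hochschild, descend_cls, mapCyc_cls, hochMul_apply,
    map_add, map_sum, map_smul, h]
  rfl

lemma mapCyc_B {K : Subalgebra k C} {L : Subalgebra k D} (f : C →ₐ[k] D)
    (hf : ∀ c ∈ K, f c ∈ L) (n : ℕ) :
    mapCyc f hf (n + 1) ∘ₗ connes K n = connes L n ∘ₗ mapCyc f hf n := by
  refine cyc_hom_ext fun x => ?_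
  have h : ∀ (x : Fin (n + 1) → C), (fun l => f ((Fin.cons 1 x : Fin (n + 2) → C) l)) =
        (Fin.cons 1 (fun l => f (x l)) : Fin (n + 2) → D) := by
    intro x; funext l; refine Fin.cases ?_ (fun l => ?_) l <;> simp
  simp only [LinearMap.comp_apply, connes, descend_cls, mapCyc_cls, connesMul_apply,
    map_sum, map_smul, h]
  rfl

/-- The kernel of the morphism of normalized mixed complexes
`(C ⊗ C̄^{⊗ *} ⊗, b, B) → (D ⊗ D̄^{⊗ *} ⊗, b, B)` induced by `f`. -/
def relativeMixed {K : Subalgebra k C} {L : Subalgebra k D} (f : C →ₐ[k] D)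
    (hf : ∀ c ∈ K, f c ∈ L) : MixedDiagram k where
  X n := LinearMap.ker (mapCyc f hf n)
  b n := (hochschild K n).restrict fun z hz => by
    rw [LinearMap.mem_ker] at hz ⊢
    have := LinearMap.congr_fun (mapCyc_b f hf n) z
    simpa [hz] using this
  B n := (connes K n).restrict fun z hz => by
    rw [LinearMap.mem_ker] at hz ⊢
    have := LinearMap.congr_fun (mapCyc_B f hf n) z
    simpa [hz] using this

end normalized

section homology

/-- The homology `ker g / im f` at the middle of `f : U → V`, `g : V → W`. -/
abbrev Homology {U V W : Type*} [AddCommGroup U] [AddCommGroup V] [AddCommGroup W] [Module k U]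
    [Module k V] [Module k W] (f : U →ₗ[k] V) (g : V →ₗ[k] W) : Type _ :=
  LinearMap.ker g ⧸ (LinearMap.range f).submoduleOf (LinearMap.ker g)

namespace MixedDiagram

variable (𝓜 : MixedDiagram k) (S : Set ℤ)

/-- The pairs `(i, q)` with `i ∈ S` for which `X_q uⁱ` has total degree `n`. -/
abbrev TotIdx (S : Set ℤ) (n : ℤ) : Type := {i : ℤ × ℕ // i.1 ∈ S ∧ 2 * i.1 + i.2 = n}

/-- The degree `n` part `∏_{i ∈ S} X_{n - 2i} uⁱ` of the total complex of the double complex that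
consists of the columns `X uⁱ`, `i ∈ S`, of `BP(X, b, B)`. -/
abbrev Tot (n : ℤ) : Type _ := ∀ i : TotIdx S n, 𝓜.X i.1.2

open Classical in
/-- The component of the differential that comes from `B(x uⁱ⁺¹) = B(x) uⁱ`. -/
def totB {n m : ℤ} (h : m + 1 = n) : ∀ i : TotIdx S m, 𝓜.Tot S n →ₗ[k] 𝓜.X i.1.2
  | ⟨(_, 0), _⟩ => 0
  | ⟨(i, q + 1), hi⟩ =>
    if hS : i + 1 ∈ S then
      𝓜.B q ∘ₗ LinearMap.proj (φ := fun i : TotIdx S n => 𝓜.X i.1.2)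
        ⟨(i + 1, q), hS, by have := hi.2; push_cast at this ⊢; omega⟩
    else 0

/-- The differential `b + B`, where `b(x uⁱ) = b(x) uⁱ` and `B(x uⁱ⁺¹) = B(x) uⁱ`, the latter being
zero if one of the two columns has been deleted. -/
def totD {n m : ℤ} (h : m + 1 = n) : 𝓜.Tot S n →ₗ[k] 𝓜.Tot S m :=
  LinearMap.pi fun i =>
    𝓜.b i.1.2 ∘ₗ LinearMap.proj (φ := fun i : TotIdx S n => 𝓜.X i.1.2)
      ⟨(i.1.1, i.1.2 + 1), i.2.1, by have := i.2.2; push_cast; omega⟩ +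
    𝓜.totB S h i

/-- The homology in degree `n` of the total complex of the columns in `S`. -/
abbrev H (n : ℤ) : Type _ :=
  Homology (𝓜.totD S (n := n + 1) (m := n) rfl) (𝓜.totD S (n := n) (m := n - 1) (by omega))

/-- Hochschild homology: the homology of `(X, b)`, the column `u⁰`. -/
abbrev HH (n : ℤ) : Type _ := 𝓜.H {0} n
/-- Cyclic homology: the columns `uⁱ` with `i ≥ 0`, which form `BC`. -/
abbrev HC (n : ℤ) : Type _ := 𝓜.H (Set.Ici 0) n
/-- Periodic homology: all columns, which form `BP`. -/
abbrev HP (n : ℤ) : Type _ := 𝓜.H Set.univ n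
/-- Negative homology: the columns `uⁱ` with `i ≤ 0`, which form `BN`. -/
abbrev HN (n : ℤ) : Type _ := 𝓜.H (Set.Iic 0) n

end MixedDiagram

/-- A triple diagram of `k`-modules `X u v w` with `u ∈ ℤ` and `v, w ≥ 0` (the modules with `v < 0` or
`w < 0` being zero), and maps `dh`, `dv`, `dd` that lower `u`, `v`, `w` by one, respectively.
The maps are indexed by their target. -/
structure TripleDiagram (k : Type*) [CommRing k] where
  X : ℤ → ℕ → ℕ → Type*
  [addCommGroup : ∀ u v w, AddCommGroup (X u v w)]
  [module : ∀ u v w, Module k (X u v w)]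
  dh : ∀ u v w, X (u + 1) v w →ₗ[k] X u v w
  dv : ∀ u v w, X u (v + 1) w →ₗ[k] X u v w
  dd : ∀ u v w, X u v (w + 1) →ₗ[k] X u v w

attribute [instance] TripleDiagram.addCommGroup TripleDiagram.module

namespace TripleDiagram

variable (𝓧 : TripleDiagram k)

/-- The three maps have square zero and anticommute. -/
structure IsTripleComplex : Prop where
  dh_dh : ∀ u v w, 𝓧.dh u v w ∘ₗ 𝓧.dh (u + 1) v w = 0
  dv_dv : ∀ u v w, 𝓧.dv u v w ∘ₗ 𝓧.dv u (v + 1) w = 0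
  dd_dd : ∀ u v w, 𝓧.dd u v w ∘ₗ 𝓧.dd u v (w + 1) = 0
  dh_dv : ∀ u v w, 𝓧.dh u v w ∘ₗ 𝓧.dv (u + 1) v w + 𝓧.dv u v w ∘ₗ 𝓧.dh u (v + 1) w = 0
  dh_dd : ∀ u v w, 𝓧.dh u v w ∘ₗ 𝓧.dd (u + 1) v w + 𝓧.dd u v w ∘ₗ 𝓧.dh u v (w + 1) = 0
  dv_dd : ∀ u v w, 𝓧.dv u v w ∘ₗ 𝓧.dd u (v + 1) w + 𝓧.dd u v w ∘ₗ 𝓧.dv u v (w + 1) = 0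

/-- The triples of total degree `n`. -/
abbrev TotIdx (n : ℤ) : Type := {i : ℤ × ℕ × ℕ // i.1 + i.2.1 + i.2.2 = n}

/-- The degree `n` part `∏_{u + v + w = n} X u v w` of the total complex. -/
abbrev Tot (n : ℤ) : Type _ := ∀ i : TotIdx n, 𝓧.X i.1.1 i.1.2.1 i.1.2.2

/-- The projection of the total complex to one component. -/
abbrev totProj {n : ℤ} (u : ℤ) (v w : ℕ) (h : u + v + w = n) : 𝓧.Tot n →ₗ[k] 𝓧.X u v w :=
  LinearMap.proj (φ := fun i : TotIdx n => 𝓧.X i.1.1 i.1.2.1 i.1.2.2) ⟨(u, v, w), h⟩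

/-- The differential `dh + dv + dd` of the total complex. -/
def totD {n m : ℤ} (h : m + 1 = n) : 𝓧.Tot n →ₗ[k] 𝓧.Tot m :=
  LinearMap.pi fun ⟨(u, v, w), hi⟩ =>
    𝓧.dh u v w ∘ₗ 𝓧.totProj (u + 1) v w (by simp only at hi; omega) +
    𝓧.dv u v w ∘ₗ 𝓧.totProj u (v + 1) w (by simp only at hi; push_cast; omega) +
    𝓧.dd u v w ∘ₗ 𝓧.totProj u v (w + 1) (by simp only at hi; push_cast; omega)

/-- The homology of the total complex in degree `n`. -/
abbrev H (n : ℤ) : Type _ :=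
  Homology (𝓧.totD (n := n + 1) (m := n) rfl) (𝓧.totD (n := n) (m := n - 1) (by omega))

/-- `X u v w` if `u ∈ S`, and zero otherwise. -/
def truncMod (S : Set ℤ) (u : ℤ) (v w : ℕ) : Submodule k (𝓧.X u v w) where
  carrier := {x | u ∉ S → x = 0}
  add_mem' hx hy hu := by rw [hx hu, hy hu, add_zero]
  zero_mem' _ := rfl
  smul_mem' c x hx hu := by rw [hx hu, smul_zero]

open Classical in
/-- The map induced by `f`; zero if the target lies in a deleted column. -/
def truncMap (S : Set ℤ) {u u' : ℤ} {v v' w w' : ℕ} (f : 𝓧.X u v w →ₗ[k] 𝓧.X u' v' w') :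
    𝓧.truncMod S u v w →ₗ[k] 𝓧.truncMod S u' v' w' :=
  LinearMap.codRestrict _ (if u' ∈ S then f ∘ₗ (𝓧.truncMod S u v w).subtype else 0)
    fun x hu => by simp [hu]

/-- The diagram obtained by deleting the columns whose index `u` is not in `S`. For `S = {u ≤ l}` this
is the subdiagram `τ^l`, for `S = {u ≥ 0}` the quotient `τ_0` of the diagram by `τ^{-1}`, and for
`S = {0, 1}` the quotient `τ_0^1` of `τ^1` by `τ^{-1}`. -/
def trunc (S : Set ℤ) : TripleDiagram k where
  X u v w := 𝓧.truncMod S u v w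
  dh u v w := 𝓧.truncMap S (𝓧.dh u v w)
  dv u v w := 𝓧.truncMap S (𝓧.dv u v w)
  dd u v w := 𝓧.truncMap S (𝓧.dd u v w)

end TripleDiagram
end homology

/-- A cleft extension of the `k`-algebra `A`: a `k`-algebra `E` with morphisms of `k`-algebras
`p : E → A` and `i : A → E` such that `p ∘ i = id`. Then `E` is the direct sum of `i(A)`, a copy of
`A`, and of `M = ker p`, an `A`-bimodule through `i`, and the product `M × M → M` of `E` is the
associative `A`-bimodule map `m ⊗ m' ↦ m ▽ m'` with `E = A ⋉_▽ M`. -/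
structure CleftExtension (k A E : Type*) [CommRing k] [Ring A] [Algebra k A] [Ring E]
    [Algebra k E] where
  p : E →ₐ[k] A
  i : A →ₐ[k] E
  p_i : ∀ a, p (i a) = a

namespace CleftExtension

variable {A E : Type*} [Ring A] [Algebra k A] [Ring E] [Algebra k E]
  (𝓔 : CleftExtension k A E) (K : Subalgebra k A)

/-- The subalgebra `K` of `A`, viewed as a subalgebra of `E`. -/
abbrev base : Subalgebra k E := K.map 𝓔.i

/-- `M = ker p`. -/
abbrev M : Submodule k E := LinearMap.ker 𝓔.p.toLinearMap

/-- The copy `i(A)` of `A` in `E`. -/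
abbrev copyA : Submodule k E := LinearMap.range 𝓔.i.toLinearMap

lemma p_base : ∀ c ∈ 𝓔.base K, 𝓔.p c ∈ K := by
  rintro _ ⟨a, ha, rfl⟩
  exact (𝓔.p_i a).symm ▸ ha

/-- The mixed complex `ker ((E ⊗ Ē^{⊗ *} ⊗, b, B) → (A ⊗ Ā^{⊗ *} ⊗, b, B))`, whose homologies are those
of the `K`-algebra `E` relative to `M`; here `E / M` is identified with `A` by means of `p`. -/
def relMixed : MixedDiagram k := relativeMixed 𝓔.p (𝓔.p_base K)

/-- The projection of `E` onto `i(A)` along `M`. -/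
def piA : E →ₗ[k] E := 𝓔.i.toLinearMap ∘ₗ 𝓔.p.toLinearMap

/-- The projection of `E` onto `M` along `i(A)`. -/
def piM : E →ₗ[k] E := LinearMap.id - 𝓔.piA

/-- The bilinear map `x ▽ y` of `E`: the product of `E` if `x, y ∈ M`, and zero if `x ∈ A` or `y ∈ A`. -/
def tri : E →ₗ[k] E →ₗ[k] E := (LinearMap.mul k E).compl₁₂ 𝓔.piM 𝓔.piM

/-- The bilinear product `xy` of `E` that is the product of `E` if `x ∈ A` or `y ∈ A`, and zero if
`x, y ∈ M`. -/
def dot : E →ₗ[k] E →ₗ[k] E := LinearMap.mul k E - 𝓔.tri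

lemma piA_apply (x : E) : 𝓔.piA x = 𝓔.i (𝓔.p x) := rfl

lemma piM_apply (x : E) : 𝓔.piM x = x - 𝓔.i (𝓔.p x) := rfl

lemma tri_apply (x y : E) : 𝓔.tri x y = 𝓔.piM x * 𝓔.piM y := rfl

lemma dot_apply (x y : E) : 𝓔.dot x y = x * y - 𝓔.piM x * 𝓔.piM y := rfl

variable {K} in
lemma piA_of_mem {c : E} (hc : c ∈ 𝓔.base K) : 𝓔.piA c = c := by
  obtain ⟨a, -, rfl⟩ := hc
  exact congrArg 𝓔.i (𝓔.p_i a)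

lemma piA_mul (x y : E) : 𝓔.piA (x * y) = 𝓔.piA x * 𝓔.piA y := by simp [piA_apply]

variable {K} in
lemma piM_of_mem {c : E} (hc : c ∈ 𝓔.base K) : 𝓔.piM c = 0 := by
  rw [piM, LinearMap.sub_apply, 𝓔.piA_of_mem hc, LinearMap.id_apply, sub_self]

variable {K} in
lemma piM_mul_right {c : E} (hc : c ∈ 𝓔.base K) (x : E) : 𝓔.piM (x * c) = 𝓔.piM x * c := by
  simp only [piM, LinearMap.sub_apply, piA_mul, 𝓔.piA_of_mem hc, LinearMap.id_apply, sub_mul]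

variable {K} in
lemma piM_mul_left {c : E} (hc : c ∈ 𝓔.base K) (x : E) : 𝓔.piM (c * x) = c * 𝓔.piM x := by
  simp only [piM, LinearMap.sub_apply, piA_mul, 𝓔.piA_of_mem hc, LinearMap.id_apply, mul_sub]

lemma isProd_tri : IsProd (𝓔.base K) 𝓔.tri 0 where
  mid c hc x y := by simp [tri_apply, 𝓔.piM_mul_left hc, 𝓔.piM_mul_right hc, mul_assoc]
  left c hc x y := by simp [tri_apply, 𝓔.piM_mul_left hc, mul_assoc]
  right c hc x y := by simp [tri_apply, 𝓔.piM_mul_right hc, mul_assoc]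
  one_left c hc y := by simp [tri_apply, 𝓔.piM_of_mem hc]
  one_right c hc y := by simp [tri_apply, 𝓔.piM_of_mem hc]

lemma isProd_dot : IsProd (𝓔.base K) 𝓔.dot 1 where
  mid c hc x y := by simp [dot_apply, 𝓔.piM_mul_left hc, 𝓔.piM_mul_right hc, mul_assoc]
  left c hc x y := by simp [dot_apply, 𝓔.piM_mul_left hc, mul_assoc, mul_sub]
  right c hc x y := by simp [dot_apply, 𝓔.piM_mul_right hc, mul_assoc, sub_mul]
  one_left c hc y := by simp [dot_apply, 𝓔.piM_of_mem hc]
  one_right c hc y := by simp [dot_apply, 𝓔.piM_of_mem hc]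

/-- `b = ∑_{j ≤ n} μⱼ`, formed with the product `dot`. -/
def b (n : ℕ) : CycTensor (𝓔.base K) (n + 1) →ₗ[k] CycTensor (𝓔.base K) n :=
  descend (hochMul (𝓔.base K) 𝓔.dot n) (hochMul_descends (𝓔.isProd_dot K) n)

/-- `d = ∑_{j ≤ n} ϱⱼ`, formed with the product `tri`. -/
def d (n : ℕ) : CycTensor (𝓔.base K) (n + 1) →ₗ[k] CycTensor (𝓔.base K) n :=
  descend (hochMul (𝓔.base K) 𝓔.tri n) (hochMul_descends (𝓔.isProd_tri K) n)

/-- The sum `∑_{j < n} ϱⱼ`. -/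
def d' (n : ℕ) : CycTensor (𝓔.base K) (n + 1) →ₗ[k] CycTensor (𝓔.base K) n :=
  descend (hochMul' (𝓔.base K) 𝓔.tri n) (hochMul'_descends (𝓔.isProd_tri K) n)

/-- The maps whose tensor product over `l` selects the tensors such that the last entry in `M` is the
`i`-th one: the projection to `M` at `l = i`, the projection to `A` for `l > i`. -/
def lastProj {n : ℕ} (i l : Fin (n + 1)) : E →ₗ[k] E :=
  if l < i then LinearMap.id else if l = i then 𝓔.piM else 𝓔.piA

/-- The multilinear form of `t`. A simple tensor with entries in `A ∪ M`, not all of them in `A`, is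
mapped to `(-1)^{i n} xᵢ ⊗ ⋯ ⊗ xₙ ⊗ x₀ ⊗ ⋯ ⊗ xᵢ₋₁`, where `i` is the last index with `xᵢ ∈ M`: only
this one of the summands is different from zero. -/
def tMul (n : ℕ) : MultilinearMap k (fun _ : Fin (n + 1) => E) (CycTensor (𝓔.base K) n) :=
  ∑ i : Fin (n + 1), (-1 : k) ^ ((i : ℕ) * n) •
    ((cls (𝓔.base K) n).domDomCongr (Equiv.addRight i)).compLinearMap fun l => 𝓔.lastProj i l

lemma tMul_apply (n : ℕ) (x : Fin (n + 1) → E) :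
    𝓔.tMul K n x = ∑ i : Fin (n + 1), (-1 : k) ^ ((i : ℕ) * n) •
      cls (𝓔.base K) n (rot i fun l => 𝓔.lastProj i l (x l)) := by
  simp [tMul]
  rfl

variable {K} in
lemma lastProj_mul_right {n : ℕ} (i l : Fin (n + 1)) {c : E} (hc : c ∈ 𝓔.base K) (x : E) :
    𝓔.lastProj i l (x * c) = 𝓔.lastProj i l x * c := by
  unfold lastProj
  split_ifs
  · rfl
  · exact 𝓔.piM_mul_right hc x
  · rw [piA_mul, 𝓔.piA_of_mem hc]

variable {K} in
lemma lastProj_mul_left {n : ℕ} (i l : Fin (n + 1)) {c : E} (hc : c ∈ 𝓔.base K) (x : E) :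
    𝓔.lastProj i l (c * x) = c * 𝓔.lastProj i l x := by
  unfold lastProj
  split_ifs
  · rfl
  · exact 𝓔.piM_mul_left hc x
  · rw [piA_mul, 𝓔.piA_of_mem hc]

lemma tMul_descends (n : ℕ) : Descends (𝓔.base K) (𝓔.tMul K n) where
  balanced x j c hc := by
    simp only [tMul_apply]
    refine Finset.sum_congr rfl fun i _ => ?_
    congr 1
    refine cls_balanced (j - i) hc (rot i fun l => 𝓔.lastProj i l (x l)) _ _
      (fun l => ?_) (fun l => ?_)
    · simp only [rot, Function.update_apply, ← eq_sub_iff_add_eq]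
      split_ifs with h
      · rw [𝓔.lastProj_mul_right i _ hc, h, sub_add_cancel]
      · rfl
    · have e : j - i + 1 + i = j + 1 := by abel
      have e' : l + i = j + 1 ↔ l = j - i + 1 := by rw [← e]; simp
      simp only [rot, Function.update_apply, e, e']
      split_ifs with h
      · rw [𝓔.lastProj_mul_left i _ hc, h, e]
      · rfl
  degen x j hj hx := by
    rw [tMul_apply]
    refine Finset.sum_eq_zero fun i _ => ?_
    by_cases hij : j = i
    · subst hij
      rw [(cls (𝓔.base K) n).map_coord_zero 0, smul_zero]
      simp [rot, lastProj, 𝓔.piM_of_mem hx]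
    · rw [cls_degen _ (sub_ne_zero.2 hij), smul_zero]
      simp only [rot, sub_add_cancel, lastProj, if_neg hij]
      split_ifs
      · exact hx
      · rw [𝓔.piA_of_mem hx]; exact hx

/-- The map `t`. -/
def t (n : ℕ) : CycTensor (𝓔.base K) n →ₗ[k] CycTensor (𝓔.base K) n :=
  descend (𝓔.tMul K n) (𝓔.tMul_descends K n)

/-- `M ⊗ B^n_w ⊗ ⊆ E ⊗ Ē^{⊗ n} ⊗`, spanned by the tensors `x₀ ⊗ ⋯ ⊗ xₙ` such that `x₀ ∈ M`, exactly `w`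
of `x₁, …, xₙ` are in `M` and the other ones in `A`. It is zero if `n < w`. In bidegree `(v, w)` one
takes `n = v + w`. -/
def X (n w : ℕ) : Submodule k (CycTensor (𝓔.base K) n) :=
  Submodule.span k {z | ∃ (x : Fin (n + 1) → E) (S : Finset (Fin n)), S.card = w ∧
    x 0 ∈ 𝓔.M ∧ (∀ j, j ∈ S → x j.succ ∈ 𝓔.M) ∧ (∀ j, j ∉ S → x j.succ ∈ 𝓔.copyA) ∧
    z = cls (𝓔.base K) n x}

/-- The graded pieces `A`, `M`, `0`, `0`, … of `E`. -/
def gr : ℕ → Submodule k E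
  | 0 => 𝓔.copyA
  | 1 => 𝓔.M
  | _ => ⊥

lemma X_of_gr {n w : ℕ} (x : Fin (n + 1) → E) (c : Fin (n + 1) → ℕ) (hx : ∀ l, x l ∈ 𝓔.gr (c l))
    (h0 : c 0 ≠ 0) (hc : ∑ l, c l = w + 1) : cls (𝓔.base K) n x ∈ 𝓔.X K n w := by
  by_cases h : ∃ l, 2 ≤ c l
  · obtain ⟨l, hl⟩ := h
    have hl' := hx l
    obtain ⟨m, hm⟩ := Nat.exists_eq_add_of_le' hl
    rw [hm] at hl'
    rw [(cls (𝓔.base K) n).map_coord_zero l ((Submodule.mem_bot k).1 hl')]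
    exact Submodule.zero_mem _
  · push Not at h
    have h1 : c 0 = 1 := by have := h 0; omega
    rw [Fin.sum_univ_succ, h1] at hc
    refine Submodule.subset_span ⟨x, Finset.univ.filter fun j => c j.succ = 1, ?_, ?_, ?_, ?_, rfl⟩
    · rw [Finset.card_filter]
      have : ∀ j : Fin n, (if c j.succ = 1 then 1 else 0) = c j.succ := by
        intro j; have := h j.succ; split_ifs <;> omega
      simp only [this]; omega
    · have := hx 0; rwa [h1] at this
    · intro j hj
      have := hx j.succ
      rwa [(Finset.mem_filter.1 hj).2] at this
    · intro j hj
      have hj' : c j.succ = 0 := by have := h j.succ; simp at hj; omega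
      have := hx j.succ
      rwa [hj'] at this

lemma X_le {n w : ℕ} {N : Submodule k (CycTensor (𝓔.base K) n)}
    (h : ∀ (x : Fin (n + 1) → E) (c : Fin (n + 1) → ℕ), (∀ l, x l ∈ 𝓔.gr (c l)) → c 0 = 1 →
      ∑ l, c l = w + 1 → cls (𝓔.base K) n x ∈ N) : 𝓔.X K n w ≤ N := by
  refine Submodule.span_le.2 ?_
  rintro z ⟨x, S, hS, h0, h1, h2, rfl⟩
  classical
  refine h x (Fin.cons 1 fun j => if j ∈ S then 1 else 0) ?_ rfl ?_
  · intro l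
    refine Fin.cases ?_ (fun j => ?_) l
    · exact h0
    · rw [Fin.cons_succ]
      split_ifs with hj
      · exact h1 j hj
      · exact h2 j hj
  · rw [Fin.sum_univ_succ]
    simp [hS, add_comm]

lemma piM_gr_zero {x : E} (hx : x ∈ 𝓔.gr 0) : 𝓔.piM x = 0 := by
  obtain ⟨a, rfl⟩ := hx
  simp [piM_apply, 𝓔.p_i]

lemma piM_gr_one {x : E} (hx : x ∈ 𝓔.gr 1) : 𝓔.piM x = x := by
  have hx' : 𝓔.p x = 0 := hx
  simp [piM_apply, hx']

lemma piM_gr {a : ℕ} {x : E} (hx : x ∈ 𝓔.gr a) : 𝓔.piM x ∈ 𝓔.gr a := by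
  match a, hx with
  | 0, hx => rw [𝓔.piM_gr_zero hx]; exact Submodule.zero_mem _
  | 1, hx => rw [𝓔.piM_gr_one hx]; exact hx
  | a + 2, hx => rw [(Submodule.mem_bot k).1 hx, map_zero]; exact Submodule.zero_mem _

lemma piA_gr {a : ℕ} {x : E} (hx : x ∈ 𝓔.gr a) : 𝓔.piA x ∈ 𝓔.gr a := by
  have : 𝓔.piA x = x - 𝓔.piM x := by simp [piM_apply, piA_apply]
  rw [this]
  exact Submodule.sub_mem _ hx (𝓔.piM_gr hx)

lemma lastProj_gr {n : ℕ} (i l : Fin (n + 1)) {a : ℕ} {x : E} (hx : x ∈ 𝓔.gr a) :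
    𝓔.lastProj i l x ∈ 𝓔.gr a := by
  unfold lastProj
  split_ifs
  exacts [hx, 𝓔.piM_gr hx, 𝓔.piA_gr hx]

lemma dot_gr {a c : ℕ} {x y : E} (hx : x ∈ 𝓔.gr a) (hy : y ∈ 𝓔.gr c) :
    𝓔.dot x y ∈ 𝓔.gr (a + c) := by
  match a, c, hx, hy with
  | a + 2, c, hx, hy =>
    rw [(Submodule.mem_bot k).1 hx, map_zero]; exact Submodule.zero_mem _
  | a, c + 2, hx, hy =>
    rw [(Submodule.mem_bot k).1 hy, map_zero]; exact Submodule.zero_mem _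
  | 0, 0, hx, hy =>
    rw [dot_apply, 𝓔.piM_gr_zero hx, zero_mul, sub_zero]
    obtain ⟨x, rfl⟩ := hx
    obtain ⟨y, rfl⟩ := hy
    exact ⟨x * y, by simp⟩
  | 0, 1, hx, hy =>
    rw [dot_apply, 𝓔.piM_gr_zero hx, zero_mul, sub_zero]
    have hy' : 𝓔.p y = 0 := hy
    change 𝓔.p (x * y) = 0
    rw [map_mul, hy', mul_zero]
  | 1, 0, hx, hy =>
    rw [dot_apply, 𝓔.piM_gr_zero hy, mul_zero, sub_zero]
    have hx' : 𝓔.p x = 0 := hx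
    change 𝓔.p (x * y) = 0
    rw [map_mul, hx', zero_mul]
  | 1, 1, hx, hy =>
    rw [dot_apply, 𝓔.piM_gr_one hx, 𝓔.piM_gr_one hy, sub_self]
    exact Submodule.zero_mem _

lemma tri_mem (x y : E) : 𝓔.tri x y ∈ 𝓔.gr 1 := by
  change 𝓔.p (𝓔.tri x y) = 0
  simp [tri_apply, piM_apply, 𝓔.p_i]

/-- The degrees of the entries after two neighbours have been multiplied. -/
def contrDeg {n : ℕ} (j : Fin (n + 1)) (c : Fin (n + 2) → ℕ) : Fin (n + 1) → ℕ := fun l =>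
  if l < j then c l.castSucc else if l = j then c l.castSucc + c l.succ else c l.succ

lemma sum_contrDeg {n : ℕ} (j : Fin (n + 1)) (c : Fin (n + 2) → ℕ) :
    ∑ l, contrDeg j c l = ∑ l, c l := by
  rw [Fin.sum_univ_succAbove c j.succ]
  have : ∀ l, contrDeg j c l = (if l = j then c j.succ else 0) + c (j.succ.succAbove l) := by
    intro l
    unfold contrDeg
    split_ifs with h1 h2 h3
    · exact absurd h1 (by simp [h2])
    · rw [Fin.succAbove_of_castSucc_lt _ _ (by
        rw [Fin.lt_def] at h1 ⊢; simp only [Fin.val_castSucc, Fin.val_succ]; omega), zero_add]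
    · subst h3
      rw [Fin.succAbove_of_castSucc_lt _ _ (by
        rw [Fin.lt_def]; simp), add_comm]
    · rw [Fin.succAbove_of_le_castSucc _ _ (by
        have := lt_of_le_of_ne (not_lt.1 h1) (Ne.symm h3)
        rw [Fin.lt_def] at this
        rw [Fin.le_def]; simp only [Fin.val_castSucc, Fin.val_succ]; omega), zero_add]
  simp only [this, Finset.sum_add_distrib]
  simp

lemma dot_contr_mem {n w : ℕ} (j : Fin (n + 1)) (x : Fin (n + 2) → E) (c : Fin (n + 2) → ℕ)
    (hx : ∀ l, x l ∈ 𝓔.gr (c l)) (h0 : c 0 ≠ 0 ∨ (j = 0 ∧ c 1 ≠ 0)) (hc : ∑ l, c l = w + 1) :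
    cls (𝓔.base K) n (contr 𝓔.dot j x) ∈ 𝓔.X K n w := by
  refine 𝓔.X_of_gr K _ (contrDeg j c) (fun l => ?_) ?_ ((sum_contrDeg j c).trans hc)
  · unfold contr contrDeg
    split_ifs
    exacts [hx _, 𝓔.dot_gr (hx _) (hx _), hx _]
  · unfold contrDeg
    obtain h0 | ⟨rfl, h0⟩ := h0
    · split_ifs with h1 h2
      · exact h0
      · simp only [Fin.castSucc_zero]; omega
      · exact absurd (Fin.pos_of_ne_zero (Ne.symm h2)) h1
    · simp only [lt_self_iff_false, if_false, if_true, Fin.castSucc_zero, Fin.succ_zero_eq_one]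
      omega

lemma tri_contr_mem {n w : ℕ} (j : Fin (n + 1)) (x : Fin (n + 2) → E) (c : Fin (n + 2) → ℕ)
    (hx : ∀ l, x l ∈ 𝓔.gr (c l)) (h0 : c 0 ≠ 0 ∨ j = 0) (hc : ∑ l, c l = w + 2) :
    cls (𝓔.base K) n (contr 𝓔.tri j x) ∈ 𝓔.X K n w := by
  by_cases h : 𝓔.tri (x j.castSucc) (x j.succ) = 0
  · rw [(cls (𝓔.base K) n).map_coord_zero j (by simp [contr, h])]
    exact Submodule.zero_mem _
  have key : ∀ l, 𝓔.piM (x l) ≠ 0 → c l = 1 := by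
    intro l hl
    have := hx l
    match hcl : c l with
    | 0 => rw [hcl] at this; exact absurd (𝓔.piM_gr_zero this) hl
    | 1 => rfl
    | m + 2 =>
      rw [hcl] at this
      rw [(Submodule.mem_bot k).1 this, map_zero] at hl
      exact absurd rfl hl
  have h1 : c j.castSucc = 1 := key _ fun h' => h (by rw [tri_apply, h', zero_mul])
  have h2 : c j.succ = 1 := key _ fun h' => h (by rw [tri_apply, h', mul_zero])
  have hs := sum_contrDeg j c
  have hcj : contrDeg j c j = 2 := by simp [contrDeg, h1, h2]
  have hs' : ∑ l, Function.update (contrDeg j c) j 1 l = w + 1 := by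
    rw [Finset.sum_update_of_mem (Finset.mem_univ j)]
    have := Finset.add_sum_erase Finset.univ (contrDeg j c) (Finset.mem_univ j)
    rw [Finset.erase_eq] at this
    omega
  refine 𝓔.X_of_gr K _ (Function.update (contrDeg j c) j 1) (fun l => ?_) ?_ hs'
  · rw [Function.update_apply]
    unfold contr contrDeg
    split_ifs with e1 e2 <;> first
      | exact hx _
      | exact 𝓔.tri_mem _ _
      | exact absurd e2 (by simp [e1])
  · rw [Function.update_apply]
    split_ifs with e1
    · simp
    · have hj : (0 : Fin (n + 1)) < j := Fin.pos_of_ne_zero (Ne.symm e1)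
      obtain h0 | h0 := h0
      · simpa [contrDeg, hj] using h0
      · exact absurd h0.symm e1

lemma rot_last_one {Y : Type*} {n : ℕ} (x : Fin (n + 2) → Y) :
    rot (Fin.last (n + 1)) x 1 = x 0 := by
  simp only [rot]; congr 1
  exact Fin.ext (by rw [val_add_last]; simp)

lemma sum_rot {n : ℕ} (i : Fin (n + 1)) (c : Fin (n + 1) → ℕ) : ∑ l, rot i c l = ∑ l, c l :=
  Equiv.sum_comp (Equiv.addRight i) c

lemma b_mem (n w : ℕ) : ∀ z ∈ 𝓔.X K (n + 1) w, 𝓔.b K n z ∈ 𝓔.X K n w := by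
  refine 𝓔.X_le K (N := (𝓔.X K n w).comap (𝓔.b K n)) fun x c hx h0 hc => ?_
  rw [Submodule.mem_comap, b, descend_cls, hochMul_apply]
  refine Submodule.add_mem _ (Submodule.sum_mem _ fun j _ => Submodule.smul_mem _ _ ?_)
    (Submodule.smul_mem _ _ ?_)
  · exact 𝓔.dot_contr_mem K j x c hx (Or.inl (by omega)) hc
  · exact 𝓔.dot_contr_mem K 0 _ (rot (Fin.last (n + 1)) c) (fun l => hx _)
      (Or.inr ⟨rfl, by rw [rot_last_one]; omega⟩) ((sum_rot _ c).trans hc)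

lemma d_mem (n w : ℕ) : ∀ z ∈ 𝓔.X K (n + 1) (w + 1), 𝓔.d K n z ∈ 𝓔.X K n w := by
  refine 𝓔.X_le K (N := (𝓔.X K n w).comap (𝓔.d K n)) fun x c hx h0 hc => ?_
  rw [Submodule.mem_comap, d, descend_cls, hochMul_apply]
  refine Submodule.add_mem _ (Submodule.sum_mem _ fun j _ => Submodule.smul_mem _ _ ?_)
    (Submodule.smul_mem _ _ ?_)
  · exact 𝓔.tri_contr_mem K j x c hx (Or.inl (by omega)) hc
  · exact 𝓔.tri_contr_mem K 0 _ (rot (Fin.last (n + 1)) c) (fun l => hx _)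
      (Or.inr rfl) ((sum_rot _ c).trans hc)

lemma d'_mem (n w : ℕ) : ∀ z ∈ 𝓔.X K (n + 1) (w + 1), 𝓔.d' K n z ∈ 𝓔.X K n w := by
  refine 𝓔.X_le K (N := (𝓔.X K n w).comap (𝓔.d' K n)) fun x c hx h0 hc => ?_
  rw [Submodule.mem_comap, d', descend_cls, hochMul'_apply]
  exact Submodule.sum_mem _ fun j _ => Submodule.smul_mem _ _
    (𝓔.tri_contr_mem K j x c hx (Or.inl (by omega)) hc)

lemma t_mem (n w : ℕ) : ∀ z ∈ 𝓔.X K n w, 𝓔.t K n z ∈ 𝓔.X K n w := by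
  refine 𝓔.X_le K (N := (𝓔.X K n w).comap (𝓔.t K n)) fun x c hx h0 hc => ?_
  rw [Submodule.mem_comap, t, descend_cls, tMul_apply]
  refine Submodule.sum_mem _ fun i _ => Submodule.smul_mem _ _ ?_
  by_cases hi : c i = 0
  · rw [(cls (𝓔.base K) n).map_coord_zero 0]
    · exact Submodule.zero_mem _
    · have := hx i
      rw [hi] at this
      simp [rot, lastProj, 𝓔.piM_gr_zero this]
  · exact 𝓔.X_of_gr K _ (rot i c) (fun l => 𝓔.lastProj_gr _ _ (hx _)) (by simpa [rot] using hi)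
      ((sum_rot i c).trans hc)

/-- `t` on `M ⊗ B^n_w ⊗`. -/
def tX (n w : ℕ) : 𝓔.X K n w →ₗ[k] 𝓔.X K n w := (𝓔.t K n).restrict (𝓔.t_mem K n w)

/-- `N = id + t + ⋯ + t^w` on `M ⊗ B^n_w ⊗`. -/
def NX (n w : ℕ) : 𝓔.X K n w →ₗ[k] 𝓔.X K n w := ∑ l ∈ Finset.range (w + 1), 𝓔.tX K n w ^ l

/-- `b` on `M ⊗ B^n_w ⊗`. -/
def bX (n w : ℕ) : 𝓔.X K (n + 1) w →ₗ[k] 𝓔.X K n w := (𝓔.b K n).restrict (𝓔.b_mem K n w)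

/-- `d` on `M ⊗ B^n_w ⊗`. -/
def dX (n w : ℕ) : 𝓔.X K (n + 1) (w + 1) →ₗ[k] 𝓔.X K n w := (𝓔.d K n).restrict (𝓔.d_mem K n w)

/-- The restriction to `M ⊗ B^n_w ⊗` of the sum `∑_{j < n} ϱⱼ`. -/
def dX' (n w : ℕ) : 𝓔.X K (n + 1) (w + 1) →ₗ[k] 𝓔.X K n w :=
  (𝓔.d' K n).restrict (𝓔.d'_mem K n w)

/-- Transport along an equality `m = n`. -/
def castX {m n : ℕ} (h : m = n) (w : ℕ) : 𝓔.X K m w →ₗ[k] 𝓔.X K n w :=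
  match n, h with
  | _, rfl => LinearMap.id

/-- The triple diagram. The module in position `(u, v, w)` is `X_{v w} = M ⊗ B^{v + w}_w ⊗`. The faces
with even `u` are `(X, b, d)`, those with odd `u` are `(X, -b, -d')`; the map from column `u + 1` to
column `u` is `id - t` if `u` is even, and `N` if `u` is odd. -/
def diagram : TripleDiagram k where
  X _ v w := 𝓔.X K (v + w) w
  dh u v w := if Even u then LinearMap.id - 𝓔.tX K (v + w) w else 𝓔.NX K (v + w) w
  dv u v w :=
    (if Even u then 𝓔.bX K (v + w) w else -𝓔.bX K (v + w) w) ∘ₗ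
      𝓔.castX K (show v + 1 + w = v + w + 1 by omega) w
  dd u v w := if Even u then 𝓔.dX K (v + w) w else -𝓔.dX' K (v + w) w

end CleftExtension

end Cleft

end

/-!
Let `Φ` send `x₀ ⊗ ⋯ ⊗ xₙ` to the sum of the summands `± 1 ⊗ xᵢ₊₁ ⊗ ⋯ ⊗ xₙ ⊗ x₀ ⊗ ⋯ ⊗ xᵢ` of Connes'
operator with `xᵢ₊₁, …, xₙ` replaced by their components in `A`, and let `F` be the span of the
tensors with first factor in `M`. Comparing `Φ` with `B` in `bB + Bb = 0` gives, on `F`, the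
homotopy formula `bΦ = 1 - t - Φ(b + d')`, and `B = ΦN` there. Hence `Θ`, the inclusion of `F` on
the even columns and `Φ` on the odd ones, is a morphism from the triple diagram to the mixed
complex.

The sum of `F` and `Φ(F)` is direct, since the tensors in `Φ(F)` begin with `1`, and `Φ` is
injective on `F`. Therefore the identities `b² = 0` and `bB + Bb = 0` split into identities between
the differentials of the triple diagram, which the grading by the number of factors in `M` separates
further.

The map `Θ` is injective, and its cokernel is acyclic: the computation of `bΦ` shows that `bΦ + Φb -
1` takes values in `F ⊕ Φ(F)` on the kernel of `p`, and `BΦ = ΦB = 0`.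
-/

noncomputable section

namespace Cleft

section cyclicTensors

variable {k C : Type*} [CommRing k] [Ring C] [Algebra k C]

/-! ### Faces and rotations of tensor powers -/

section tuples

variable {X : Type*} {n : ℕ}

lemma rot_nat_apply (i : Fin (n + 1)) (y : ℕ → X) (l : Fin (n + 1)) :
    rot i (fun l : Fin (n + 1) => y l) l =
      if (l : ℕ) + i < n + 1 then y (l + i) else y (l + i - (n + 1)) := by
  have hl := l.2
  have hi := i.2
  simp only [rot, Fin.val_add]
  split_ifs with h
  · rw [Nat.mod_eq_of_lt h]
  · rw [Nat.mod_eq_sub_mod (by omega), Nat.mod_eq_of_lt (by omega)]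

lemma rot_one_apply (y : ℕ → X) (l : Fin (n + 1)) :
    rot 1 (fun l : Fin (n + 1) => y l) l = if (l : ℕ) = n then y 0 else y (l + 1) := by
  simp only [rot, val_add_one']
  split_ifs <;> rfl

lemma rot_zero (x : Fin (n + 1) → X) : rot 0 x = x := by
  funext l
  simp only [rot, add_zero]

lemma rot_rot (a c : Fin (n + 1)) (x : Fin (n + 1) → X) : rot a (rot c x) = rot (a + c) x := by
  funext l
  simp only [rot, add_assoc]

/-- The entries `xₐ` and `xₐ₊₁` are replaced by `μ(xₐ, xₐ₊₁)`; for `a > n` the last entry is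
followed by the first one, and `μ(xₙ₊₁, x₀)` takes the position `0`. -/
def mergeAt (μ : C →ₗ[k] C →ₗ[k] C) (a : ℕ) (x : Fin (n + 2) → C) : Fin (n + 1) → C := fun l =>
  if n < a ∧ (l : ℕ) = 0 then μ (x (Fin.last _)) (x 0)
  else if (l : ℕ) < a then x l.castSucc
  else if (l : ℕ) = a then μ (x l.castSucc) (x l.succ) else x l.succ

lemma rot_ofNat_succ_last (r : ℕ) (x : Fin (n + 1) → X) :
    rot (Fin.ofNat (n + 1) (r + 1)) x (Fin.last n) = x (Fin.ofNat (n + 1) r) := by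
  rw [rot]
  congr 1
  ext
  simp only [Fin.val_add, Fin.val_last, Fin.val_ofNat, Nat.add_mod_mod]
  rw [show n + (r + 1) = r + (n + 1) by omega, Nat.add_mod_right]

lemma count_ofNat_mem (S : Finset (Fin (n + 1))) :
    Nat.count (fun i => Fin.ofNat (n + 1) i ∈ S) (n + 1) = S.card := by
  rw [Nat.count_eq_card_filter_range, Finset.card_filter, Finset.sum_range]
  simp

variable (μ : C →ₗ[k] C →ₗ[k] C)

lemma mergeAt_eq_contr (j : Fin (n + 1)) (x : Fin (n + 2) → C) : mergeAt μ j x = contr μ j x := by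
  have hj : ¬ n < (j : ℕ) := by omega
  funext l
  simp only [mergeAt, contr, hj, false_and, if_false, Fin.lt_def, Fin.ext_iff]

lemma mergeAt_of_lt {a : ℕ} (ha : n < a) (x : Fin (n + 2) → C) :
    mergeAt μ a x = contr μ 0 (rot (Fin.last (n + 1)) x) := by
  obtain ⟨y, rfl⟩ := exists_nat_ext x
  funext l
  have := l.2
  simp only [mergeAt, contr, rot_nat_apply, Fin.lt_def, Fin.ext_iff, Fin.val_castSucc,
    Fin.val_succ, Fin.val_zero, Fin.val_last]
  grind

lemma mergeAt_rot {a : ℕ} (ha : a ≤ n) (x : Fin (n + 2) → C) :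
    mergeAt μ a (rot 1 x) = rot 1 (mergeAt μ (a + 1) x) := by
  obtain ⟨y, rfl⟩ := exists_nat_ext x
  funext l
  have := l.2
  simp only [mergeAt, rot, val_add_one', Fin.val_castSucc, Fin.val_succ,
    Fin.val_zero, Fin.val_last]
  grind

lemma mergeAt_last_rot (x : Fin (n + 2) → C) : mergeAt μ (n + 1) (rot 1 x) = mergeAt μ 0 x := by
  obtain ⟨y, rfl⟩ := exists_nat_ext x
  funext l
  have := l.2
  simp only [mergeAt, rot_one_apply, Fin.val_castSucc, Fin.val_succ, Fin.val_zero, Fin.val_last]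
  grind

lemma mergeAt_mul_mergeAt_mul {a c : ℕ} (hac : a ≤ c) (hc : c ≤ n + 1) (x : Fin (n + 3) → C) :
    mergeAt (LinearMap.mul k C) a (mergeAt (LinearMap.mul k C) (c + 1) x) =
      mergeAt (LinearMap.mul k C) c (mergeAt (LinearMap.mul k C) a x) := by
  obtain ⟨y, rfl⟩ := exists_nat_ext x
  funext l
  have := l.2
  simp only [mergeAt, LinearMap.mul_apply', Fin.val_castSucc, Fin.val_succ, Fin.val_last,
    Fin.val_zero]
  grind [mul_assoc]

lemma mergeAt_mul_zero_cons_one (x : Fin (n + 1) → C) :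
    mergeAt (LinearMap.mul k C) 0 (Fin.cons 1 x : Fin (n + 2) → C) = x := by
  funext l
  refine Fin.cases ?_ (fun l => ?_) l <;> simp [mergeAt]

lemma mergeAt_succ_cons {a : ℕ} (ha : a ≤ n) (c : C) (x : Fin (n + 2) → C) :
    mergeAt μ (a + 1) (Fin.cons c x : Fin (n + 3) → C) = Fin.cons c (mergeAt μ a x) := by
  funext l
  refine Fin.cases ?_ (fun l => ?_) l
  · simp [mergeAt, show ¬ n < a by omega]
  · simp only [mergeAt, Fin.val_succ, Fin.cons_succ, ← Fin.succ_castSucc]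
    grind

lemma mergeAt_mul_last_cons_one_rot (x : Fin (n + 1) → C) :
    mergeAt (LinearMap.mul k C) (n + 1) (Fin.cons 1 (rot 1 x) : Fin (n + 2) → C) = x := by
  have hlast : (Fin.cons 1 (rot 1 x) : Fin (n + 2) → C) (Fin.last _) = x 0 := by
    rw [← Fin.succ_last, Fin.cons_succ]
    simp [rot]
  funext l
  refine Fin.cases ?_ (fun l => ?_) l
  · simp [mergeAt, hlast]
  · simp [mergeAt, rot]

end tuples

section tensorPower

variable {n : ℕ}

lemma mergeAt_update (μ : C →ₗ[k] C →ₗ[k] C) (a : ℕ) (x : Fin (n + 2) → C) (i : Fin (n + 2)) :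
    ∃ (l : Fin (n + 1)) (f : C →ₗ[k] C),
      ∀ v, mergeAt μ a (Function.update x i v) = Function.update (mergeAt μ a x) l (f v) := by
  obtain ha | ha := lt_or_ge n a
  · simp only [mergeAt_of_lt μ ha, rot_update]
    exact contr_update μ 0 _ _
  · simpa only [← mergeAt_eq_contr] using contr_update μ ⟨a, Nat.lt_succ_of_le ha⟩ x i

lemma exists_mergeAt_eq_update (a : ℕ) (x : Fin (n + 2) → C) :
    ∃ (p : Fin (n + 1)) (u v : Fin (n + 2)), ∀ μ : C →ₗ[k] C →ₗ[k] C,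
      mergeAt μ a x = Function.update (mergeAt (0 : C →ₗ[k] C →ₗ[k] C) a x) p (μ (x u) (x v)) := by
  obtain ha | ha := lt_or_ge n a
  · refine ⟨0, Fin.last _, 0, fun μ => funext fun l => ?_⟩
    simp only [mergeAt, Function.update_apply, Fin.ext_iff, Fin.val_zero]
    grind
  · refine ⟨⟨a, by omega⟩, ⟨a, by omega⟩, ⟨a + 1, by omega⟩, fun μ => funext fun l => ?_⟩
    obtain ⟨y, rfl⟩ := exists_nat_ext x
    simp only [mergeAt, Function.update_apply, Fin.ext_iff, Fin.val_castSucc, Fin.val_succ]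
    grind

/-- The `a`-th face `D_a` of the cyclic module of tensor powers, with its sign `(-1)ᵃ`, for the
product `μ`. The last one, `a = n + 1`, multiplies the last entry by the first one. -/
def cyclicFace (μ : C →ₗ[k] C →ₗ[k] C) (n a : ℕ) : ⨂[k]^(n + 2) C →ₗ[k] ⨂[k]^(n + 1) C :=
  (-1 : k) ^ a • PiTensorProduct.lift
    { toFun := fun x => PiTensorProduct.tprod k (mergeAt μ a x)
      map_update_add' := fun {inst} x i v w => by
        obtain rfl : inst = instDecidableEqFin _ := Subsingleton.elim _ _
        obtain ⟨l, f, h⟩ := mergeAt_update μ a x i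
        rw [h, h, h, map_add, MultilinearMap.map_update_add]
      map_update_smul' := fun {inst} x i c v => by
        obtain rfl : inst = instDecidableEqFin _ := Subsingleton.elim _ _
        obtain ⟨l, f, h⟩ := mergeAt_update μ a x i
        rw [h, h, map_smul, MultilinearMap.map_update_smul] }

variable (k C) in
/-- The signed cyclic operator `x₀ ⊗ ⋯ ⊗ xₙ ↦ (-1)ⁿ x₁ ⊗ ⋯ ⊗ xₙ ⊗ x₀`. -/
def rotate (n : ℕ) : ⨂[k]^(n + 1) C →ₗ[k] ⨂[k]^(n + 1) C :=
  (-1 : k) ^ n • PiTensorProduct.lift ((PiTensorProduct.tprod k).domDomCongr (Equiv.addRight 1))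

variable (k C) in
/-- The extra degeneracy `x₀ ⊗ ⋯ ⊗ xₙ ↦ 1 ⊗ x₀ ⊗ ⋯ ⊗ xₙ`. -/
def unitCons (n : ℕ) : ⨂[k]^(n + 1) C →ₗ[k] ⨂[k]^(n + 2) C :=
  PiTensorProduct.lift ((PiTensorProduct.tprod k (s := fun _ : Fin (n + 2) => C)).curryLeft 1)

lemma cyclicFace_tprod (μ : C →ₗ[k] C →ₗ[k] C) (a : ℕ) (x : Fin (n + 2) → C) :
    cyclicFace μ n a (PiTensorProduct.tprod k x) =
      (-1 : k) ^ a • PiTensorProduct.tprod k (mergeAt μ a x) := by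
  simp [cyclicFace]

lemma cyclicFace_add (μ ν : C →ₗ[k] C →ₗ[k] C) (a : ℕ) (z : ⨂[k]^(n + 2) C) :
    cyclicFace (μ + ν) n a z = cyclicFace μ n a z + cyclicFace ν n a z := by
  rw [← LinearMap.add_apply]
  refine LinearMap.congr_fun (PiTensorProduct.ext (MultilinearMap.ext fun x => ?_)) z
  obtain ⟨p, u, v, h⟩ := exists_mergeAt_eq_update (k := k) a x
  simp only [LinearMap.compMultilinearMap_apply, LinearMap.add_apply, cyclicFace_tprod, ← smul_add]
  rw [h (μ + ν), h μ, h ν, LinearMap.add_apply, LinearMap.add_apply,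
    MultilinearMap.map_update_add]

lemma rotate_tprod (x : Fin (n + 1) → C) :
    rotate k C n (PiTensorProduct.tprod k x) =
      (-1 : k) ^ n • PiTensorProduct.tprod k (rot 1 x) := by
  simp only [rotate, LinearMap.smul_apply, PiTensorProduct.lift.tprod,
    MultilinearMap.domDomCongr_apply, Equiv.coe_addRight]
  rfl

lemma unitCons_tprod (x : Fin (n + 1) → C) :
    unitCons k C n (PiTensorProduct.tprod k x) =
      PiTensorProduct.tprod k (Fin.cons 1 x : Fin (n + 2) → C) := by
  simp [unitCons]

lemma rotate_pow_tprod (i : ℕ) (x : Fin (n + 1) → C) :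
    (rotate k C n ^ i) (PiTensorProduct.tprod k x) =
      (-1 : k) ^ (i * n) • PiTensorProduct.tprod k (rot (Fin.ofNat (n + 1) i) x) := by
  induction i generalizing x with
  | zero => simp [rot_zero]
  | succ i ih =>
    have hi : Fin.ofNat (n + 1) i + 1 = Fin.ofNat (n + 1) (i + 1) := by
      ext
      simp [Fin.val_add]
    rw [pow_succ, Module.End.mul_apply, rotate_tprod, map_smul, ih, rot_rot, hi, smul_smul,
      ← pow_add]
    congr 2
    ring

lemma rotate_pow_eq_one : rotate k C n ^ (n + 1) = 1 := by
  ext x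
  have hodd : Even ((n + 1) * n) := by simpa [mul_comm] using Nat.even_mul_succ_self n
  simp [rotate_pow_tprod, hodd.neg_one_pow, rot_zero, Fin.ofNat]

lemma eq_of_tprod {V : Type*} [AddCommGroup V] [Module k V] (f g : ⨂[k]^(n + 1) C →ₗ[k] V)
    (h : ∀ x, f (PiTensorProduct.tprod k x) = g (PiTensorProduct.tprod k x))
    (z : ⨂[k]^(n + 1) C) : f z = g z :=
  LinearMap.congr_fun (PiTensorProduct.ext (MultilinearMap.ext h)) z

section relations

variable (μ : C →ₗ[k] C →ₗ[k] C)

lemma cyclicFace_rotate {a : ℕ} (ha : a ≤ n) (z : ⨂[k]^(n + 2) C) :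
    cyclicFace μ n a (rotate k C (n + 1) z) = rotate k C n (cyclicFace μ n (a + 1) z) := by
  refine eq_of_tprod (cyclicFace μ n a ∘ₗ rotate k C (n + 1))
    (rotate k C n ∘ₗ cyclicFace μ n (a + 1)) (fun x => ?_) z
  simp only [LinearMap.comp_apply, rotate_tprod, cyclicFace_tprod, map_smul, smul_smul,
    mergeAt_rot μ ha]
  ring_nf

lemma cyclicFace_last_rotate (z : ⨂[k]^(n + 2) C) :
    cyclicFace μ n (n + 1) (rotate k C (n + 1) z) = cyclicFace μ n 0 z := by
  refine eq_of_tprod (cyclicFace μ n (n + 1) ∘ₗ rotate k C (n + 1)) (cyclicFace μ n 0)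
    (fun x => ?_) z
  simp only [LinearMap.comp_apply, rotate_tprod, cyclicFace_tprod, map_smul, smul_smul,
    mergeAt_last_rot, ← mul_pow, neg_mul_neg, mul_one, one_pow, pow_zero]

lemma cyclicFace_mul_cyclicFace_mul {a c : ℕ} (hac : a ≤ c) (hc : c ≤ n + 1)
    (z : ⨂[k]^(n + 3) C) :
    cyclicFace (LinearMap.mul k C) n a (cyclicFace (LinearMap.mul k C) (n + 1) (c + 1) z) =
      -cyclicFace (LinearMap.mul k C) n c (cyclicFace (LinearMap.mul k C) (n + 1) a z) := by
  refine eq_of_tprod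
    (cyclicFace (LinearMap.mul k C) n a ∘ₗ cyclicFace (LinearMap.mul k C) (n + 1) (c + 1))
    (-(cyclicFace (LinearMap.mul k C) n c ∘ₗ cyclicFace (LinearMap.mul k C) (n + 1) a))
    (fun x => ?_) z
  simp only [LinearMap.comp_apply, LinearMap.neg_apply, cyclicFace_tprod, map_smul, smul_smul,
    mergeAt_mul_mergeAt_mul hac hc, ← neg_smul]
  ring_nf

lemma cyclicFace_mul_zero_unitCons (z : ⨂[k]^(n + 1) C) :
    cyclicFace (LinearMap.mul k C) n 0 (unitCons k C n z) = z := by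
  refine eq_of_tprod (cyclicFace (LinearMap.mul k C) n 0 ∘ₗ unitCons k C n) LinearMap.id
    (fun x => ?_) z
  simp only [LinearMap.comp_apply, unitCons_tprod, cyclicFace_tprod, mergeAt_mul_zero_cons_one,
    pow_zero, one_smul, LinearMap.id_apply]

lemma cyclicFace_succ_unitCons {a : ℕ} (ha : a ≤ n) (z : ⨂[k]^(n + 2) C) :
    cyclicFace μ (n + 1) (a + 1) (unitCons k C (n + 1) z) =
      -unitCons k C n (cyclicFace μ n a z) := by
  refine eq_of_tprod (cyclicFace μ (n + 1) (a + 1) ∘ₗ unitCons k C (n + 1))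
    (-(unitCons k C n ∘ₗ cyclicFace μ n a)) (fun x => ?_) z
  simp only [LinearMap.comp_apply, LinearMap.neg_apply, unitCons_tprod, cyclicFace_tprod, map_smul,
    mergeAt_succ_cons μ ha, ← neg_smul, pow_succ, mul_neg, mul_one]

lemma cyclicFace_mul_last_unitCons_rotate (z : ⨂[k]^(n + 1) C) :
    cyclicFace (LinearMap.mul k C) n (n + 1) (unitCons k C n (rotate k C n z)) = -z := by
  refine eq_of_tprod
    (cyclicFace (LinearMap.mul k C) n (n + 1) ∘ₗ unitCons k C n ∘ₗ rotate k C n)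
    (-LinearMap.id) (fun x => ?_) z
  simp only [LinearMap.comp_apply, rotate_tprod, unitCons_tprod, cyclicFace_tprod, map_smul,
    smul_smul, mergeAt_mul_last_cons_one_rot, LinearMap.neg_apply, LinearMap.id_apply, pow_succ,
    ← mul_assoc, ← mul_pow, neg_mul_neg, mul_one, one_pow, one_mul, neg_smul, one_smul]

lemma sum_cyclicFace_rotate_pow {i : ℕ} (hi : i ≤ n + 1) (z : ⨂[k]^(n + 2) C) :
    ∑ a ∈ Finset.range (n + 1), cyclicFace μ n a ((rotate k C (n + 1) ^ (i + 1)) z) =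
      (rotate k C n ^ (i + 1)) (∑ c ∈ Finset.Ico (i + 1) (n + 2), cyclicFace μ n c z) +
        (rotate k C n ^ i) (∑ c ∈ Finset.range i, cyclicFace μ n c z) := by
  induction i generalizing z with
  | zero =>
    rw [Finset.range_zero, Finset.sum_empty, map_zero, add_zero, zero_add, pow_one, pow_one,
      Finset.sum_Ico_eq_sum_range, map_sum]
    refine Finset.sum_congr (by simp) fun a ha => ?_
    rw [cyclicFace_rotate μ (by simpa [Nat.lt_succ_iff] using ha), add_comm 1 a]
  | succ i ih =>
    have hlow : ∑ c ∈ Finset.range i, cyclicFace μ n c (rotate k C (n + 1) z) =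
        rotate k C n (∑ c ∈ Finset.range i, cyclicFace μ n (c + 1) z) := by
      rw [map_sum]
      exact Finset.sum_congr rfl fun c hc =>
        cyclicFace_rotate μ (by have := Finset.mem_range.1 hc; omega) z
    have hhigh : ∑ c ∈ Finset.Ico (i + 1) (n + 1), cyclicFace μ n c (rotate k C (n + 1) z) =
        rotate k C n (∑ c ∈ Finset.Ico (i + 2) (n + 2), cyclicFace μ n c z) := by
      rw [map_sum, ← Finset.sum_Ico_add' _ (i + 1) (n + 1) 1]
      exact Finset.sum_congr rfl fun c hc =>
        cyclicFace_rotate μ (by have := (Finset.mem_Ico.1 hc).2; omega) z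
    rw [pow_succ, Module.End.mul_apply, ih (by omega), hlow, Finset.sum_Ico_succ_top (by omega),
      hhigh, cyclicFace_last_rotate, map_add, Finset.sum_range_succ' _ i, map_add,
      pow_succ _ (i + 1), pow_succ _ i]
    simp only [Module.End.mul_apply]
    abel

lemma sum_sum_cyclicFace_rotate_pow (α : ℕ → ⨂[k]^(n + 2) C) :
    ∑ i ∈ Finset.range (n + 2), ∑ a ∈ Finset.range (n + 1),
        cyclicFace μ n a ((rotate k C (n + 1) ^ (i + 1)) (α i)) =
      ∑ i ∈ Finset.range (n + 1), (rotate k C n ^ (i + 1))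
        (∑ c ∈ Finset.range (i + 1), cyclicFace μ n c (α (i + 1)) +
          ∑ c ∈ Finset.Ico (i + 1) (n + 2), cyclicFace μ n c (α i)) := by
  simp only [map_add, Finset.sum_add_distrib]
  rw [Finset.sum_congr rfl fun i hi => sum_cyclicFace_rotate_pow μ
      (by have := Finset.mem_range.1 hi; omega) (α i), Finset.sum_add_distrib,
    Finset.sum_range_succ _ (n + 1), Finset.sum_range_succ' _ (n + 1), Finset.Ico_self,
    Finset.range_zero, Finset.sum_empty, Finset.sum_empty, map_zero, map_zero, add_zero, add_zero]
  exact add_comm _ _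

end relations

lemma sum_cyclicFace_unitCons (y : ⨂[k]^(n + 2) C) :
    ∑ a ∈ Finset.range (n + 3), cyclicFace (LinearMap.mul k C) (n + 1) a (unitCons k C (n + 1) y) =
      y - unitCons k C n (∑ a ∈ Finset.range (n + 1), cyclicFace (LinearMap.mul k C) n a y) +
        cyclicFace (LinearMap.mul k C) (n + 1) (n + 2) (unitCons k C (n + 1) y) := by
  rw [Finset.sum_range_succ, Finset.sum_range_succ', cyclicFace_mul_zero_unitCons, map_sum,
    Finset.sum_congr rfl fun a ha => cyclicFace_succ_unitCons _
      (Nat.lt_succ_iff.1 (Finset.mem_range.1 ha)) y, Finset.sum_neg_distrib, neg_add_eq_sub]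

/-- For constant `α` this is `b B = - B b`; the truncated families of the cleft situation are not
constant. -/
lemma sum_cyclicFace_unitCons_rotate_pow (α : ℕ → ⨂[k]^(n + 2) C) :
    ∑ a ∈ Finset.range (n + 3), cyclicFace (LinearMap.mul k C) (n + 1) a (unitCons k C (n + 1)
        (∑ i ∈ Finset.range (n + 2), (rotate k C (n + 1) ^ (i + 1)) (α i))) =
      ∑ i ∈ Finset.range (n + 2),
          ((rotate k C (n + 1) ^ (i + 1)) (α i) - (rotate k C (n + 1) ^ i) (α i)) -
        unitCons k C n (∑ i ∈ Finset.range (n + 1), (rotate k C n ^ (i + 1))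
          (∑ c ∈ Finset.range (i + 1), cyclicFace (LinearMap.mul k C) n c (α (i + 1)) +
            ∑ c ∈ Finset.Ico (i + 1) (n + 2), cyclicFace (LinearMap.mul k C) n c (α i))) := by
  have hlast (i : ℕ) : cyclicFace (LinearMap.mul k C) (n + 1) (n + 2) (unitCons k C (n + 1)
      ((rotate k C (n + 1) ^ (i + 1)) (α i))) = -(rotate k C (n + 1) ^ i) (α i) := by
    rw [pow_succ', Module.End.mul_apply, cyclicFace_mul_last_unitCons_rotate]
  rw [sum_cyclicFace_unitCons, ← sum_sum_cyclicFace_rotate_pow, Finset.sum_comm]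
  simp only [map_sum, hlast, Finset.sum_neg_distrib, Finset.sum_sub_distrib]
  abel

lemma sum_cyclicFace_zero_unitCons_rotate (z : ⨂[k]^1 C) :
    ∑ a ∈ Finset.range 2, cyclicFace (LinearMap.mul k C) 0 a
      (unitCons k C 0 (rotate k C 0 z)) = rotate k C 0 z - z := by
  rw [Finset.sum_range_succ, Finset.sum_range_one, cyclicFace_mul_zero_unitCons,
    cyclicFace_mul_last_unitCons_rotate, sub_eq_add_neg]

lemma sum_sum_eq_zero_of_eq_neg {M : Type*} [AddCommGroup M] (m : ℕ) (f : ℕ → ℕ → M)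
    (h : ∀ i j, i ≤ j → j < m → f i (j + 1) = -f j i) :
    ∑ i ∈ Finset.range m, ∑ j ∈ Finset.range (m + 1), f i j = 0 := by
  induction m with
  | zero => simp
  | succ m ih =>
    have hcol : ∑ i ∈ Finset.range (m + 1), f i (m + 1) = -∑ i ∈ Finset.range (m + 1), f m i := by
      rw [← Finset.sum_neg_distrib]
      exact Finset.sum_congr rfl fun i hi =>
        h i m (Nat.lt_succ_iff.1 (Finset.mem_range.1 hi)) m.lt_succ_self
    simp only [Finset.sum_range_succ _ (m + 1), Finset.sum_add_distrib, hcol]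
    rw [Finset.sum_range_succ, ih fun i j hij hj => h i j hij (by omega), zero_add,
      add_neg_cancel]

end tensorPower

section mixedComplex

variable {K : Subalgebra k C} {n : ℕ}

lemma cyclicFace_tprod_coe (μ : C →ₗ[k] C →ₗ[k] C) (j : Fin (n + 1)) (x : Fin (n + 2) → C) :
    (tensorRel K n).mkQ (cyclicFace μ n j (PiTensorProduct.tprod k x)) =
      (-1 : k) ^ (j : ℕ) • cls K n (contr μ j x) := by
  rw [cyclicFace_tprod, mergeAt_eq_contr, map_smul]
  rfl

lemma descend_hochMul'_mkQ {μ : C →ₗ[k] C →ₗ[k] C} (h : Descends K (hochMul' K μ n))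
    (z : ⨂[k]^(n + 2) C) :
    descend (hochMul' K μ n) h ((tensorRel K (n + 1)).mkQ z) =
      (tensorRel K n).mkQ (∑ a ∈ Finset.range (n + 1), cyclicFace μ n a z) := by
  rw [← LinearMap.sum_apply]
  refine eq_of_tprod (descend (hochMul' K μ n) h ∘ₗ (tensorRel K (n + 1)).mkQ)
    ((tensorRel K n).mkQ ∘ₗ ∑ a ∈ Finset.range (n + 1), cyclicFace μ n a) (fun x => ?_) z
  rw [LinearMap.comp_apply, LinearMap.comp_apply, LinearMap.sum_apply, map_sum,
    Finset.sum_range]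
  simp only [cyclicFace_tprod_coe]
  exact (descend_cls _ h x).trans (hochMul'_apply K μ n x)

lemma descend_hochMul_mkQ {μ : C →ₗ[k] C →ₗ[k] C} (h : Descends K (hochMul K μ n))
    (z : ⨂[k]^(n + 2) C) :
    descend (hochMul K μ n) h ((tensorRel K (n + 1)).mkQ z) =
      (tensorRel K n).mkQ (∑ a ∈ Finset.range (n + 2), cyclicFace μ n a z) := by
  rw [← LinearMap.sum_apply]
  refine eq_of_tprod (descend (hochMul K μ n) h ∘ₗ (tensorRel K (n + 1)).mkQ)
    ((tensorRel K n).mkQ ∘ₗ ∑ a ∈ Finset.range (n + 2), cyclicFace μ n a) (fun x => ?_) z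
  rw [LinearMap.comp_apply, LinearMap.comp_apply, LinearMap.sum_apply, map_sum,
    Finset.sum_range_succ, Finset.sum_range, cyclicFace_tprod, mergeAt_of_lt μ n.lt_succ_self,
    map_smul]
  simp only [cyclicFace_tprod_coe]
  exact (descend_cls _ h x).trans (hochMul_apply K μ n x)

lemma hochschild_mkQ (z : ⨂[k]^(n + 2) C) :
    hochschild K n ((tensorRel K (n + 1)).mkQ z) = (tensorRel K n).mkQ
      (∑ a ∈ Finset.range (n + 2), cyclicFace (LinearMap.mul k C) n a z) :=
  descend_hochMul_mkQ _ z

lemma connes_mkQ (z : ⨂[k]^(n + 1) C) :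
    connes K n ((tensorRel K n).mkQ z) = (tensorRel K (n + 1)).mkQ
      (unitCons k C n (∑ i ∈ Finset.range (n + 1), (rotate k C n ^ (i + 1)) z)) := by
  have hshift : ∑ i ∈ Finset.range (n + 1), (rotate k C n ^ (i + 1)) z =
      ∑ i ∈ Finset.range (n + 1), (rotate k C n ^ i) z := by
    rw [Finset.sum_range_succ, rotate_pow_eq_one, Finset.sum_range_succ' _ n, pow_zero]
  rw [hshift, ← LinearMap.sum_apply]
  refine eq_of_tprod (connes K n ∘ₗ (tensorRel K n).mkQ) ((tensorRel K (n + 1)).mkQ ∘ₗ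
    unitCons k C n ∘ₗ ∑ i ∈ Finset.range (n + 1), rotate k C n ^ i) (fun x => ?_) z
  simp only [LinearMap.comp_apply, LinearMap.sum_apply, map_sum, rotate_pow_tprod, map_smul,
    unitCons_tprod]
  rw [Finset.sum_range]
  simp only [Fin.ofNat_val_eq_self]
  exact (descend_cls _ _ x).trans (connesMul_apply K n x)

lemma hochschild_hochschild (z : CycTensor K (n + 2)) :
    hochschild K n (hochschild K (n + 1) z) = 0 := by
  obtain ⟨z, rfl⟩ := (tensorRel K (n + 2)).mkQ_surjective z
  rw [hochschild_mkQ, hochschild_mkQ]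
  simp only [map_sum]
  exact sum_sum_eq_zero_of_eq_neg _ _ fun a c hac hc => by
    rw [cyclicFace_mul_cyclicFace_mul hac (by omega), map_neg]

lemma hochschild_zero_connes_zero (z : CycTensor K 0) : hochschild K 0 (connes K 0 z) = 0 := by
  obtain ⟨z, rfl⟩ := (tensorRel K 0).mkQ_surjective z
  have h := sum_cyclicFace_zero_unitCons_rotate z
  rw [show rotate k C 0 = 1 from (pow_one _).symm.trans rotate_pow_eq_one, Module.End.one_apply,
    sub_self] at h
  rw [connes_mkQ, hochschild_mkQ, Finset.sum_range_one, rotate_pow_eq_one, Module.End.one_apply]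
  exact (congrArg _ h).trans (map_zero _)

lemma hochschild_connes (z : CycTensor K (n + 1)) :
    hochschild K (n + 1) (connes K (n + 1) z) = -connes K n (hochschild K n z) := by
  obtain ⟨z, rfl⟩ := (tensorRel K (n + 1)).mkQ_surjective z
  rw [connes_mkQ, hochschild_mkQ, hochschild_mkQ, connes_mkQ,
    sum_cyclicFace_unitCons_rotate_pow fun _ => z, Finset.sum_range_sub fun i =>
      (rotate k C (n + 1) ^ i) z, rotate_pow_eq_one, pow_zero, sub_self, zero_sub, map_neg]
  congr! 5 with i hi
  exact Finset.sum_range_add_sum_Ico _ (by have := Finset.mem_range.1 hi; omega)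

end mixedComplex

lemma mem_of_forall_cls_mem {K : Subalgebra k C} {n : ℕ} {N : Submodule k (CycTensor K n)}
    (h : ∀ x, cls K n x ∈ N) (z : CycTensor K n) : z ∈ N := by
  have hN : Submodule.span k (Set.range (cls K n)) ≤ N :=
    Submodule.span_le.2 (Set.range_subset_iff.2 h)
  exact hN ((span_cls (K := K) (n := n)).ge Submodule.mem_top)

section bimoduleMaps

variable {K : Subalgebra k C} {n : ℕ}

/-- `f` is a map of `K`-bimodules that preserves `K`; such maps can be applied to the factors of
`C ⊗ C̄^{⊗ n} ⊗`. -/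
structure IsBimoduleMap (K : Subalgebra k C) (f : C →ₗ[k] C) : Prop where
  right : ∀ c ∈ K, ∀ x, f (x * c) = f x * c
  left : ∀ c ∈ K, ∀ x, f (c * x) = c * f x
  map_mem : ∀ c ∈ K, f c ∈ K

lemma isBimoduleMap_id (K : Subalgebra k C) : IsBimoduleMap K (LinearMap.id : C →ₗ[k] C) :=
  ⟨fun _ _ _ => rfl, fun _ _ _ => rfl, fun _ h => h⟩

lemma apply_update_mul_right {f : Fin (n + 1) → C →ₗ[k] C} (hf : ∀ l, IsBimoduleMap K (f l))
    (x : Fin (n + 1) → C) (j : Fin (n + 1)) {c : C} (hc : c ∈ K) :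
    (fun l => f l (Function.update x j (x j * c) l)) =
      Function.update (fun l => f l (x l)) j (f j (x j) * c) := by
  funext l
  rw [Function.apply_update fun l => f l, (hf j).right c hc]

lemma apply_update_mul_left {f : Fin (n + 1) → C →ₗ[k] C} (hf : ∀ l, IsBimoduleMap K (f l))
    (x : Fin (n + 1) → C) (j : Fin (n + 1)) {c : C} (hc : c ∈ K) :
    (fun l => f l (Function.update x j (c * x j) l)) =
      Function.update (fun l => f l (x l)) j (c * f j (x j)) := by
  funext l
  rw [Function.apply_update fun l => f l, (hf j).left c hc]

lemma compLinearMap_descends {f : Fin (n + 1) → C →ₗ[k] C} (hf : ∀ l, IsBimoduleMap K (f l)) :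
    Descends K ((cls K n).compLinearMap f) where
  balanced x j c hc := by
    simp only [MultilinearMap.compLinearMap_apply, apply_update_mul_right hf x j hc,
      apply_update_mul_left hf x (j + 1) hc]
    exact cls_update (fun l => f l (x l)) j hc
  degen x j hj hx := cls_degen _ hj ((hf j).map_mem _ hx)

/-- The map `x₀ ⊗ ⋯ ⊗ xₙ ↦ f₀(x₀) ⊗ ⋯ ⊗ fₙ(xₙ)` on `C ⊗ C̄^{⊗ n} ⊗`. -/
def mapFactors (f : Fin (n + 1) → C →ₗ[k] C) (hf : ∀ l, IsBimoduleMap K (f l)) :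
    CycTensor K n →ₗ[k] CycTensor K n :=
  descend ((cls K n).compLinearMap f) (compLinearMap_descends hf)

lemma mapFactors_cls (f : Fin (n + 1) → C →ₗ[k] C) (hf : ∀ l, IsBimoduleMap K (f l))
    (x : Fin (n + 1) → C) : mapFactors f hf (cls K n x) = cls K n fun l => f l (x l) :=
  descend_cls _ _ x

lemma mapFactors_mkQ (f : Fin (n + 1) → C →ₗ[k] C) (hf : ∀ l, IsBimoduleMap K (f l))
    (z : ⨂[k]^(n + 1) C) :
    mapFactors f hf ((tensorRel K n).mkQ z) = (tensorRel K n).mkQ (PiTensorProduct.map f z) := by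
  refine eq_of_tprod (mapFactors f hf ∘ₗ (tensorRel K n).mkQ)
    ((tensorRel K n).mkQ ∘ₗ PiTensorProduct.map f) (fun x => ?_) z
  rw [LinearMap.comp_apply, LinearMap.comp_apply, PiTensorProduct.map_tprod]
  exact mapFactors_cls f hf x

end bimoduleMaps

section unitInsert

variable {K : Subalgebra k C} {n : ℕ}

lemma mkQ_unitCons_rotate_pow_tprod (i : ℕ) (x : Fin (n + 1) → C) :
    (tensorRel K (n + 1)).mkQ
        (unitCons k C n ((rotate k C n ^ i) (PiTensorProduct.tprod k x))) =
      (-1 : k) ^ (i * n) • cls K (n + 1) (Fin.cons 1 (rot (Fin.ofNat (n + 1) i) x)) := by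
  rw [rotate_pow_tprod, map_smul, map_smul, unitCons_tprod]
  rfl

/-- In contrast to `cls_degen`, the entry in `K` may be the first one. -/
lemma mkQ_unitCons_rotate_pow_tprod_of_mem (i : ℕ) {x : Fin (n + 1) → C} {j : Fin (n + 1)}
    (hx : x j ∈ K) :
    (tensorRel K (n + 1)).mkQ
      (unitCons k C n ((rotate k C n ^ i) (PiTensorProduct.tprod k x))) = 0 := by
  rw [mkQ_unitCons_rotate_pow_tprod, cls_degen _ (Fin.succ_ne_zero (j - Fin.ofNat (n + 1) i)),
    smul_zero]
  rw [Fin.cons_succ]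
  simpa only [rot, sub_add_cancel] using hx

lemma unitCons_rotate_pow_descends (K : Subalgebra k C) (n i : ℕ) :
    Descends K (((tensorRel K (n + 1)).mkQ ∘ₗ unitCons k C n ∘ₗ
      rotate k C n ^ i).compMultilinearMap (PiTensorProduct.tprod k)) where
  balanced x j c hc := by
    set r := Fin.ofNat (n + 1) i
    have h1 : rot r x (j - r) = x j := by simp only [rot, sub_add_cancel]
    have h2 : rot r x (j - r + 1) = x (j + 1) := by
      simp only [rot]
      congr 1
      abel
    have h3 : j + 1 - r = j - r + 1 := by abel
    have h := cons_one_balanced (rot r x) (j - r) c hc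
    rw [h1, h2] at h
    simp only [LinearMap.compMultilinearMap_apply, LinearMap.comp_apply,
      mkQ_unitCons_rotate_pow_tprod]
    rw [rot_update, rot_update, h3, h]
  degen _ _ _ hx := mkQ_unitCons_rotate_pow_tprod_of_mem i hx

/-- The map `x₀ ⊗ ⋯ ⊗ xₙ ↦ (-1)ⁱⁿ 1 ⊗ xᵢ ⊗ ⋯ ⊗ xₙ ⊗ x₀ ⊗ ⋯ ⊗ xᵢ₋₁`, the `i`-th summand of Connes'
operator. -/
def unitInsert (K : Subalgebra k C) (n i : ℕ) : CycTensor K n →ₗ[k] CycTensor K (n + 1) :=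
  descend _ (unitCons_rotate_pow_descends K n i)

lemma unitInsert_mkQ (i : ℕ) (z : ⨂[k]^(n + 1) C) :
    unitInsert K n i ((tensorRel K n).mkQ z) =
      (tensorRel K (n + 1)).mkQ (unitCons k C n ((rotate k C n ^ i) z)) :=
  eq_of_tprod (unitInsert K n i ∘ₗ (tensorRel K n).mkQ)
    ((tensorRel K (n + 1)).mkQ ∘ₗ unitCons k C n ∘ₗ rotate k C n ^ i)
    (fun x => descend_cls _ (unitCons_rotate_pow_descends K n i) x) z

lemma unitInsert_cls (i : ℕ) (x : Fin (n + 1) → C) :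
    unitInsert K n i (cls K n x) =
      (-1 : k) ^ (i * n) • cls K (n + 1) (Fin.cons 1 (rot (Fin.ofNat (n + 1) i) x)) :=
  (descend_cls _ (unitCons_rotate_pow_descends K n i) x).trans
    (mkQ_unitCons_rotate_pow_tprod i x)

lemma unitInsert_cls_of_mem (i : ℕ) {x : Fin (n + 1) → C} {j : Fin (n + 1)} (hx : x j ∈ K) :
    unitInsert K n i (cls K n x) = 0 :=
  (descend_cls _ (unitCons_rotate_pow_descends K n i) x).trans
    (mkQ_unitCons_rotate_pow_tprod_of_mem i hx)

lemma unitInsert_unitInsert (i j : ℕ) (z : CycTensor K n) :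
    unitInsert K (n + 1) i (unitInsert K n j z) = 0 := by
  suffices h : unitInsert K (n + 1) i ∘ₗ unitInsert K n j = 0 from LinearMap.congr_fun h z
  refine cyc_hom_ext fun x => ?_
  rw [LinearMap.comp_apply, unitInsert_cls, map_smul, LinearMap.zero_apply,
    unitInsert_cls_of_mem i (j := 0) K.one_mem, smul_zero]

lemma unitInsert_mapFactors_unitInsert {f : Fin (n + 2) → C →ₗ[k] C}
    (hf : ∀ l, IsBimoduleMap K (f l)) (i j : ℕ) (z : CycTensor K n) :
    unitInsert K (n + 1) i (mapFactors f hf (unitInsert K n j z)) = 0 := by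
  suffices h : unitInsert K (n + 1) i ∘ₗ mapFactors f hf ∘ₗ unitInsert K n j = 0 from
    LinearMap.congr_fun h z
  refine cyc_hom_ext fun x => ?_
  rw [LinearMap.comp_apply, LinearMap.comp_apply, unitInsert_cls, map_smul, map_smul,
    mapFactors_cls, LinearMap.zero_apply,
    unitInsert_cls_of_mem i (j := 0) ((hf 0).map_mem _ K.one_mem), smul_zero]

lemma mapCyc_unitInsert {D : Type*} [Ring D] [Algebra k D] {L : Subalgebra k D} (f : C →ₐ[k] D)
    (hf : ∀ c ∈ K, f c ∈ L) (i : ℕ) (z : CycTensor K n) :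
    mapCyc f hf (n + 1) (unitInsert K n i z) = unitInsert L n i (mapCyc f hf n z) := by
  suffices h : mapCyc f hf (n + 1) ∘ₗ unitInsert K n i = unitInsert L n i ∘ₗ mapCyc f hf n from
    LinearMap.congr_fun h z
  refine cyc_hom_ext fun x => ?_
  rw [LinearMap.comp_apply, LinearMap.comp_apply, unitInsert_cls, mapCyc_cls, unitInsert_cls,
    map_smul, mapCyc_cls]
  congr 2
  funext l
  refine Fin.cases ?_ (fun l => ?_) l
  · exact map_one f
  · rfl

lemma connes_apply (z : CycTensor K n) :
    connes K n z = ∑ i ∈ Finset.range (n + 1), unitInsert K n (i + 1) z := by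
  obtain ⟨z, rfl⟩ := (tensorRel K n).mkQ_surjective z
  simp only [connes_mkQ, unitInsert_mkQ, map_sum]

lemma connes_connes (z : CycTensor K n) : connes K (n + 1) (connes K n z) = 0 := by
  simp only [connes_apply, map_sum, unitInsert_unitInsert, Finset.sum_const_zero]

end unitInsert

end cyclicTensors

namespace CleftExtension

variable {k A E : Type*} [CommRing k] [Ring A] [Algebra k A] [Ring E] [Algebra k E]
  (𝓔 : CleftExtension k A E) (K : Subalgebra k A) {n w : ℕ}

/-! ### The homotopy `Φ` -/

section projections

lemma isBimoduleMap_piA : IsBimoduleMap (𝓔.base K) 𝓔.piA where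
  right c hc x := by rw [piA_mul, 𝓔.piA_of_mem hc]
  left c hc x := by rw [piA_mul, 𝓔.piA_of_mem hc]
  map_mem c hc := by rwa [𝓔.piA_of_mem hc]

lemma isBimoduleMap_piM : IsBimoduleMap (𝓔.base K) 𝓔.piM where
  right _ hc x := 𝓔.piM_mul_right hc x
  left _ hc x := 𝓔.piM_mul_left hc x
  map_mem c hc := by rw [𝓔.piM_of_mem hc]; exact zero_mem _

lemma piA_add_piM : 𝓔.piA + 𝓔.piM = LinearMap.id := add_sub_cancel _ _

lemma piM_piA (x : E) : 𝓔.piM (𝓔.piA x) = 0 := by simp only [piA_apply, piM_apply, 𝓔.p_i, sub_self]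

lemma piA_of_mem_M {x : E} (hx : x ∈ 𝓔.M) : 𝓔.piA x = 0 :=
  (congrArg 𝓔.i hx).trans (map_zero _)

lemma piM_of_mem_M {x : E} (hx : x ∈ 𝓔.M) : 𝓔.piM x = x := 𝓔.piM_gr_one hx

lemma piA_of_mem_copyA {x : E} (hx : x ∈ 𝓔.copyA) : 𝓔.piA x = x :=
  (sub_eq_zero.1 (𝓔.piM_gr_zero hx)).symm

lemma piM_of_mem_copyA {x : E} (hx : x ∈ 𝓔.copyA) : 𝓔.piM x = 0 := 𝓔.piM_gr_zero hx

lemma piA_mem (x : E) : 𝓔.piA x ∈ 𝓔.copyA := ⟨𝓔.p x, rfl⟩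

lemma piM_mem (x : E) : 𝓔.piM x ∈ 𝓔.M := by
  change 𝓔.p (𝓔.piM x) = 0
  rw [piM_apply, map_sub, 𝓔.p_i, sub_self]

/-- The projection to `A` of the entries in the positions `≥ r`. -/
def tailProj (r l : ℕ) : E →ₗ[k] E := if l < r then LinearMap.id else 𝓔.piA

lemma tailProj_of_lt {r l : ℕ} (h : l < r) : 𝓔.tailProj r l = LinearMap.id := if_pos h

lemma tailProj_of_le {r l : ℕ} (h : r ≤ l) : 𝓔.tailProj r l = 𝓔.piA := if_neg h.not_gt

lemma isBimoduleMap_tailProj (r l : ℕ) : IsBimoduleMap (𝓔.base K) (𝓔.tailProj r l) := by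
  unfold tailProj
  split_ifs
  exacts [isBimoduleMap_id _, 𝓔.isBimoduleMap_piA K]

/-- The projection to `A` of the entries in the positions `≥ r` of a tensor. -/
def mapTail (n r : ℕ) : ⨂[k]^(n + 1) E →ₗ[k] ⨂[k]^(n + 1) E :=
  PiTensorProduct.map fun l : Fin (n + 1) => 𝓔.tailProj r l

lemma mapTail_tprod (r : ℕ) (x : Fin (n + 1) → E) :
    𝓔.mapTail n r (PiTensorProduct.tprod k x) =
      PiTensorProduct.tprod k fun l : Fin (n + 1) => 𝓔.tailProj r l (x l) :=
  PiTensorProduct.map_tprod _ _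

lemma mapTail_of_lt {r : ℕ} (hr : n < r) (z : ⨂[k]^(n + 1) E) : 𝓔.mapTail n r z = z := by
  have h : (fun l : Fin (n + 1) => 𝓔.tailProj r l) = fun _ => LinearMap.id :=
    funext fun l => 𝓔.tailProj_of_lt (by omega)
  rw [mapTail, h, PiTensorProduct.map_id, LinearMap.id_apply]

lemma mapTail_succ (i : Fin (n + 1)) (z : ⨂[k]^(n + 1) E) :
    𝓔.mapTail n (i + 1) z = 𝓔.mapTail n i z + PiTensorProduct.map (𝓔.lastProj i) z := by
  set f : Fin (n + 1) → E →ₗ[k] E := fun l => 𝓔.tailProj i l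
  have hid : (fun l : Fin (n + 1) => 𝓔.tailProj (i + 1) l) =
      Function.update f i (𝓔.piA + 𝓔.piM) := by
    funext l
    rw [piA_add_piM]
    obtain rfl | h := eq_or_ne l i
    · rw [Function.update_self, tailProj_of_lt _ l.val.lt_succ_self]
    · have h' : (l : ℕ) ≠ i := fun h' => h (Fin.ext h')
      have h'' : (l : ℕ) < i + 1 ↔ (l : ℕ) < i := by omega
      simp only [Function.update_of_ne h, tailProj, f, h'']
  have hA : Function.update f i 𝓔.piA = f := by
    rw [Function.update_eq_self_iff]
    exact (𝓔.tailProj_of_le le_rfl).symm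
  have hM : Function.update f i 𝓔.piM = 𝓔.lastProj i := by
    funext l
    obtain rfl | h := eq_or_ne l i
    · rw [Function.update_self, lastProj, if_neg (lt_irrefl _), if_pos rfl]
    · rw [Function.update_of_ne h, lastProj, if_neg h]
      rfl
  rw [mapTail, hid, PiTensorProduct.map_update_add, hA, hM]
  rfl

end projections

section faces

lemma mapTail_cyclicFace_mul_of_lt {r c : ℕ} (hc : c < r) (hcn : c ≤ n) (z : ⨂[k]^(n + 2) E) :
    𝓔.mapTail n r (cyclicFace (LinearMap.mul k E) n c z) =
      cyclicFace (LinearMap.mul k E) n c (𝓔.mapTail (n + 1) (r + 1) z) := by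
  refine eq_of_tprod (𝓔.mapTail n r ∘ₗ cyclicFace (LinearMap.mul k E) n c)
    (cyclicFace (LinearMap.mul k E) n c ∘ₗ 𝓔.mapTail (n + 1) (r + 1)) (fun x => ?_) z
  obtain ⟨y, rfl⟩ := exists_nat_ext x
  simp only [LinearMap.comp_apply, cyclicFace_tprod, mapTail_tprod, map_smul]
  congr 2
  funext l
  simp only [mergeAt, tailProj]
  grind [LinearMap.id_apply, LinearMap.mul_apply']

lemma mapTail_cyclicFace_mul_of_le {r c : ℕ} (hr : r ≤ c) (hcn : c ≤ n) (z : ⨂[k]^(n + 2) E) :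
    𝓔.mapTail n r (cyclicFace (LinearMap.mul k E) n c z) =
      cyclicFace (LinearMap.mul k E) n c (𝓔.mapTail (n + 1) r z) := by
  refine eq_of_tprod (𝓔.mapTail n r ∘ₗ cyclicFace (LinearMap.mul k E) n c)
    (cyclicFace (LinearMap.mul k E) n c ∘ₗ 𝓔.mapTail (n + 1) r) (fun x => ?_) z
  obtain ⟨y, rfl⟩ := exists_nat_ext x
  simp only [LinearMap.comp_apply, cyclicFace_tprod, mapTail_tprod, map_smul]
  congr 2
  funext l
  simp only [mergeAt, tailProj]
  grind [LinearMap.id_apply, LinearMap.mul_apply', piA_mul]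

lemma mapTail_cyclicFace_piA_last {r : ℕ} (hr : 0 < r) (hrn : r ≤ n + 1) (z : ⨂[k]^(n + 2) E) :
    𝓔.mapTail n r (cyclicFace (LinearMap.mul k E ∘ₗ 𝓔.piA) n (n + 1) z) =
      cyclicFace (LinearMap.mul k E) n (n + 1) (𝓔.mapTail (n + 1) r z) := by
  refine eq_of_tprod (𝓔.mapTail n r ∘ₗ cyclicFace (LinearMap.mul k E ∘ₗ 𝓔.piA) n (n + 1))
    (cyclicFace (LinearMap.mul k E) n (n + 1) ∘ₗ 𝓔.mapTail (n + 1) r) (fun x => ?_) z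
  obtain ⟨y, rfl⟩ := exists_nat_ext x
  simp only [LinearMap.comp_apply, cyclicFace_tprod, mapTail_tprod, map_smul]
  congr 2
  funext l
  simp only [mergeAt, tailProj, Fin.val_last, Fin.val_zero]
  grind [LinearMap.id_apply, LinearMap.mul_apply', LinearMap.comp_apply]

lemma sum_cyclicFace_mapTail {i : ℕ} (hi : i ≤ n) (z : ⨂[k]^(n + 2) E) :
    ∑ c ∈ Finset.range (i + 1),
          cyclicFace (LinearMap.mul k E) n c (𝓔.mapTail (n + 1) (i + 2) z) +
        ∑ c ∈ Finset.Ico (i + 1) (n + 2),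
          cyclicFace (LinearMap.mul k E) n c (𝓔.mapTail (n + 1) (i + 1) z) =
      𝓔.mapTail n (i + 1) (∑ c ∈ Finset.range (n + 2), cyclicFace (LinearMap.mul k E) n c z -
        cyclicFace (LinearMap.mul k E ∘ₗ 𝓔.piM) n (n + 1) z) := by
  have hlow : ∀ c ∈ Finset.range (i + 1),
      cyclicFace (LinearMap.mul k E) n c (𝓔.mapTail (n + 1) (i + 2) z) =
        𝓔.mapTail n (i + 1) (cyclicFace (LinearMap.mul k E) n c z) := fun c hc => by
    have hc := Finset.mem_range.1 hc
    rw [𝓔.mapTail_cyclicFace_mul_of_lt hc (by omega)]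
  have hhigh : ∀ c ∈ Finset.Ico (i + 1) (n + 1),
      cyclicFace (LinearMap.mul k E) n c (𝓔.mapTail (n + 1) (i + 1) z) =
        𝓔.mapTail n (i + 1) (cyclicFace (LinearMap.mul k E) n c z) := fun c hc => by
    have hc := Finset.mem_Ico.1 hc
    rw [𝓔.mapTail_cyclicFace_mul_of_le hc.1 (by omega)]
  have hlast : cyclicFace (LinearMap.mul k E) n (n + 1) z =
      cyclicFace (LinearMap.mul k E ∘ₗ 𝓔.piA) n (n + 1) z +
        cyclicFace (LinearMap.mul k E ∘ₗ 𝓔.piM) n (n + 1) z := by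
    rw [← cyclicFace_add, ← LinearMap.comp_add, piA_add_piM, LinearMap.comp_id]
  rw [Finset.sum_congr rfl hlow, Finset.sum_Ico_succ_top (by omega), Finset.sum_congr rfl hhigh,
    ← 𝓔.mapTail_cyclicFace_piA_last i.succ_pos (by omega), ← add_assoc,
    Finset.sum_range_add_sum_Ico _ (by omega), Finset.sum_range_succ _ (n + 1), hlast,
    ← add_assoc, add_sub_cancel_right, map_add, map_sum]

end faces

section homotopy

/-- The operator `Φ`, given by `Φ(x) = ∑ᵢ ± 1 ⊗ xᵢ₊₁ ⊗ ⋯ ⊗ xₙ ⊗ x₀ ⊗ ⋯ ⊗ xᵢ`, where the entries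
`xᵢ₊₁, …, xₙ` of the `i`-th summand are projected to `A`. On the tensors with `x₀ ∈ M` it embeds the
odd columns of the triple diagram, and it is the contracting homotopy of the comparison. -/
def phi (n : ℕ) : CycTensor (𝓔.base K) n →ₗ[k] CycTensor (𝓔.base K) (n + 1) :=
  ∑ i ∈ Finset.range (n + 1), unitInsert (𝓔.base K) n (i + 1) ∘ₗ
    mapFactors (fun l : Fin (n + 1) => 𝓔.tailProj (i + 1) l)
      (fun l => 𝓔.isBimoduleMap_tailProj K (i + 1) l)

lemma phi_mkQ (z : ⨂[k]^(n + 1) E) :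
    𝓔.phi K n ((tensorRel (𝓔.base K) n).mkQ z) = (tensorRel (𝓔.base K) (n + 1)).mkQ
      (unitCons k E n (∑ i ∈ Finset.range (n + 1),
        (rotate k E n ^ (i + 1)) (𝓔.mapTail n (i + 1) z))) := by
  simp only [phi, LinearMap.sum_apply, LinearMap.comp_apply, mapFactors_mkQ, unitInsert_mkQ,
    map_sum]
  rfl

lemma t_mkQ (z : ⨂[k]^(n + 1) E) :
    𝓔.t K n ((tensorRel (𝓔.base K) n).mkQ z) = (tensorRel (𝓔.base K) n).mkQ
      (∑ i ∈ Finset.range (n + 1),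
        (rotate k E n ^ i) (𝓔.mapTail n (i + 1) z - 𝓔.mapTail n i z)) := by
  rw [Finset.sum_range]
  simp only [mapTail_succ, add_sub_cancel_left]
  simp only [← LinearMap.comp_apply, ← LinearMap.sum_apply]
  refine eq_of_tprod _ _ (fun x => ?_) z
  simp only [LinearMap.comp_apply, LinearMap.sum_apply, PiTensorProduct.map_tprod,
    rotate_pow_tprod, map_sum, map_smul, Fin.ofNat_val_eq_self]
  exact (descend_cls _ _ x).trans (𝓔.tMul_apply K n x)

/-- Compare with `B = ∑ unitInsert` and `b B + B b = 0`: the truncation by the projections to `A`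
contributes `1 - t`, as `t` collects the differences of consecutive truncations, and it omits the
face that multiplies a last entry in `M` by the first one. -/
lemma hochschild_phi_mkQ (z : ⨂[k]^(n + 2) E) :
    hochschild (𝓔.base K) (n + 1) (𝓔.phi K (n + 1) ((tensorRel (𝓔.base K) (n + 1)).mkQ z)) =
      (tensorRel (𝓔.base K) (n + 1)).mkQ z -
          (tensorRel (𝓔.base K) (n + 1)).mkQ (𝓔.mapTail (n + 1) 0 z) -
        𝓔.t K (n + 1) ((tensorRel (𝓔.base K) (n + 1)).mkQ z) -
        𝓔.phi K n (hochschild (𝓔.base K) n ((tensorRel (𝓔.base K) (n + 1)).mkQ z) -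
          (tensorRel (𝓔.base K) n).mkQ
            (cyclicFace (LinearMap.mul k E ∘ₗ 𝓔.piM) n (n + 1) z)) := by
  have htelescope : ∑ i ∈ Finset.range (n + 2),
      ((rotate k E (n + 1) ^ (i + 1)) (𝓔.mapTail (n + 1) (i + 1) z) -
        (rotate k E (n + 1) ^ i) (𝓔.mapTail (n + 1) (i + 1) z)) =
      z - 𝓔.mapTail (n + 1) 0 z - ∑ i ∈ Finset.range (n + 2), (rotate k E (n + 1) ^ i)
        (𝓔.mapTail (n + 1) (i + 1) z - 𝓔.mapTail (n + 1) i z) := by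
    have h := Finset.sum_range_sub (fun i => (rotate k E (n + 1) ^ i) (𝓔.mapTail (n + 1) i z))
      (n + 2)
    rw [rotate_pow_eq_one, 𝓔.mapTail_of_lt (n + 1).lt_succ_self, pow_zero, Module.End.one_apply,
      Module.End.one_apply] at h
    rw [← h, ← Finset.sum_sub_distrib]
    refine Finset.sum_congr rfl fun i _ => ?_
    rw [map_sub]
    abel
  rw [phi_mkQ, hochschild_mkQ, sum_cyclicFace_unitCons_rotate_pow fun i => 𝓔.mapTail _ (i + 1) z,
    htelescope, t_mkQ, hochschild_mkQ,
    ← map_sub (tensorRel (𝓔.base K) n).mkQ (∑ a ∈ Finset.range (n + 2), _), phi_mkQ, map_sub,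
    map_sub, map_sub]
  congr! 5 with i hi
  exact 𝓔.sum_cyclicFace_mapTail (Finset.mem_range_succ_iff.1 hi) z

lemma hochschild_zero_phi_zero (z : CycTensor (𝓔.base K) 0) :
    hochschild (𝓔.base K) 0 (𝓔.phi K 0 z) = 0 := by
  suffices h : 𝓔.phi K 0 z = connes (𝓔.base K) 0 z by rw [h, hochschild_zero_connes_zero]
  obtain ⟨z, rfl⟩ := (tensorRel (𝓔.base K) 0).mkQ_surjective z
  rw [phi_mkQ, connes_mkQ, Finset.sum_range_one, Finset.sum_range_one,
    𝓔.mapTail_of_lt (Nat.succ_pos 0)]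

end homotopy

/-! ### The number of factors in `M` -/

section grading

lemma X_le_of_finset {N : Submodule k (CycTensor (𝓔.base K) n)}
    (h : ∀ (x : Fin (n + 1) → E) (S : Finset (Fin (n + 1))), 0 ∈ S → S.card = w + 1 →
      (∀ l ∈ S, x l ∈ 𝓔.M) → (∀ l ∉ S, x l ∈ 𝓔.copyA) → cls (𝓔.base K) n x ∈ N) :
    𝓔.X K n w ≤ N := by
  classical
  refine Submodule.span_le.2 ?_
  rintro z ⟨x, S, hS, hx0, hxM, hxA, rfl⟩
  refine h x (insert 0 (S.map ⟨Fin.succ, Fin.succ_injective n⟩)) (Finset.mem_insert_self _ _)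
    ?_ ?_ ?_
  · rw [Finset.card_insert_of_notMem (by simp), Finset.card_map, hS]
  · simpa using And.intro hx0 hxM
  · intro l hl
    obtain ⟨j, rfl⟩ := Fin.exists_succ_eq.2 fun h0 => hl (h0 ▸ Finset.mem_insert_self _ _)
    exact hxA j fun hj => hl (by simpa using hj)

lemma X_eq_bot (h : n < w) : 𝓔.X K n w = ⊥ := by
  rw [X, Submodule.span_eq_bot]
  rintro z ⟨x, S, hS, -⟩
  have := S.card_le_univ
  rw [Fintype.card_fin] at this
  omega

open Classical in
/-- The projection to `M` in the positions of `S` and to `A` in the other ones. -/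
def gradeFactor (S : Finset (Fin (n + 1))) (l : Fin (n + 1)) : E →ₗ[k] E :=
  if l ∈ S then 𝓔.piM else 𝓔.piA

lemma gradeFactor_of_mem {S : Finset (Fin (n + 1))} {l : Fin (n + 1)} (h : l ∈ S) :
    𝓔.gradeFactor S l = 𝓔.piM := if_pos h

lemma gradeFactor_of_notMem {S : Finset (Fin (n + 1))} {l : Fin (n + 1)} (h : l ∉ S) :
    𝓔.gradeFactor S l = 𝓔.piA := if_neg h

lemma isBimoduleMap_gradeFactor (S : Finset (Fin (n + 1))) (l : Fin (n + 1)) :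
    IsBimoduleMap (𝓔.base K) (𝓔.gradeFactor S l) := by
  unfold gradeFactor
  split_ifs
  exacts [𝓔.isBimoduleMap_piM K, 𝓔.isBimoduleMap_piA K]

/-- The projection to the tensors with exactly `w` entries in `M`, the first entry included. -/
def gradeProj (n w : ℕ) : CycTensor (𝓔.base K) n →ₗ[k] CycTensor (𝓔.base K) n :=
  ∑ S ∈ Finset.univ.powersetCard w,
    mapFactors (𝓔.gradeFactor S) (fun l => 𝓔.isBimoduleMap_gradeFactor K S l)

lemma gradeProj_cls (w : ℕ) (x : Fin (n + 1) → E) :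
    𝓔.gradeProj K n w (cls (𝓔.base K) n x) =
      ∑ S ∈ Finset.univ.powersetCard w, cls (𝓔.base K) n (fun l => 𝓔.gradeFactor S l (x l)) := by
  simp only [gradeProj, LinearMap.sum_apply, mapFactors_cls]

lemma sum_gradeProj (z : CycTensor (𝓔.base K) n) :
    ∑ w ∈ Finset.range (n + 2), 𝓔.gradeProj K n w z = z := by
  suffices h : ∑ w ∈ Finset.range (n + 2), 𝓔.gradeProj K n w = LinearMap.id by
    simpa only [LinearMap.sum_apply, LinearMap.id_apply] using LinearMap.congr_fun h z
  refine cyc_hom_ext fun x => ?_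
  have hx : ((fun l => 𝓔.piM (x l)) + fun l => 𝓔.piA (x l)) = x :=
    funext fun l => (add_comm _ _).trans (LinearMap.congr_fun 𝓔.piA_add_piM (x l))
  have h := (cls (𝓔.base K) n).map_add_univ (fun l => 𝓔.piM (x l)) (fun l => 𝓔.piA (x l))
  rw [hx, ← Finset.powerset_univ, Finset.sum_powerset, Finset.card_univ, Fintype.card_fin] at h
  simp only [LinearMap.sum_apply, gradeProj_cls, LinearMap.id_apply]
  rw [h]
  refine Finset.sum_congr rfl fun w _ => Finset.sum_congr rfl fun S _ => ?_
  congr 1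
  funext l
  rw [gradeFactor, Finset.piecewise]
  split_ifs <;> rfl

variable {K} in
lemma cls_gradeFactor_eq_zero {x : Fin (n + 1) → E} {S T : Finset (Fin (n + 1))}
    (hM : ∀ l ∈ S, x l ∈ 𝓔.M) (hA : ∀ l ∉ S, x l ∈ 𝓔.copyA) (h : T ≠ S) :
    cls (𝓔.base K) n (fun l => 𝓔.gradeFactor T l (x l)) = 0 := by
  obtain ⟨l, hl⟩ : ∃ l, ¬(l ∈ T ↔ l ∈ S) := by
    by_contra! h'
    exact h (Finset.ext h')
  rw [(cls (𝓔.base K) n).map_coord_zero l]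
  by_cases hS : l ∈ S
  · rw [gradeFactor_of_notMem _ fun hT => hl (iff_of_true hT hS), 𝓔.piA_of_mem_M (hM l hS)]
  · have hT : l ∈ T := by_contra fun hT => hl (iff_of_false hT hS)
    rw [gradeFactor_of_mem _ hT, 𝓔.piM_of_mem_copyA (hA l hS)]

lemma gradeFactor_apply_self {x : Fin (n + 1) → E} {S : Finset (Fin (n + 1))}
    (hM : ∀ l ∈ S, x l ∈ 𝓔.M) (hA : ∀ l ∉ S, x l ∈ 𝓔.copyA) :
    (fun l => 𝓔.gradeFactor S l (x l)) = x := by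
  funext l
  by_cases hS : l ∈ S
  · rw [gradeFactor_of_mem _ hS, 𝓔.piM_of_mem_M (hM l hS)]
  · rw [gradeFactor_of_notMem _ hS, 𝓔.piA_of_mem_copyA (hA l hS)]

variable {K} in
lemma gradeProj_of_mem_X (w' : ℕ) {z : CycTensor (𝓔.base K) n} (hz : z ∈ 𝓔.X K n w) :
    𝓔.gradeProj K n w' z = if w' = w + 1 then z else 0 := by
  suffices h : 𝓔.X K n w ≤ LinearMap.eqLocus (𝓔.gradeProj K n w')
      (if w' = w + 1 then LinearMap.id else 0) by
    rw [h hz]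
    split_ifs <;> rfl
  refine 𝓔.X_le_of_finset K fun x S _ hS hM hA => ?_
  rw [LinearMap.mem_eqLocus, gradeProj_cls]
  split_ifs with hw
  · rw [Finset.sum_eq_single S (fun T _ => 𝓔.cls_gradeFactor_eq_zero hM hA)
      fun h => absurd (Finset.mem_powersetCard_univ.2 (hS.trans hw.symm)) h,
      𝓔.gradeFactor_apply_self hM hA, LinearMap.id_apply]
  · refine Finset.sum_eq_zero fun T hT => 𝓔.cls_gradeFactor_eq_zero hM hA ?_
    rintro rfl
    exact hw ((Finset.mem_powersetCard_univ.1 hT).symm.trans hS)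

end grading

section firstEntry

/-- The span of the tensors whose first entry is in `M`. -/
def F (n : ℕ) : Submodule k (CycTensor (𝓔.base K) n) := ⨆ w, 𝓔.X K n w

lemma X_le_F (n w : ℕ) : 𝓔.X K n w ≤ 𝓔.F K n := le_iSup _ w

lemma F_le {N : Submodule k (CycTensor (𝓔.base K) n)}
    (h : ∀ x : Fin (n + 1) → E, x 0 ∈ 𝓔.M → cls (𝓔.base K) n x ∈ N) : 𝓔.F K n ≤ N :=
  iSup_le fun _ => 𝓔.X_le_of_finset K fun x _ h0 _ hM _ => h x (hM 0 h0)

variable {K}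

lemma gradeProj_zero_of_mem_F {z : CycTensor (𝓔.base K) n} (hz : z ∈ 𝓔.F K n) :
    𝓔.gradeProj K n 0 z = 0 := by
  suffices h : 𝓔.F K n ≤ LinearMap.ker (𝓔.gradeProj K n 0) from h hz
  exact iSup_le fun w z hz => 𝓔.gradeProj_of_mem_X 0 hz

lemma gradeProj_mem_X (w : ℕ) {z : CycTensor (𝓔.base K) n} (hz : z ∈ 𝓔.F K n) :
    𝓔.gradeProj K n (w + 1) z ∈ 𝓔.X K n w := by
  suffices h : 𝓔.F K n ≤ (𝓔.X K n w).comap (𝓔.gradeProj K n (w + 1)) from h hz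
  refine iSup_le fun w' z hz => ?_
  rw [Submodule.mem_comap, 𝓔.gradeProj_of_mem_X _ hz]
  split_ifs with h
  · obtain rfl : w = w' := Nat.succ_injective h
    exact hz
  · exact zero_mem _

lemma sum_gradeProj_of_mem_F {z : CycTensor (𝓔.base K) n} (hz : z ∈ 𝓔.F K n) :
    ∑ w ∈ Finset.range (n + 1), 𝓔.gradeProj K n (w + 1) z = z := by
  have h := 𝓔.sum_gradeProj K z
  rwa [Finset.sum_range_succ', 𝓔.gradeProj_zero_of_mem_F hz, add_zero] at h

lemma cls_mem_F {x : Fin (n + 1) → E} (h0 : x 0 ∈ 𝓔.M) : cls (𝓔.base K) n x ∈ 𝓔.F K n := by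
  rw [← 𝓔.sum_gradeProj K (cls (𝓔.base K) n x)]
  refine Submodule.sum_mem _ fun w _ => ?_
  rw [gradeProj_cls]
  refine Submodule.sum_mem _ fun S _ => ?_
  by_cases hS : (0 : Fin (n + 1)) ∈ S
  · classical
    refine 𝓔.X_le_F K n (∑ l, (if l ∈ S then 1 else 0) - 1) (𝓔.X_of_gr K _
      (fun l => if l ∈ S then 1 else 0) (fun l => ?_) (by simp [hS]) ?_)
    · rw [gradeFactor]
      split_ifs
      exacts [𝓔.piM_mem _, 𝓔.piA_mem _]
    · have : 0 < ∑ l, (if l ∈ S then 1 else 0) :=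
        Finset.sum_pos' (fun _ _ => Nat.zero_le _) ⟨0, Finset.mem_univ _, by simp [hS]⟩
      omega
  · rw [(cls (𝓔.base K) n).map_coord_zero 0]
    · exact zero_mem _
    · rw [gradeFactor_of_notMem _ hS, 𝓔.piA_of_mem_M h0]

lemma mapCyc_p_of_mem_F {z : CycTensor (𝓔.base K) n} (hz : z ∈ 𝓔.F K n) :
    mapCyc 𝓔.p (𝓔.p_base K) n z = 0 := by
  suffices h : 𝓔.F K n ≤ LinearMap.ker (mapCyc 𝓔.p (𝓔.p_base K) n) from h hz
  refine 𝓔.F_le K fun x h0 => ?_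
  rw [LinearMap.mem_ker, mapCyc_cls, (cls K n).map_coord_zero 0]
  exact h0

/-- The projection to `M` in position `0`. -/
def firstProj (l : Fin (n + 1)) : E →ₗ[k] E := if l = 0 then 𝓔.piM else LinearMap.id

variable (K)

lemma isBimoduleMap_firstProj (l : Fin (n + 1)) :
    IsBimoduleMap (𝓔.base K) (𝓔.firstProj l) := by
  unfold firstProj
  split_ifs
  exacts [𝓔.isBimoduleMap_piM K, isBimoduleMap_id _]

/-- The projection to the tensors whose first entry is in `M`. -/
def projF (n : ℕ) : CycTensor (𝓔.base K) n →ₗ[k] CycTensor (𝓔.base K) n :=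
  mapFactors 𝓔.firstProj (fun l => 𝓔.isBimoduleMap_firstProj K l)

lemma projF_mem_F (z : CycTensor (𝓔.base K) n) : 𝓔.projF K n z ∈ 𝓔.F K n := by
  refine mem_of_forall_cls_mem (N := (𝓔.F K n).comap (𝓔.projF K n)) (fun x => ?_) z
  rw [Submodule.mem_comap, projF, mapFactors_cls]
  exact 𝓔.cls_mem_F (𝓔.piM_mem (x 0))

variable {K} in
lemma projF_of_mem_F {z : CycTensor (𝓔.base K) n} (hz : z ∈ 𝓔.F K n) : 𝓔.projF K n z = z := by
  suffices h : 𝓔.F K n ≤ LinearMap.eqLocus (𝓔.projF K n) LinearMap.id from h hz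
  refine 𝓔.F_le K fun x h0 => ?_
  rw [LinearMap.mem_eqLocus, projF, mapFactors_cls, LinearMap.id_apply]
  congr 1
  funext l
  rw [firstProj]
  split_ifs with h
  · rw [h, 𝓔.piM_of_mem_M h0]
  · rfl

end firstEntry

section differentials

variable {K}

lemma dot_add_tri : 𝓔.dot + 𝓔.tri = LinearMap.mul k E :=
  LinearMap.ext₂ fun _ _ => sub_add_cancel _ _

lemma hochschild_apply (z : CycTensor (𝓔.base K) (n + 1)) :
    hochschild (𝓔.base K) n z = 𝓔.b K n z + 𝓔.d K n z := by
  obtain ⟨z, rfl⟩ := (tensorRel (𝓔.base K) (n + 1)).mkQ_surjective z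
  rw [hochschild_mkQ, b, d, descend_hochMul_mkQ, descend_hochMul_mkQ, ← map_add, ← 𝓔.dot_add_tri,
    ← Finset.sum_add_distrib]
  simp only [cyclicFace_add]

lemma d_mkQ (z : ⨂[k]^(n + 2) E) :
    𝓔.d K n ((tensorRel (𝓔.base K) (n + 1)).mkQ z) =
      𝓔.d' K n ((tensorRel (𝓔.base K) (n + 1)).mkQ z) +
        (tensorRel (𝓔.base K) n).mkQ (cyclicFace 𝓔.tri n (n + 1) z) := by
  rw [d, d', descend_hochMul_mkQ, descend_hochMul'_mkQ, Finset.sum_range_succ _ (n + 1), map_add]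

lemma d'_of_mem_X_zero {z : CycTensor (𝓔.base K) (n + 1)} (hz : z ∈ 𝓔.X K (n + 1) 0) :
    𝓔.d' K n z = 0 := by
  suffices h : 𝓔.X K (n + 1) 0 ≤ LinearMap.ker (𝓔.d' K n) from h hz
  refine 𝓔.X_le_of_finset K fun x S h0 hS _ hA => ?_
  obtain ⟨a, rfl⟩ := Finset.card_eq_one.1 hS
  obtain rfl := Finset.mem_singleton.1 h0
  rw [LinearMap.mem_ker, d', descend_cls, hochMul'_apply]
  refine Finset.sum_eq_zero fun j _ => ?_
  have hj : 𝓔.piM (x j.succ) = 0 :=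
    𝓔.piM_of_mem_copyA (hA _ (Finset.notMem_singleton.2 (Fin.succ_ne_zero j)))
  rw [(cls (𝓔.base K) n).map_coord_zero j, smul_zero]
  simp only [contr, lt_self_iff_false, if_false, if_true, tri_apply, hj, mul_zero]

lemma d_of_mem_X_zero {z : CycTensor (𝓔.base K) (n + 1)} (hz : z ∈ 𝓔.X K (n + 1) 0) :
    𝓔.d K n z = 0 := by
  suffices h : 𝓔.X K (n + 1) 0 ≤ LinearMap.eqLocus (𝓔.d K n) (𝓔.d' K n) from
    (h hz).trans (𝓔.d'_of_mem_X_zero hz)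
  refine 𝓔.X_le_of_finset K fun x S h0 hS _ hA => ?_
  obtain ⟨a, rfl⟩ := Finset.card_eq_one.1 hS
  obtain rfl := Finset.mem_singleton.1 h0
  have hlast : 𝓔.piM (x (Fin.last (n + 1))) = 0 :=
    𝓔.piM_of_mem_copyA (hA _ (Finset.notMem_singleton.2 (Fin.last_pos.ne')))
  refine (𝓔.d_mkQ (PiTensorProduct.tprod k x)).trans (add_eq_left.2 ?_)
  rw [cyclicFace_tprod, map_smul, (PiTensorProduct.tprod k).map_coord_zero 0, map_zero, smul_zero]
  simp only [mergeAt, Fin.val_zero, lt_add_iff_pos_right, Nat.lt_add_one, and_self, if_true,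
    tri_apply, hlast, zero_mul]

end differentials

section graded

variable {K}

lemma t_mem_F (z : CycTensor (𝓔.base K) n) : 𝓔.t K n z ∈ 𝓔.F K n := by
  refine mem_of_forall_cls_mem (N := (𝓔.F K n).comap (𝓔.t K n)) (fun x => ?_) z
  rw [Submodule.mem_comap, t, descend_cls, tMul_apply]
  refine Submodule.sum_mem _ fun i _ => Submodule.smul_mem _ _ (𝓔.cls_mem_F ?_)
  simpa only [rot, zero_add, lastProj, lt_self_iff_false, if_false, if_true] using 𝓔.piM_mem (x i)

lemma map_mem_F_of_degree_zero {m : ℕ}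
    {f : CycTensor (𝓔.base K) m →ₗ[k] CycTensor (𝓔.base K) n}
    (hf : ∀ w, ∀ z ∈ 𝓔.X K m w, f z ∈ 𝓔.X K n w) {z : CycTensor (𝓔.base K) m}
    (hz : z ∈ 𝓔.F K m) : f z ∈ 𝓔.F K n := by
  suffices h : 𝓔.F K m ≤ (𝓔.F K n).comap f from h hz
  exact iSup_le fun w z hz => 𝓔.X_le_F K n w (hf w z hz)

lemma map_mem_F_of_degree_one {m : ℕ}
    {f : CycTensor (𝓔.base K) m →ₗ[k] CycTensor (𝓔.base K) n}
    (hf₀ : ∀ z ∈ 𝓔.X K m 0, f z = 0) (hf : ∀ w, ∀ z ∈ 𝓔.X K m (w + 1), f z ∈ 𝓔.X K n w)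
    {z : CycTensor (𝓔.base K) m} (hz : z ∈ 𝓔.F K m) : f z ∈ 𝓔.F K n := by
  suffices h : 𝓔.F K m ≤ (𝓔.F K n).comap f from h hz
  refine iSup_le fun w z hz => ?_
  cases w with
  | zero => rw [Submodule.mem_comap, hf₀ z hz]; exact zero_mem _
  | succ w => exact 𝓔.X_le_F K n w (hf w z hz)

lemma gradeProj_map_of_degree_zero {m : ℕ}
    {f : CycTensor (𝓔.base K) m →ₗ[k] CycTensor (𝓔.base K) n}
    (hf : ∀ w, ∀ z ∈ 𝓔.X K m w, f z ∈ 𝓔.X K n w) (w : ℕ) {z : CycTensor (𝓔.base K) m}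
    (hz : z ∈ 𝓔.F K m) : 𝓔.gradeProj K n w (f z) = f (𝓔.gradeProj K m w z) := by
  suffices h : 𝓔.F K m ≤ LinearMap.eqLocus (𝓔.gradeProj K n w ∘ₗ f) (f ∘ₗ 𝓔.gradeProj K m w)
    from h hz
  refine iSup_le fun w' z hz => ?_
  rw [LinearMap.mem_eqLocus, LinearMap.comp_apply, LinearMap.comp_apply,
    𝓔.gradeProj_of_mem_X w hz, 𝓔.gradeProj_of_mem_X w (hf w' z hz), apply_ite f, map_zero]

lemma gradeProj_map_of_degree_one {m : ℕ}
    {f : CycTensor (𝓔.base K) m →ₗ[k] CycTensor (𝓔.base K) n}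
    (hf₀ : ∀ z ∈ 𝓔.X K m 0, f z = 0) (hf : ∀ w, ∀ z ∈ 𝓔.X K m (w + 1), f z ∈ 𝓔.X K n w)
    (w : ℕ) {z : CycTensor (𝓔.base K) m} (hz : z ∈ 𝓔.F K m) :
    𝓔.gradeProj K n w (f z) = f (𝓔.gradeProj K m (w + 1) z) := by
  suffices h : 𝓔.F K m ≤
      LinearMap.eqLocus (𝓔.gradeProj K n w ∘ₗ f) (f ∘ₗ 𝓔.gradeProj K m (w + 1)) from h hz
  refine iSup_le fun w' z hz => ?_
  rw [LinearMap.mem_eqLocus, LinearMap.comp_apply, LinearMap.comp_apply,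
    𝓔.gradeProj_of_mem_X (w + 1) hz, apply_ite f, map_zero]
  cases w' with
  | zero => rw [hf₀ z hz, map_zero, ite_self]
  | succ w' => simp only [𝓔.gradeProj_of_mem_X w (hf w' z hz), Nat.add_right_cancel_iff]

lemma b_mem_F {z : CycTensor (𝓔.base K) (n + 1)} (hz : z ∈ 𝓔.F K (n + 1)) :
    𝓔.b K n z ∈ 𝓔.F K n := 𝓔.map_mem_F_of_degree_zero (𝓔.b_mem K n) hz

lemma d_mem_F {z : CycTensor (𝓔.base K) (n + 1)} (hz : z ∈ 𝓔.F K (n + 1)) :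
    𝓔.d K n z ∈ 𝓔.F K n :=
  𝓔.map_mem_F_of_degree_one (fun _ => 𝓔.d_of_mem_X_zero) (𝓔.d_mem K n) hz

lemma d'_mem_F {z : CycTensor (𝓔.base K) (n + 1)} (hz : z ∈ 𝓔.F K (n + 1)) :
    𝓔.d' K n z ∈ 𝓔.F K n :=
  𝓔.map_mem_F_of_degree_one (fun _ => 𝓔.d'_of_mem_X_zero) (𝓔.d'_mem K n) hz

lemma gradeProj_b (w : ℕ) {z : CycTensor (𝓔.base K) (n + 1)} (hz : z ∈ 𝓔.F K (n + 1)) :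
    𝓔.gradeProj K n w (𝓔.b K n z) = 𝓔.b K n (𝓔.gradeProj K (n + 1) w z) :=
  𝓔.gradeProj_map_of_degree_zero (𝓔.b_mem K n) w hz

lemma gradeProj_t (w : ℕ) {z : CycTensor (𝓔.base K) n} (hz : z ∈ 𝓔.F K n) :
    𝓔.gradeProj K n w (𝓔.t K n z) = 𝓔.t K n (𝓔.gradeProj K n w z) :=
  𝓔.gradeProj_map_of_degree_zero (𝓔.t_mem K n) w hz

lemma gradeProj_d (w : ℕ) {z : CycTensor (𝓔.base K) (n + 1)} (hz : z ∈ 𝓔.F K (n + 1)) :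
    𝓔.gradeProj K n w (𝓔.d K n z) = 𝓔.d K n (𝓔.gradeProj K (n + 1) (w + 1) z) :=
  𝓔.gradeProj_map_of_degree_one (fun _ => 𝓔.d_of_mem_X_zero) (𝓔.d_mem K n) w hz

lemma gradeProj_d' (w : ℕ) {z : CycTensor (𝓔.base K) (n + 1)} (hz : z ∈ 𝓔.F K (n + 1)) :
    𝓔.gradeProj K n w (𝓔.d' K n z) = 𝓔.d' K n (𝓔.gradeProj K (n + 1) (w + 1) z) :=
  𝓔.gradeProj_map_of_degree_one (fun _ => 𝓔.d'_of_mem_X_zero) (𝓔.d'_mem K n) w hz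

lemma t_pow_mem (l : ℕ) {z : CycTensor (𝓔.base K) n} (hz : z ∈ 𝓔.X K n w) :
    (𝓔.t K n ^ l) z ∈ 𝓔.X K n w := by
  induction l with
  | zero => exact hz
  | succ l ih =>
    rw [pow_succ', Module.End.mul_apply]
    exact 𝓔.t_mem K n w _ ih

variable (K) in
/-- The norm `N = 1 + t + ⋯ + t^w` on tensors of arbitrary degree. -/
def Nw (n w : ℕ) : CycTensor (𝓔.base K) n →ₗ[k] CycTensor (𝓔.base K) n :=
  ∑ l ∈ Finset.range (w + 1), 𝓔.t K n ^ l

lemma Nw_mem (w' : ℕ) {z : CycTensor (𝓔.base K) n} (hz : z ∈ 𝓔.X K n w) :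
    𝓔.Nw K n w' z ∈ 𝓔.X K n w := by
  rw [Nw, LinearMap.sum_apply]
  exact Submodule.sum_mem _ fun l _ => 𝓔.t_pow_mem l hz

end graded

/-! ### The homotopy formula and the decomposition `F ⊕ Φ(F)` -/

section homotopyFormula

lemma i_mem_base : ∀ c ∈ K, 𝓔.i c ∈ 𝓔.base K := fun c hc => ⟨c, hc, rfl⟩

variable {K}

lemma mkQ_mapTail_zero (z : ⨂[k]^(n + 1) E) :
    (tensorRel (𝓔.base K) n).mkQ (𝓔.mapTail n 0 z) =
      mapCyc 𝓔.i (𝓔.i_mem_base K) n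
        (mapCyc 𝓔.p (𝓔.p_base K) n ((tensorRel (𝓔.base K) n).mkQ z)) := by
  refine eq_of_tprod ((tensorRel (𝓔.base K) n).mkQ ∘ₗ 𝓔.mapTail n 0)
    (mapCyc 𝓔.i (𝓔.i_mem_base K) n ∘ₗ mapCyc 𝓔.p (𝓔.p_base K) n ∘ₗ
      (tensorRel (𝓔.base K) n).mkQ) (fun x => ?_) z
  have hp := mapCyc_cls 𝓔.p (𝓔.p_base K) n x
  have hi := mapCyc_cls 𝓔.i (𝓔.i_mem_base K) n fun l => 𝓔.p (x l)
  rw [LinearMap.comp_apply, mapTail_tprod]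
  exact ((congrArg _ hp).trans hi).symm

lemma mkQ_cyclicFace_piM_mem_F (z : ⨂[k]^(n + 2) E) :
    (tensorRel (𝓔.base K) n).mkQ (cyclicFace (LinearMap.mul k E ∘ₗ 𝓔.piM) n (n + 1) z) ∈
      𝓔.F K n := by
  suffices h : Submodule.span k (Set.range (PiTensorProduct.tprod k)) ≤
      (𝓔.F K n).comap ((tensorRel (𝓔.base K) n).mkQ ∘ₗ
        cyclicFace (LinearMap.mul k E ∘ₗ 𝓔.piM) n (n + 1)) from
    h (PiTensorProduct.span_tprod_eq_top.ge Submodule.mem_top)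
  refine Submodule.span_le.2 (Set.range_subset_iff.2 fun x => ?_)
  rw [SetLike.mem_coe, Submodule.mem_comap, LinearMap.comp_apply, cyclicFace_tprod, map_smul]
  refine Submodule.smul_mem _ _ (𝓔.cls_mem_F ?_)
  simp only [mergeAt, Fin.val_zero, lt_add_iff_pos_right, Nat.lt_add_one, and_self, if_true,
    LinearMap.comp_apply, LinearMap.mul_apply', LinearMap.mem_ker, AlgHom.toLinearMap_apply,
    map_mul]
  rw [show 𝓔.p (𝓔.piM _) = 0 from 𝓔.piM_mem _, zero_mul]

lemma hochschild_phi_of_mem_F {z : CycTensor (𝓔.base K) (n + 1)} (hz : z ∈ 𝓔.F K (n + 1)) :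
    hochschild (𝓔.base K) (n + 1) (𝓔.phi K (n + 1) z) =
      z - 𝓔.t K (n + 1) z - 𝓔.phi K n (𝓔.b K n z + 𝓔.d' K n z) := by
  suffices h : 𝓔.F K (n + 1) ≤ LinearMap.eqLocus
      (hochschild (𝓔.base K) (n + 1) ∘ₗ 𝓔.phi K (n + 1))
      (LinearMap.id - 𝓔.t K (n + 1) - 𝓔.phi K n ∘ₗ (𝓔.b K n + 𝓔.d' K n)) from h hz
  refine 𝓔.F_le K fun x h0 => ?_
  have hA : (tensorRel (𝓔.base K) (n + 1)).mkQ
      (𝓔.mapTail (n + 1) 0 (PiTensorProduct.tprod k x)) = 0 := by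
    rw [mkQ_mapTail_zero]
    exact (congrArg _ (𝓔.mapCyc_p_of_mem_F (𝓔.cls_mem_F h0))).trans (map_zero _)
  have hlast : cyclicFace (LinearMap.mul k E ∘ₗ 𝓔.piM) n (n + 1) (PiTensorProduct.tprod k x) =
      cyclicFace 𝓔.tri n (n + 1) (PiTensorProduct.tprod k x) := by
    rw [cyclicFace_tprod, cyclicFace_tprod]
    congr 2
    funext l
    have := l.2
    simp only [mergeAt, LinearMap.comp_apply, LinearMap.mul_apply', tri_apply, 𝓔.piM_of_mem_M h0]
    grind
  have h := 𝓔.hochschild_phi_mkQ K (PiTensorProduct.tprod k x)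
  rw [hA, sub_zero, hlast, 𝓔.hochschild_apply (n := n), d_mkQ, ← add_assoc,
    add_sub_cancel_right] at h
  exact h

lemma t_zero {z : CycTensor (𝓔.base K) 0} (hz : mapCyc 𝓔.p (𝓔.p_base K) 0 z = 0) :
    𝓔.t K 0 z = z := by
  obtain ⟨z, rfl⟩ := (tensorRel (𝓔.base K) 0).mkQ_surjective z
  rw [t_mkQ, Finset.sum_range_one, pow_zero, Module.End.one_apply,
    𝓔.mapTail_of_lt (Nat.succ_pos 0), map_sub, mkQ_mapTail_zero, hz, map_zero, sub_zero]

lemma mem_F_zero {z : CycTensor (𝓔.base K) 0} (hz : mapCyc 𝓔.p (𝓔.p_base K) 0 z = 0) :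
    z ∈ 𝓔.F K 0 := 𝓔.t_zero hz ▸ 𝓔.t_mem_F z

variable (K) in
/-- The image of the comparison map: the sum of `F` and of `Φ(F)`. -/
def imTheta : (n : ℕ) → Submodule k (CycTensor (𝓔.base K) n)
  | 0 => 𝓔.F K 0
  | n + 1 => 𝓔.F K (n + 1) ⊔ (𝓔.F K n).map (𝓔.phi K n)

lemma F_le_imTheta : ∀ n, 𝓔.F K n ≤ 𝓔.imTheta K n
  | 0 => le_rfl
  | _ + 1 => le_sup_left

lemma phi_mem_imTheta {z : CycTensor (𝓔.base K) n} (hz : z ∈ 𝓔.F K n) :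
    𝓔.phi K n z ∈ 𝓔.imTheta K (n + 1) :=
  Submodule.mem_sup_right (Submodule.mem_map_of_mem hz)

lemma hochschild_phi_add_phi_hochschild_sub_mem_imTheta {z : CycTensor (𝓔.base K) (n + 1)}
    (hz : mapCyc 𝓔.p (𝓔.p_base K) (n + 1) z = 0) :
    hochschild (𝓔.base K) (n + 1) (𝓔.phi K (n + 1) z) +
      𝓔.phi K n (hochschild (𝓔.base K) n z) - z ∈ 𝓔.imTheta K (n + 1) := by
  obtain ⟨z, rfl⟩ := (tensorRel (𝓔.base K) (n + 1)).mkQ_surjective z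
  rw [hochschild_phi_mkQ, mkQ_mapTail_zero, hz, map_zero, sub_zero, map_sub]
  have ht := 𝓔.F_le_imTheta (n + 1) (𝓔.t_mem_F ((tensorRel (𝓔.base K) (n + 1)).mkQ z))
  have hphi := 𝓔.phi_mem_imTheta (𝓔.mkQ_cyclicFace_piM_mem_F (K := K) z)
  convert Submodule.sub_mem _ hphi ht using 1
  abel

end homotopyFormula

section unitTensors

variable {K}

lemma phi_phi (z : CycTensor (𝓔.base K) n) : 𝓔.phi K (n + 1) (𝓔.phi K n z) = 0 := by
  simp only [phi, LinearMap.sum_apply, LinearMap.comp_apply, map_sum,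
    unitInsert_mapFactors_unitInsert, Finset.sum_const_zero]

lemma connes_phi (z : CycTensor (𝓔.base K) n) :
    connes (𝓔.base K) (n + 1) (𝓔.phi K n z) = 0 := by
  simp only [phi, connes_apply, LinearMap.sum_apply, LinearMap.comp_apply, map_sum,
    unitInsert_unitInsert, Finset.sum_const_zero]

lemma phi_connes (z : CycTensor (𝓔.base K) n) :
    𝓔.phi K (n + 1) (connes (𝓔.base K) n z) = 0 := by
  simp only [phi, connes_apply, LinearMap.sum_apply, LinearMap.comp_apply, map_sum,
    unitInsert_mapFactors_unitInsert, Finset.sum_const_zero]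

lemma mapCyc_p_mapFactors_tailProj (r : ℕ) (z : CycTensor (𝓔.base K) n) :
    mapCyc 𝓔.p (𝓔.p_base K) n (mapFactors (fun l : Fin (n + 1) => 𝓔.tailProj r l)
      (fun l => 𝓔.isBimoduleMap_tailProj K r l) z) = mapCyc 𝓔.p (𝓔.p_base K) n z := by
  suffices h : mapCyc 𝓔.p (𝓔.p_base K) n ∘ₗ
      mapFactors (fun l : Fin (n + 1) => 𝓔.tailProj r l)
        (fun l => 𝓔.isBimoduleMap_tailProj K r l) = mapCyc 𝓔.p (𝓔.p_base K) n from
    LinearMap.congr_fun h z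
  refine cyc_hom_ext fun x => ?_
  rw [LinearMap.comp_apply, mapFactors_cls, mapCyc_cls, mapCyc_cls]
  congr 1
  funext l
  rw [tailProj]
  split_ifs
  · rfl
  · exact 𝓔.p_i _

lemma mapCyc_phi (z : CycTensor (𝓔.base K) n) :
    mapCyc 𝓔.p (𝓔.p_base K) (n + 1) (𝓔.phi K n z) =
      connes K n (mapCyc 𝓔.p (𝓔.p_base K) n z) := by
  simp only [phi, connes_apply, LinearMap.sum_apply, LinearMap.comp_apply, map_sum,
    mapCyc_unitInsert, mapCyc_p_mapFactors_tailProj]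

end unitTensors

section retraction

variable {K}

lemma projF_mkQ_unitCons (z : ⨂[k]^(n + 1) E) :
    𝓔.projF K (n + 1) ((tensorRel (𝓔.base K) (n + 1)).mkQ (unitCons k E n z)) = 0 := by
  refine eq_of_tprod (𝓔.projF K (n + 1) ∘ₗ (tensorRel (𝓔.base K) (n + 1)).mkQ ∘ₗ
    unitCons k E n) 0 (fun x => ?_) z
  have hone : 𝓔.piM 1 = 0 := 𝓔.piM_of_mem (𝓔.base K).one_mem
  rw [LinearMap.comp_apply, LinearMap.comp_apply, unitCons_tprod, projF, mapFactors_mkQ,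
    PiTensorProduct.map_tprod, (PiTensorProduct.tprod k).map_coord_zero 0, map_zero,
    LinearMap.zero_apply]
  rw [firstProj, if_pos rfl, Fin.cons_zero, hone]

lemma projF_phi (z : CycTensor (𝓔.base K) n) : 𝓔.projF K (n + 1) (𝓔.phi K n z) = 0 := by
  obtain ⟨z, rfl⟩ := (tensorRel (𝓔.base K) n).mkQ_surjective z
  rw [phi_mkQ, projF_mkQ_unitCons]

lemma projF_mkQ_rotate_pow_mapTail {r : ℕ} (hr : r ≤ n) (z : ⨂[k]^(n + 1) E) :
    𝓔.projF K n
      ((tensorRel (𝓔.base K) n).mkQ ((rotate k E n ^ r) (𝓔.mapTail n r z))) = 0 := by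
  refine eq_of_tprod (𝓔.projF K n ∘ₗ (tensorRel (𝓔.base K) n).mkQ ∘ₗ (rotate k E n ^ r) ∘ₗ
    𝓔.mapTail n r) 0 (fun x => ?_) z
  simp only [LinearMap.comp_apply, mapTail_tprod, rotate_pow_tprod, map_smul, projF,
    mapFactors_mkQ, PiTensorProduct.map_tprod]
  have hval : ((Fin.ofNat (n + 1) r : Fin (n + 1)) : ℕ) = r :=
    Nat.mod_eq_of_lt (Nat.lt_succ_of_le hr)
  rw [(PiTensorProduct.tprod k).map_coord_zero 0, map_zero, smul_zero, LinearMap.zero_apply]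
  rw [firstProj, if_pos rfl, rot, zero_add, hval, tailProj_of_le _ le_rfl, piM_piA]

/-- The projections to `A` in position `0` and to `M` in position `1`. -/
def epsProj (l : Fin (n + 2)) : E →ₗ[k] E :=
  if l = 0 then 𝓔.piA else if l = 1 then 𝓔.piM else LinearMap.id

variable (K) in
lemma isBimoduleMap_epsProj (l : Fin (n + 2)) : IsBimoduleMap (𝓔.base K) (𝓔.epsProj l) := by
  unfold epsProj
  split_ifs
  exacts [𝓔.isBimoduleMap_piA K, 𝓔.isBimoduleMap_piM K, isBimoduleMap_id _]

variable (K) in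
lemma face_epsProj_descends (n : ℕ) : Descends (𝓔.base K)
    ((face (𝓔.base K) (LinearMap.mul k E) n 0).compLinearMap 𝓔.epsProj) where
  balanced x j c hc := by
    simp only [MultilinearMap.compLinearMap_apply,
      apply_update_mul_right (𝓔.isBimoduleMap_epsProj K) x j hc,
      apply_update_mul_left (𝓔.isBimoduleMap_epsProj K) x (j + 1) hc]
    exact face_balanced (isProd_mul _) 0 (fun l => 𝓔.epsProj l (x l)) j c hc
  degen x j hj hx := by
    change cls (𝓔.base K) n (contr (LinearMap.mul k E) 0 fun l => 𝓔.epsProj l (x l)) = 0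
    by_cases h1 : j = 1
    · rw [(cls (𝓔.base K) n).map_coord_zero 0]
      subst h1
      simp [contr, epsProj, 𝓔.piM_of_mem hx]
    · refine cls_contr_degen _ 0 _ hj ?_ ?_ ?_
      · simpa only [epsProj, hj, h1, if_false, LinearMap.id_apply] using hx
      · exact fun h => hj (Fin.ext (h.trans (by simp)))
      · exact fun h => h1 (Fin.ext (h.trans (by simp)))

variable (K) in
/-- The map `x₀ ⊗ x₁ ⊗ ⋯ ⊗ xₙ ↦ x₀ x₁ ⊗ x₂ ⊗ ⋯ ⊗ xₙ` for `x₀ ∈ A`, `x₁ ∈ M`, which is zero if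
`x₀ ∈ M` or `x₁ ∈ A`. It is a retraction of the restriction of `Φ` to `F`. -/
def eps (n : ℕ) : CycTensor (𝓔.base K) (n + 1) →ₗ[k] CycTensor (𝓔.base K) n :=
  descend _ (𝓔.face_epsProj_descends K n)

lemma eps_cls (x : Fin (n + 2) → E) : 𝓔.eps K n (cls (𝓔.base K) (n + 1) x) =
    cls (𝓔.base K) n (contr (LinearMap.mul k E) 0 fun l => 𝓔.epsProj l (x l)) :=
  descend_cls _ (𝓔.face_epsProj_descends K n) x

lemma eps_mem_F (z : CycTensor (𝓔.base K) (n + 1)) : 𝓔.eps K n z ∈ 𝓔.F K n := by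
  refine mem_of_forall_cls_mem (N := (𝓔.F K n).comap (𝓔.eps K n)) (fun x => ?_) z
  have hM : 𝓔.p (𝓔.piM (x 1)) = 0 := 𝓔.piM_mem (x 1)
  rw [Submodule.mem_comap, eps_cls]
  refine 𝓔.cls_mem_F ?_
  simp [contr, epsProj, hM]

lemma eps_of_mem_F {z : CycTensor (𝓔.base K) (n + 1)} (hz : z ∈ 𝓔.F K (n + 1)) :
    𝓔.eps K n z = 0 := by
  suffices h : 𝓔.F K (n + 1) ≤ LinearMap.ker (𝓔.eps K n) from h hz
  refine 𝓔.F_le K fun x h0 => ?_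
  rw [LinearMap.mem_ker, eps_cls, (cls (𝓔.base K) n).map_coord_zero 0]
  simp [contr, epsProj, 𝓔.piA_of_mem_M h0]

lemma eps_mkQ_unitCons (z : ⨂[k]^(n + 1) E) :
    𝓔.eps K n ((tensorRel (𝓔.base K) (n + 1)).mkQ (unitCons k E n z)) =
      𝓔.projF K n ((tensorRel (𝓔.base K) n).mkQ z) := by
  refine eq_of_tprod (𝓔.eps K n ∘ₗ (tensorRel (𝓔.base K) (n + 1)).mkQ ∘ₗ unitCons k E n)
    (𝓔.projF K n ∘ₗ (tensorRel (𝓔.base K) n).mkQ) (fun x => ?_) z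
  have hone : 𝓔.piA 1 = 1 := 𝓔.piA_of_mem (𝓔.base K).one_mem
  rw [LinearMap.comp_apply, LinearMap.comp_apply, unitCons_tprod]
  refine (𝓔.eps_cls _).trans (.trans ?_ (mapFactors_cls _ (𝓔.isBimoduleMap_firstProj K) x).symm)
  congr 1
  funext l
  obtain rfl | hl := eq_or_ne l 0
  · simp [contr, epsProj, firstProj, hone]
  · have hl1 : l.succ ≠ 1 := fun h => hl (Fin.succ_injective _ h)
    simp [contr, epsProj, firstProj, hl, hl1]

lemma eps_phi (z : CycTensor (𝓔.base K) n) : 𝓔.eps K n (𝓔.phi K n z) = 𝓔.projF K n z := by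
  obtain ⟨z, rfl⟩ := (tensorRel (𝓔.base K) n).mkQ_surjective z
  rw [phi_mkQ, eps_mkQ_unitCons, Finset.sum_range_succ, rotate_pow_eq_one,
    𝓔.mapTail_of_lt n.lt_succ_self, Module.End.one_apply, map_add, map_add, map_sum, map_sum,
    Finset.sum_eq_zero, zero_add]
  exact fun i hi => 𝓔.projF_mkQ_rotate_pow_mapTail (Finset.mem_range.1 hi) z

lemma eq_zero_of_add_phi_eq_zero {f : CycTensor (𝓔.base K) (n + 1)}
    {g : CycTensor (𝓔.base K) n} (hf : f ∈ 𝓔.F K (n + 1)) (hg : g ∈ 𝓔.F K n)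
    (h : f + 𝓔.phi K n g = 0) : f = 0 ∧ g = 0 := by
  constructor
  · have := congrArg (𝓔.projF K (n + 1)) h
    rwa [map_add, 𝓔.projF_of_mem_F hf, projF_phi, add_zero, map_zero] at this
  · have := congrArg (𝓔.eps K n) h
    rwa [map_add, 𝓔.eps_of_mem_F hf, eps_phi, 𝓔.projF_of_mem_F hg, zero_add, map_zero] at this

lemma projF_add_phi_eps {z : CycTensor (𝓔.base K) (n + 1)} (hz : z ∈ 𝓔.imTheta K (n + 1)) :
    𝓔.projF K (n + 1) z + 𝓔.phi K n (𝓔.eps K n z) = z := by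
  obtain ⟨f, hf, -, ⟨g, hg, rfl⟩, rfl⟩ := Submodule.mem_sup.1 hz
  rw [map_add, map_add, 𝓔.projF_of_mem_F hf, projF_phi, 𝓔.eps_of_mem_F hf, eps_phi,
    𝓔.projF_of_mem_F hg, add_zero, zero_add]

end retraction

section norm

variable {K}

lemma mapTail_tprod_eq_zero {y : Fin (n + 1) → E} {j : Fin (n + 1)} (hj : y j ∈ 𝓔.M) {r : ℕ}
    (hr : r ≤ j) : 𝓔.mapTail n r (PiTensorProduct.tprod k y) = 0 := by
  rw [mapTail_tprod, (PiTensorProduct.tprod k).map_coord_zero j]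
  rw [tailProj_of_le _ hr, 𝓔.piA_of_mem_M hj]

lemma t_mkQ_of_last_mem_M {y : Fin (n + 1) → E} (hy : y (Fin.last n) ∈ 𝓔.M) :
    𝓔.t K n ((tensorRel (𝓔.base K) n).mkQ (PiTensorProduct.tprod k y)) =
      (tensorRel (𝓔.base K) n).mkQ ((rotate k E n ^ n) (PiTensorProduct.tprod k y)) := by
  rw [t_mkQ, Finset.sum_range_succ, Finset.sum_eq_zero, zero_add, 𝓔.mapTail_of_lt n.lt_succ_self,
    𝓔.mapTail_tprod_eq_zero (r := n) hy le_rfl, sub_zero]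
  intro i hi
  have hi : i < n := Finset.mem_range.1 hi
  rw [𝓔.mapTail_tprod_eq_zero hy hi.le, 𝓔.mapTail_tprod_eq_zero hy (Nat.succ_le_of_lt hi),
    sub_zero, map_zero]

lemma phi_mkQ_of_last_mem_M {y : Fin (n + 1) → E} (hy : y (Fin.last n) ∈ 𝓔.M) :
    𝓔.phi K n ((tensorRel (𝓔.base K) n).mkQ (PiTensorProduct.tprod k y)) =
      (tensorRel (𝓔.base K) (n + 1)).mkQ (unitCons k E n (PiTensorProduct.tprod k y)) := by
  rw [phi_mkQ, Finset.sum_range_succ, Finset.sum_eq_zero, zero_add, rotate_pow_eq_one,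
    𝓔.mapTail_of_lt n.lt_succ_self, Module.End.one_apply]
  intro i hi
  rw [𝓔.mapTail_tprod_eq_zero hy (Nat.succ_le_of_lt (Finset.mem_range.1 hi)), map_zero]

lemma mapTail_one_tprod {y : Fin (n + 1) → E} (hy : y 0 ∈ 𝓔.copyA) :
    𝓔.mapTail n 1 (PiTensorProduct.tprod k y) = 𝓔.mapTail n 0 (PiTensorProduct.tprod k y) := by
  rw [mapTail_tprod, mapTail_tprod]
  congr 1
  funext l
  have h0 := 𝓔.piA_of_mem_copyA hy
  obtain rfl | hl := eq_or_ne l 0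
  · rw [Fin.val_zero, 𝓔.tailProj_of_lt one_pos, 𝓔.tailProj_of_le le_rfl, h0, LinearMap.id_apply]
  · rw [𝓔.tailProj_of_le (Nat.one_le_iff_ne_zero.2 (Fin.val_ne_zero_iff.2 hl)),
      𝓔.tailProj_of_le (Nat.zero_le _)]

lemma mapTail_rotate {y : Fin (n + 1) → E} (hy : y 0 ∈ 𝓔.copyA) (r : ℕ) :
    𝓔.mapTail n r (rotate k E n (PiTensorProduct.tprod k y)) =
      rotate k E n (𝓔.mapTail n (r + 1) (PiTensorProduct.tprod k y)) := by
  have h0 := 𝓔.piA_of_mem_copyA hy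
  rw [rotate_tprod, map_smul, mapTail_tprod, mapTail_tprod, rotate_tprod]
  obtain ⟨y, rfl⟩ := exists_nat_ext y
  congr 2
  funext l
  simp only [Fin.val_zero] at h0
  simp only [rot, tailProj, val_add_one']
  grind [LinearMap.id_apply]

lemma t_mkQ_rotate {y : Fin (n + 1) → E} (h0 : y 0 ∈ 𝓔.copyA) :
    𝓔.t K n ((tensorRel (𝓔.base K) n).mkQ (rotate k E n (PiTensorProduct.tprod k y))) =
      𝓔.t K n ((tensorRel (𝓔.base K) n).mkQ (PiTensorProduct.tprod k y)) := by
  set u := PiTensorProduct.tprod k y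
  set f : ℕ → ⨂[k]^(n + 1) E := fun i =>
    (rotate k E n ^ i) (𝓔.mapTail n (i + 1) u - 𝓔.mapTail n i u) with hf
  have hzero : f 0 = 0 := by
    simp only [hf, u, pow_zero, Module.End.one_apply, zero_add, 𝓔.mapTail_one_tprod h0, sub_self]
  have hlast : f (n + 1) = 0 := by
    simp only [hf, 𝓔.mapTail_of_lt n.lt_succ_self, 𝓔.mapTail_of_lt (n.lt_succ_self.trans
      (n + 1).lt_succ_self), sub_self, map_zero]
  have hstep (i : ℕ) : (rotate k E n ^ i) (𝓔.mapTail n (i + 1) (rotate k E n u) -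
      𝓔.mapTail n i (rotate k E n u)) = f (i + 1) := by
    rw [hf, 𝓔.mapTail_rotate h0, 𝓔.mapTail_rotate h0, ← map_sub, ← Module.End.mul_apply, ← pow_succ]
  have hshift := (Finset.sum_range_succ f (n + 1)).symm.trans (Finset.sum_range_succ' f (n + 1))
  rw [hzero, hlast, add_zero, add_zero] at hshift
  rw [t_mkQ, t_mkQ, hshift, Finset.sum_congr rfl fun i _ => hstep i]

lemma phi_mkQ_rotate {y : Fin (n + 1) → E} (h0 : y 0 ∈ 𝓔.copyA) {j : Fin (n + 1)}
    (hj : y j ∈ 𝓔.M) :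
    𝓔.phi K n ((tensorRel (𝓔.base K) n).mkQ (rotate k E n (PiTensorProduct.tprod k y))) =
      𝓔.phi K n ((tensorRel (𝓔.base K) n).mkQ (PiTensorProduct.tprod k y)) +
        (tensorRel (𝓔.base K) (n + 1)).mkQ
          (unitCons k E n (rotate k E n (PiTensorProduct.tprod k y))) := by
  set u := PiTensorProduct.tprod k y
  set f : ℕ → ⨂[k]^(n + 1) E := fun i => (rotate k E n ^ i) (𝓔.mapTail n i u) with hf
  have hone : f 1 = 0 := by
    simp only [hf, u, 𝓔.mapTail_one_tprod h0, 𝓔.mapTail_tprod_eq_zero hj (Nat.zero_le _), map_zero]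
  have hlast : f (n + 2) = rotate k E n u := by
    simp only [hf, 𝓔.mapTail_of_lt (n.lt_succ_self.trans (n + 1).lt_succ_self)]
    rw [pow_succ, rotate_pow_eq_one, one_mul]
  have hstep (i : ℕ) : (rotate k E n ^ (i + 1)) (𝓔.mapTail n (i + 1) (rotate k E n u)) =
      f (i + 2) := by
    rw [hf, 𝓔.mapTail_rotate h0, ← Module.End.mul_apply, ← pow_succ]
  have hshift := (Finset.sum_range_succ (fun i => f (i + 1)) (n + 1)).symm.trans
    (Finset.sum_range_succ' (fun i => f (i + 1)) (n + 1))
  rw [hone, hlast, add_zero] at hshift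
  rw [phi_mkQ, phi_mkQ, ← map_add, ← map_add, Finset.sum_congr rfl fun i _ => hstep i]
  exact congrArg _ (congrArg _ hshift.symm)

lemma t_mkQ_rotate_pow_of_mem_M {x : Fin (n + 1) → E} {r : ℕ}
    (hx : x (Fin.ofNat (n + 1) r) ∈ 𝓔.M) :
    𝓔.t K n ((tensorRel (𝓔.base K) n).mkQ
        ((rotate k E n ^ (r + 1)) (PiTensorProduct.tprod k x))) =
      (tensorRel (𝓔.base K) n).mkQ ((rotate k E n ^ r) (PiTensorProduct.tprod k x)) := by
  have h : (rotate k E n ^ n) ((rotate k E n ^ (r + 1)) (PiTensorProduct.tprod k x)) =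
      (rotate k E n ^ r) (PiTensorProduct.tprod k x) := by
    rw [← Module.End.mul_apply, ← pow_add, show n + (r + 1) = n + 1 + r by omega, pow_add,
      rotate_pow_eq_one, one_mul]
  rw [← h, rotate_pow_tprod, map_smul, map_smul, map_smul, map_smul,
    𝓔.t_mkQ_of_last_mem_M (by rwa [rot_ofNat_succ_last])]

lemma phi_mkQ_rotate_pow_of_mem_M {x : Fin (n + 1) → E} {r : ℕ}
    (hx : x (Fin.ofNat (n + 1) r) ∈ 𝓔.M) :
    𝓔.phi K n ((tensorRel (𝓔.base K) n).mkQ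
        ((rotate k E n ^ (r + 1)) (PiTensorProduct.tprod k x))) =
      (tensorRel (𝓔.base K) (n + 1)).mkQ
        (unitCons k E n ((rotate k E n ^ (r + 1)) (PiTensorProduct.tprod k x))) := by
  rw [rotate_pow_tprod, map_smul, map_smul, map_smul, map_smul,
    𝓔.phi_mkQ_of_last_mem_M (by rwa [rot_ofNat_succ_last])]

lemma t_mkQ_rotate_pow_of_mem_copyA {x : Fin (n + 1) → E} {r : ℕ}
    (hx : x (Fin.ofNat (n + 1) r) ∈ 𝓔.copyA) :
    𝓔.t K n ((tensorRel (𝓔.base K) n).mkQ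
        ((rotate k E n ^ (r + 1)) (PiTensorProduct.tprod k x))) =
      𝓔.t K n ((tensorRel (𝓔.base K) n).mkQ
        ((rotate k E n ^ r) (PiTensorProduct.tprod k x))) := by
  rw [pow_succ', Module.End.mul_apply, rotate_pow_tprod]
  simp only [map_smul]
  rw [𝓔.t_mkQ_rotate]
  rwa [rot, zero_add]

lemma phi_mkQ_rotate_pow_of_mem_copyA {x : Fin (n + 1) → E} {r : ℕ}
    (hx : x (Fin.ofNat (n + 1) r) ∈ 𝓔.copyA) {j : Fin (n + 1)} (hj : x j ∈ 𝓔.M) :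
    𝓔.phi K n ((tensorRel (𝓔.base K) n).mkQ
        ((rotate k E n ^ (r + 1)) (PiTensorProduct.tprod k x))) =
      𝓔.phi K n ((tensorRel (𝓔.base K) n).mkQ
          ((rotate k E n ^ r) (PiTensorProduct.tprod k x))) +
        (tensorRel (𝓔.base K) (n + 1)).mkQ
          (unitCons k E n ((rotate k E n ^ (r + 1)) (PiTensorProduct.tprod k x))) := by
  rw [pow_succ', Module.End.mul_apply, rotate_pow_tprod]
  simp only [map_smul]
  rw [𝓔.phi_mkQ_rotate (j := j - Fin.ofNat (n + 1) r), smul_add]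
  · rwa [rot, zero_add]
  · rwa [rot, sub_add_cancel]

/-- Rotating past an entry of `A` does not change the value of `t` and adds one insertion of `1`
to that of `phi`; rotating past an entry of `M` is inverse to `t`. -/
lemma phi_sum_t_pow_rotate_pow {x : Fin (n + 1) → E} {S : Finset (Fin (n + 1))} (h0 : 0 ∈ S)
    (hM : ∀ l ∈ S, x l ∈ 𝓔.M) (hA : ∀ l ∉ S, x l ∈ 𝓔.copyA) (r : ℕ) :
    𝓔.phi K n (∑ l ∈ Finset.range (Nat.count (fun i => Fin.ofNat (n + 1) i ∈ S) r),
        (𝓔.t K n ^ l) ((tensorRel (𝓔.base K) n).mkQ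
          ((rotate k E n ^ r) (PiTensorProduct.tprod k x)))) =
      (tensorRel (𝓔.base K) (n + 1)).mkQ (unitCons k E n
        (∑ i ∈ Finset.range r, (rotate k E n ^ (i + 1)) (PiTensorProduct.tprod k x))) := by
  induction r with
  | zero => simp
  | succ r ih =>
    rw [Finset.sum_range_succ _ r, map_add, map_add, ← ih, Nat.count_succ]
    by_cases hr : Fin.ofNat (n + 1) r ∈ S
    · rw [if_pos hr, Finset.sum_range_succ', map_add, pow_zero, Module.End.one_apply,
        𝓔.phi_mkQ_rotate_pow_of_mem_M (hM _ hr)]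
      simp only [pow_succ (𝓔.t K n), Module.End.mul_apply, 𝓔.t_mkQ_rotate_pow_of_mem_M (hM _ hr)]
    · have hpos : 0 < r := Nat.pos_of_ne_zero fun h => hr (by rwa [h])
      obtain ⟨c, hc⟩ := Nat.exists_eq_add_of_lt
        (Nat.count_strict_mono (p := fun i => Fin.ofNat (n + 1) i ∈ S) h0 hpos)
      rw [if_neg hr, hc, add_zero, Finset.sum_range_succ', Finset.sum_range_succ', map_add, map_add,
        pow_zero, Module.End.one_apply, Module.End.one_apply,
        𝓔.phi_mkQ_rotate_pow_of_mem_copyA (hA _ hr) (hM 0 h0), ← add_assoc]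
      simp only [pow_succ (𝓔.t K n), Module.End.mul_apply,
        𝓔.t_mkQ_rotate_pow_of_mem_copyA (hA _ hr)]

theorem connes_eq_phi_Nw {z : CycTensor (𝓔.base K) n} (hz : z ∈ 𝓔.X K n w) :
    connes (𝓔.base K) n z = 𝓔.phi K n (𝓔.Nw K n w z) := by
  suffices h : 𝓔.X K n w ≤ LinearMap.eqLocus (connes (𝓔.base K) n) (𝓔.phi K n ∘ₗ 𝓔.Nw K n w) from
    h hz
  refine 𝓔.X_le_of_finset K fun x S h0 hS hM hA => ?_
  have h := 𝓔.phi_sum_t_pow_rotate_pow (K := K) h0 hM hA (n + 1)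
  rw [count_ofNat_mem, hS, rotate_pow_eq_one, ← connes_mkQ] at h
  rw [LinearMap.mem_eqLocus, LinearMap.comp_apply, Nw, LinearMap.sum_apply]
  exact h.symm

end norm

/-! ### The relations of the triple complex -/

section relations

variable {K}

lemma gradeProj_self {z : CycTensor (𝓔.base K) n} (hz : z ∈ 𝓔.X K n w) :
    𝓔.gradeProj K n (w + 1) z = z :=
  (𝓔.gradeProj_of_mem_X _ hz).trans (if_pos rfl)

lemma gradeProj_of_ne {z : CycTensor (𝓔.base K) n} (hz : z ∈ 𝓔.X K n w) {w' : ℕ}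
    (h : w' ≠ w + 1) : 𝓔.gradeProj K n w' z = 0 :=
  (𝓔.gradeProj_of_mem_X _ hz).trans (if_neg h)

lemma b_b {z : CycTensor (𝓔.base K) (n + 2)} (hz : z ∈ 𝓔.X K (n + 2) w) :
    𝓔.b K n (𝓔.b K (n + 1) z) = 0 := by
  have hF := 𝓔.X_le_F K _ _ hz
  have hb := 𝓔.b_mem_F hF
  have hd := 𝓔.d_mem_F hF
  have h := congrArg (𝓔.gradeProj K n (w + 1)) (hochschild_hochschild z)
  simpa only [hochschild_apply, map_add, 𝓔.gradeProj_b _ hF, 𝓔.gradeProj_b _ hb,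
    𝓔.gradeProj_b _ hd, 𝓔.gradeProj_d _ hF, 𝓔.gradeProj_d _ hb, 𝓔.gradeProj_d _ hd,
    𝓔.gradeProj_self hz, 𝓔.gradeProj_of_ne hz (show w + 1 + 1 ≠ w + 1 by omega),
    𝓔.gradeProj_of_ne hz (show w + 1 + 1 + 1 ≠ w + 1 by omega), map_zero, add_zero] using h

lemma b_d_add_d_b {z : CycTensor (𝓔.base K) (n + 2)} (hz : z ∈ 𝓔.X K (n + 2) w) :
    𝓔.b K n (𝓔.d K (n + 1) z) + 𝓔.d K n (𝓔.b K (n + 1) z) = 0 := by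
  have hF := 𝓔.X_le_F K _ _ hz
  have hb := 𝓔.b_mem_F hF
  have hd := 𝓔.d_mem_F hF
  have h := congrArg (𝓔.gradeProj K n w) (hochschild_hochschild z)
  rw [add_comm]
  simpa only [hochschild_apply, map_add, 𝓔.gradeProj_b _ hF, 𝓔.gradeProj_b _ hb,
    𝓔.gradeProj_b _ hd, 𝓔.gradeProj_d _ hF, 𝓔.gradeProj_d _ hb, 𝓔.gradeProj_d _ hd,
    𝓔.gradeProj_self hz, 𝓔.gradeProj_of_ne hz (show w ≠ w + 1 by omega),
    𝓔.gradeProj_of_ne hz (show w + 1 + 1 ≠ w + 1 by omega), map_zero, add_zero, zero_add] using h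

lemma d_d {z : CycTensor (𝓔.base K) (n + 2)} (hz : z ∈ 𝓔.X K (n + 2) w) :
    𝓔.d K n (𝓔.d K (n + 1) z) = 0 := by
  have h := hochschild_hochschild z
  simp only [hochschild_apply, map_add, 𝓔.b_b hz, zero_add] at h
  rwa [← add_assoc, add_comm (𝓔.d K n _), 𝓔.b_d_add_d_b hz, zero_add] at h

lemma b_add_d'_mem_F {z : CycTensor (𝓔.base K) (n + 1)} (hz : z ∈ 𝓔.F K (n + 1)) :
    𝓔.b K n z + 𝓔.d' K n z ∈ 𝓔.F K n :=
  add_mem (𝓔.b_mem_F hz) (𝓔.d'_mem_F hz)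

lemma hochschild_mem_F {z : CycTensor (𝓔.base K) (n + 1)} (hz : z ∈ 𝓔.F K (n + 1)) :
    hochschild (𝓔.base K) n z ∈ 𝓔.F K n := by
  rw [hochschild_apply]
  exact add_mem (𝓔.b_mem_F hz) (𝓔.d_mem_F hz)

lemma hochschild_sub_t_eq_hochschild_phi {z : CycTensor (𝓔.base K) (n + 1)}
    (hz : z ∈ 𝓔.F K (n + 1)) :
    hochschild (𝓔.base K) n (z - 𝓔.t K (n + 1) z) =
      hochschild (𝓔.base K) n (𝓔.phi K n (𝓔.b K n z + 𝓔.d' K n z)) := by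
  have h := hochschild_hochschild (𝓔.phi K (n + 1) z)
  rwa [𝓔.hochschild_phi_of_mem_F hz, map_sub, sub_eq_zero] at h

lemma hochschild_sub_t_succ {z : CycTensor (𝓔.base K) (n + 2)} (hz : z ∈ 𝓔.F K (n + 2)) :
    hochschild (𝓔.base K) (n + 1) (z - 𝓔.t K (n + 2) z) =
        (𝓔.b K (n + 1) z + 𝓔.d' K (n + 1) z) -
          𝓔.t K (n + 1) (𝓔.b K (n + 1) z + 𝓔.d' K (n + 1) z) ∧
      𝓔.b K n (𝓔.b K (n + 1) z + 𝓔.d' K (n + 1) z) +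
        𝓔.d' K n (𝓔.b K (n + 1) z + 𝓔.d' K (n + 1) z) = 0 := by
  have hy := 𝓔.b_add_d'_mem_F hz
  have h := 𝓔.hochschild_sub_t_eq_hochschild_phi hz
  rw [𝓔.hochschild_phi_of_mem_F hy, ← sub_eq_zero, ← sub_add] at h
  obtain ⟨h1, h2⟩ := 𝓔.eq_zero_of_add_phi_eq_zero
    (sub_mem (𝓔.hochschild_mem_F (sub_mem hz (𝓔.t_mem_F z))) (sub_mem hy (𝓔.t_mem_F _)))
    (𝓔.b_add_d'_mem_F hy) h
  exact ⟨sub_eq_zero.1 h1, h2⟩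

lemma hochschild_sub_t {z : CycTensor (𝓔.base K) (n + 1)} (hz : z ∈ 𝓔.F K (n + 1)) :
    hochschild (𝓔.base K) n (z - 𝓔.t K (n + 1) z) =
      (𝓔.b K n z + 𝓔.d' K n z) - 𝓔.t K n (𝓔.b K n z + 𝓔.d' K n z) := by
  cases n with
  | zero =>
    rw [𝓔.hochschild_sub_t_eq_hochschild_phi hz, hochschild_zero_phi_zero,
      𝓔.t_zero (𝓔.mapCyc_p_of_mem_F (𝓔.b_add_d'_mem_F hz)), sub_self]
  | succ n => exact (𝓔.hochschild_sub_t_succ hz).1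

lemma b_d'_add_d'_b {z : CycTensor (𝓔.base K) (n + 2)} (hz : z ∈ 𝓔.X K (n + 2) w) :
    𝓔.b K n (𝓔.d' K (n + 1) z) + 𝓔.d' K n (𝓔.b K (n + 1) z) = 0 := by
  have hF := 𝓔.X_le_F K _ _ hz
  have hb := 𝓔.b_mem_F hF
  have hd := 𝓔.d'_mem_F hF
  have h := congrArg (𝓔.gradeProj K n w) (𝓔.hochschild_sub_t_succ hF).2
  simpa only [map_add, 𝓔.gradeProj_b _ hF, 𝓔.gradeProj_b _ hb,
    𝓔.gradeProj_b _ hd, 𝓔.gradeProj_d' _ hF, 𝓔.gradeProj_d' _ hb, 𝓔.gradeProj_d' _ hd,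
    𝓔.gradeProj_self hz, 𝓔.gradeProj_of_ne hz (show w ≠ w + 1 by omega),
    𝓔.gradeProj_of_ne hz (show w + 1 + 1 ≠ w + 1 by omega), map_zero, add_zero, zero_add] using h

lemma d'_d' {z : CycTensor (𝓔.base K) (n + 2)} (hz : z ∈ 𝓔.X K (n + 2) w) :
    𝓔.d' K n (𝓔.d' K (n + 1) z) = 0 := by
  have h := (𝓔.hochschild_sub_t_succ (𝓔.X_le_F K _ _ hz)).2
  simp only [map_add, 𝓔.b_b hz, zero_add] at h
  rwa [← add_assoc, 𝓔.b_d'_add_d'_b hz, zero_add] at h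

lemma b_sub_t {z : CycTensor (𝓔.base K) (n + 1)} (hz : z ∈ 𝓔.X K (n + 1) w) :
    𝓔.b K n (z - 𝓔.t K (n + 1) z) = 𝓔.b K n z - 𝓔.t K n (𝓔.b K n z) := by
  have hF := 𝓔.X_le_F K _ _ hz
  have hb := 𝓔.b_mem_F hF
  have hd := 𝓔.d'_mem_F hF
  have hs : z - 𝓔.t K (n + 1) z ∈ 𝓔.F K (n + 1) := sub_mem hF (𝓔.t_mem_F z)
  have h := congrArg (𝓔.gradeProj K n (w + 1)) (𝓔.hochschild_sub_t hF)
  rw [hochschild_apply, map_add, 𝓔.gradeProj_b _ hs, 𝓔.gradeProj_d _ hs] at h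
  simpa only [map_add, map_sub, map_zero, 𝓔.gradeProj_b _ hF, 𝓔.gradeProj_d' _ hF,
    𝓔.gradeProj_t _ hF, 𝓔.gradeProj_t _ hb, 𝓔.gradeProj_t _ hd, 𝓔.gradeProj_self hz,
    𝓔.gradeProj_of_ne hz (show w + 1 + 1 ≠ w + 1 by omega), sub_zero, add_zero] using h

lemma d_sub_t {z : CycTensor (𝓔.base K) (n + 1)} (hz : z ∈ 𝓔.X K (n + 1) w) :
    𝓔.d K n (z - 𝓔.t K (n + 1) z) = 𝓔.d' K n z - 𝓔.t K n (𝓔.d' K n z) := by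
  have h := 𝓔.hochschild_sub_t (𝓔.X_le_F K _ _ hz)
  rw [hochschild_apply, 𝓔.b_sub_t hz, map_add (𝓔.t K n), add_sub_add_comm] at h
  exact add_left_cancel h

lemma connes_d {z : CycTensor (𝓔.base K) (n + 1)} (hz : z ∈ 𝓔.X K (n + 1) w) :
    connes (𝓔.base K) n (𝓔.d K n z) = 𝓔.phi K n (𝓔.Nw K n (w - 1) (𝓔.d K n z)) := by
  cases w with
  | zero => rw [𝓔.d_of_mem_X_zero hz, map_zero, map_zero, map_zero]
  | succ w => exact 𝓔.connes_eq_phi_Nw (𝓔.d_mem K n w z hz)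

lemma Nw_d_mem_F {z : CycTensor (𝓔.base K) (n + 1)} (hz : z ∈ 𝓔.X K (n + 1) w) (w' : ℕ) :
    𝓔.Nw K n w' (𝓔.d K n z) ∈ 𝓔.F K n := by
  cases w with
  | zero =>
    rw [𝓔.d_of_mem_X_zero hz, map_zero]
    exact zero_mem _
  | succ w => exact 𝓔.X_le_F K _ _ (𝓔.Nw_mem _ (𝓔.d_mem K n w z hz))

lemma sub_t_Nw_succ {z : CycTensor (𝓔.base K) (n + 1)} (hz : z ∈ 𝓔.X K (n + 1) w) :
    𝓔.Nw K (n + 1) w z - 𝓔.t K (n + 1) (𝓔.Nw K (n + 1) w z) = 0 ∧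
      𝓔.b K n (𝓔.Nw K (n + 1) w z) + 𝓔.d' K n (𝓔.Nw K (n + 1) w z) =
        𝓔.Nw K n w (𝓔.b K n z) + 𝓔.Nw K n (w - 1) (𝓔.d K n z) := by
  have hNF := 𝓔.X_le_F K _ _ (𝓔.Nw_mem w hz)
  have hb := 𝓔.b_mem K n w z hz
  have h := hochschild_connes z
  rw [𝓔.connes_eq_phi_Nw hz, 𝓔.hochschild_phi_of_mem_F hNF, hochschild_apply,
    map_add (connes (𝓔.base K) n), 𝓔.connes_d hz, 𝓔.connes_eq_phi_Nw hb, ← map_add,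
    eq_neg_iff_add_eq_zero, sub_add, ← map_sub, sub_eq_add_neg, ← map_neg] at h
  obtain ⟨h1, h2⟩ := 𝓔.eq_zero_of_add_phi_eq_zero (sub_mem hNF (𝓔.t_mem_F _))
    (neg_mem (sub_mem (𝓔.b_add_d'_mem_F hNF)
      (add_mem (𝓔.X_le_F K _ _ (𝓔.Nw_mem w hb)) (𝓔.Nw_d_mem_F hz _)))) h
  exact ⟨h1, sub_eq_zero.1 (neg_eq_zero.1 h2)⟩

lemma sub_t_Nw {z : CycTensor (𝓔.base K) n} (hz : z ∈ 𝓔.X K n w) :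
    𝓔.Nw K n w z - 𝓔.t K n (𝓔.Nw K n w z) = 0 := by
  cases n with
  | zero =>
    rw [𝓔.t_zero (𝓔.mapCyc_p_of_mem_F (𝓔.X_le_F K _ _ (𝓔.Nw_mem w hz))), sub_self]
  | succ n => exact (𝓔.sub_t_Nw_succ hz).1

lemma b_Nw {z : CycTensor (𝓔.base K) (n + 1)} (hz : z ∈ 𝓔.X K (n + 1) w) :
    𝓔.b K n (𝓔.Nw K (n + 1) w z) = 𝓔.Nw K n w (𝓔.b K n z) := by
  have hN := 𝓔.Nw_mem w hz
  have h := congrArg (𝓔.gradeProj K n (w + 1)) (𝓔.sub_t_Nw_succ hz).2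
  rw [map_add, map_add, 𝓔.gradeProj_self (𝓔.b_mem K n w _ hN),
    𝓔.gradeProj_self (𝓔.Nw_mem w (𝓔.b_mem K n w z hz)), 𝓔.gradeProj_d' _ (𝓔.X_le_F K _ _ hN),
    𝓔.gradeProj_of_ne hN (show w + 1 + 1 ≠ w + 1 by omega), map_zero, add_zero] at h
  rw [h]
  cases w with
  | zero => rw [𝓔.d_of_mem_X_zero hz, map_zero, map_zero, add_zero]
  | succ w =>
    rw [𝓔.gradeProj_of_ne (𝓔.Nw_mem _ (𝓔.d_mem K n w z hz)) (show w + 1 + 1 ≠ w + 1 by omega),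
      add_zero]

lemma d'_Nw {z : CycTensor (𝓔.base K) (n + 1)} (hz : z ∈ 𝓔.X K (n + 1) (w + 1)) :
    𝓔.d' K n (𝓔.Nw K (n + 1) (w + 1) z) = 𝓔.Nw K n w (𝓔.d K n z) := by
  have h := (𝓔.sub_t_Nw_succ hz).2
  rw [𝓔.b_Nw hz] at h
  exact add_left_cancel h

lemma Nw_sub_t {z : CycTensor (𝓔.base K) n} (hz : z ∈ 𝓔.X K n w) :
    𝓔.Nw K n w (z - 𝓔.t K n z) = 0 := by
  have hcomm : Commute (𝓔.Nw K n w) (𝓔.t K n) :=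
    Commute.sum_left _ _ _ fun l _ => Commute.pow_left (Commute.refl _) l
  rw [map_sub, ← Module.End.mul_apply, hcomm.eq, Module.End.mul_apply, 𝓔.sub_t_Nw hz]

end relations

section tripleComplex

lemma coe_tX (z : 𝓔.X K n w) : (𝓔.tX K n w z : CycTensor (𝓔.base K) n) = 𝓔.t K n z := rfl

lemma coe_bX (z : 𝓔.X K (n + 1) w) :
    (𝓔.bX K n w z : CycTensor (𝓔.base K) n) = 𝓔.b K n z := rfl

lemma coe_dX (z : 𝓔.X K (n + 1) (w + 1)) :
    (𝓔.dX K n w z : CycTensor (𝓔.base K) n) = 𝓔.d K n z := rfl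

lemma coe_dX' (z : 𝓔.X K (n + 1) (w + 1)) :
    (𝓔.dX' K n w z : CycTensor (𝓔.base K) n) = 𝓔.d' K n z := rfl

lemma coe_NX (z : 𝓔.X K n w) :
    (𝓔.NX K n w z : CycTensor (𝓔.base K) n) = 𝓔.Nw K n w z := by
  have coe_tX_pow (l : ℕ) :
      ((𝓔.tX K n w ^ l) z : CycTensor (𝓔.base K) n) = (𝓔.t K n ^ l) z := by
    induction l with
    | zero => simp
    | succ l ih => rw [pow_succ', pow_succ', Module.End.mul_apply, Module.End.mul_apply, coe_tX, ih]
  rw [NX, Nw, LinearMap.sum_apply, LinearMap.sum_apply, Submodule.coe_sum]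
  exact Finset.sum_congr rfl fun l _ => coe_tX_pow l

/-- The horizontal differential `X u v w → X (u - 1) v w` of the diagram, in terms of
`n = v + w` alone. -/
def hMap (u : ℤ) (n w : ℕ) : 𝓔.X K n w →ₗ[k] 𝓔.X K n w :=
  if Even u then LinearMap.id - 𝓔.tX K n w else 𝓔.NX K n w

/-- The differential of the diagram lowering `v`, in terms of `n = v + w` alone: this avoids
identifying `v + 1 + w` with `v + w + 1`. -/
def vMap (u : ℤ) (n w : ℕ) : 𝓔.X K (n + 1) w →ₗ[k] 𝓔.X K n w :=
  if Even u then 𝓔.bX K n w else -𝓔.bX K n w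

/-- The differential of the diagram lowering `w`, in terms of `n = v + w` alone. -/
def dMap (u : ℤ) (n w : ℕ) : 𝓔.X K (n + 1) (w + 1) →ₗ[k] 𝓔.X K n w :=
  if Even u then 𝓔.dX K n w else -𝓔.dX' K n w

lemma castX_hMap {m : ℕ} (u : ℤ) (h : m = n) (z : 𝓔.X K m w) :
    𝓔.castX K h w (𝓔.hMap K u m w z) = 𝓔.hMap K u n w (𝓔.castX K h w z) := by
  subst h; rfl

lemma castX_vMap {m : ℕ} (u : ℤ) (h : m = n) (z : 𝓔.X K (m + 1) w) :
    𝓔.castX K h w (𝓔.vMap K u m w z) = 𝓔.vMap K u n w (𝓔.castX K (congrArg Nat.succ h) w z) := by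
  subst h; rfl

lemma castX_dMap {m : ℕ} (u : ℤ) (h : m = n) (z : 𝓔.X K (m + 1) (w + 1)) :
    𝓔.castX K h w (𝓔.dMap K u m w z) =
      𝓔.dMap K u n w (𝓔.castX K (congrArg Nat.succ h) (w + 1) z) := by
  subst h; rfl

lemma bX_bX (z : 𝓔.X K (n + 2) w) : 𝓔.bX K n w (𝓔.bX K (n + 1) w z) = 0 :=
  Subtype.ext (𝓔.b_b z.2)

lemma dX_dX (z : 𝓔.X K (n + 2) (w + 2)) : 𝓔.dX K n w (𝓔.dX K (n + 1) (w + 1) z) = 0 :=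
  Subtype.ext (𝓔.d_d z.2)

lemma dX'_dX' (z : 𝓔.X K (n + 2) (w + 2)) :
    𝓔.dX' K n w (𝓔.dX' K (n + 1) (w + 1) z) = 0 :=
  Subtype.ext (𝓔.d'_d' z.2)

lemma bX_dX (z : 𝓔.X K (n + 2) (w + 1)) :
    𝓔.bX K n w (𝓔.dX K (n + 1) w z) + 𝓔.dX K n w (𝓔.bX K (n + 1) (w + 1) z) = 0 :=
  Subtype.ext (𝓔.b_d_add_d_b z.2)

lemma bX_dX' (z : 𝓔.X K (n + 2) (w + 1)) :
    𝓔.bX K n w (𝓔.dX' K (n + 1) w z) + 𝓔.dX' K n w (𝓔.bX K (n + 1) (w + 1) z) = 0 :=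
  Subtype.ext (𝓔.b_d'_add_d'_b z.2)

lemma bX_sub_tX (z : 𝓔.X K (n + 1) w) :
    𝓔.bX K n w (z - 𝓔.tX K (n + 1) w z) = 𝓔.bX K n w z - 𝓔.tX K n w (𝓔.bX K n w z) :=
  Subtype.ext (𝓔.b_sub_t z.2)

lemma dX_sub_tX (z : 𝓔.X K (n + 1) (w + 1)) :
    𝓔.dX K n w (z - 𝓔.tX K (n + 1) (w + 1) z) = 𝓔.dX' K n w z - 𝓔.tX K n w (𝓔.dX' K n w z) :=
  Subtype.ext (𝓔.d_sub_t z.2)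

lemma bX_NX (z : 𝓔.X K (n + 1) w) :
    𝓔.bX K n w (𝓔.NX K (n + 1) w z) = 𝓔.NX K n w (𝓔.bX K n w z) := by
  refine Subtype.ext ?_
  rw [coe_bX, coe_NX, coe_NX, coe_bX]
  exact 𝓔.b_Nw z.2

lemma dX'_NX (z : 𝓔.X K (n + 1) (w + 1)) :
    𝓔.dX' K n w (𝓔.NX K (n + 1) (w + 1) z) = 𝓔.NX K n w (𝓔.dX K n w z) := by
  refine Subtype.ext ?_
  rw [coe_dX', coe_NX, coe_NX, coe_dX]
  exact 𝓔.d'_Nw z.2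

lemma NX_sub_tX (z : 𝓔.X K n w) : 𝓔.NX K n w (z - 𝓔.tX K n w z) = 0 := by
  refine Subtype.ext ?_
  rw [coe_NX]
  exact 𝓔.Nw_sub_t z.2

lemma sub_tX_NX (z : 𝓔.X K n w) :
    𝓔.NX K n w z - 𝓔.tX K n w (𝓔.NX K n w z) = 0 := by
  refine Subtype.ext ?_
  rw [Submodule.coe_sub, coe_tX, coe_NX]
  exact 𝓔.sub_t_Nw z.2

lemma hMap_hMap (u : ℤ) (z : 𝓔.X K n w) :
    𝓔.hMap K u n w (𝓔.hMap K (u + 1) n w z) = 0 := by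
  by_cases hu : Even u
  · have hu' : ¬ Even (u + 1) := by simpa [Int.even_add_one] using hu
    rw [hMap, hMap, if_pos hu, if_neg hu']
    exact 𝓔.sub_tX_NX K z
  · have hu' : Even (u + 1) := by simpa [Int.even_add_one] using hu
    rw [hMap, hMap, if_neg hu, if_pos hu']
    exact 𝓔.NX_sub_tX K z

lemma vMap_vMap (u : ℤ) (z : 𝓔.X K (n + 2) w) :
    𝓔.vMap K u n w (𝓔.vMap K u (n + 1) w z) = 0 := by
  unfold vMap
  split_ifs <;> simp [𝓔.bX_bX K z]

lemma dMap_dMap (u : ℤ) (z : 𝓔.X K (n + 2) (w + 2)) :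
    𝓔.dMap K u n w (𝓔.dMap K u (n + 1) (w + 1) z) = 0 := by
  unfold dMap
  split_ifs <;> simp [𝓔.dX_dX K z, 𝓔.dX'_dX' K z]

lemma hMap_vMap (u : ℤ) (z : 𝓔.X K (n + 1) w) :
    𝓔.hMap K u n w (𝓔.vMap K (u + 1) n w z) + 𝓔.vMap K u n w (𝓔.hMap K u (n + 1) w z) = 0 := by
  by_cases hu : Even u
  · have hu' : ¬ Even (u + 1) := by simpa [Int.even_add_one] using hu
    simp only [hMap, vMap, if_pos hu, if_neg hu', LinearMap.neg_apply, map_neg,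
      LinearMap.sub_apply, LinearMap.id_apply, bX_sub_tX, neg_add_cancel]
  · have hu' : Even (u + 1) := by simpa [Int.even_add_one] using hu
    simp only [hMap, vMap, if_neg hu, if_pos hu', LinearMap.neg_apply, bX_NX, add_neg_cancel]

lemma hMap_dMap (u : ℤ) (z : 𝓔.X K (n + 1) (w + 1)) :
    𝓔.hMap K u n w (𝓔.dMap K (u + 1) n w z) +
      𝓔.dMap K u n w (𝓔.hMap K u (n + 1) (w + 1) z) = 0 := by
  by_cases hu : Even u
  · have hu' : ¬ Even (u + 1) := by simpa [Int.even_add_one] using hu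
    simp only [hMap, dMap, if_pos hu, if_neg hu', LinearMap.neg_apply, map_neg,
      LinearMap.sub_apply, LinearMap.id_apply, dX_sub_tX, neg_add_cancel]
  · have hu' : Even (u + 1) := by simpa [Int.even_add_one] using hu
    simp only [hMap, dMap, if_neg hu, if_pos hu', LinearMap.neg_apply, dX'_NX, add_neg_cancel]

lemma vMap_dMap (u : ℤ) (z : 𝓔.X K (n + 2) (w + 1)) :
    𝓔.vMap K u n w (𝓔.dMap K u (n + 1) w z) +
      𝓔.dMap K u n w (𝓔.vMap K u (n + 1) (w + 1) z) = 0 := by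
  unfold vMap dMap
  split_ifs
  · exact 𝓔.bX_dX K z
  · simp only [LinearMap.neg_apply, map_neg, neg_neg]
    exact 𝓔.bX_dX' K z

lemma isTripleComplex : (𝓔.diagram K).IsTripleComplex where
  dh_dh u v w := LinearMap.ext fun z => 𝓔.hMap_hMap K u z
  dv_dv u v w := LinearMap.ext fun (z : 𝓔.X K (v + 1 + 1 + w) w) => by
    change 𝓔.vMap K u (v + w) w (𝓔.castX K _ w (𝓔.vMap K u (v + 1 + w) w (𝓔.castX K _ w z))) =
      (0 : 𝓔.X K (v + w) w)
    rw [castX_vMap, vMap_vMap]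
  dd_dd u v w := LinearMap.ext fun z => 𝓔.dMap_dMap K u (n := v + w) z
  dh_dv u v w := LinearMap.ext fun (z : 𝓔.X K (v + 1 + w) w) => by
    change 𝓔.hMap K u (v + w) w (𝓔.vMap K (u + 1) (v + w) w (𝓔.castX K _ w z)) +
      𝓔.vMap K u (v + w) w (𝓔.castX K _ w (𝓔.hMap K u (v + 1 + w) w z)) = (0 : 𝓔.X K (v + w) w)
    rw [castX_hMap, hMap_vMap]
  dh_dd u v w := LinearMap.ext fun z => 𝓔.hMap_dMap K u (n := v + w) z
  dv_dd u v w := LinearMap.ext fun (z : 𝓔.X K (v + 1 + w + 1) (w + 1)) => by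
    change 𝓔.vMap K u (v + w) w (𝓔.castX K _ w (𝓔.dMap K u (v + 1 + w) w z)) +
      𝓔.dMap K u (v + w) w (𝓔.vMap K u (v + w + 1) (w + 1) (𝓔.castX K _ (w + 1) z)) =
        (0 : 𝓔.X K (v + w) w)
    rw [castX_dMap]
    exact 𝓔.vMap_dMap K u _

end tripleComplex

end CleftExtension

/-! ### Homology of total complexes -/

section homologyMap

variable {k U V W U' V' W' : Type*} [CommRing k]
  [AddCommGroup U] [AddCommGroup V] [AddCommGroup W]
  [AddCommGroup U'] [AddCommGroup V'] [AddCommGroup W']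
  [Module k U] [Module k V] [Module k W] [Module k U'] [Module k V'] [Module k W']
  {f : U →ₗ[k] V} {g : V →ₗ[k] W} {f' : U' →ₗ[k] V'} {g' : V' →ₗ[k] W'}
  {α : U →ₗ[k] U'} {β : V →ₗ[k] V'} {γ : W →ₗ[k] W'}
  (hf : ∀ x, β (f x) = f' (α x)) (hg : ∀ x, γ (g x) = g' (β x))

/-- The map induced in homology by a morphism `(α, β, γ)` from `U → V → W` to `U' → V' → W'`. -/
def homologyMap : Homology f g →ₗ[k] Homology f' g' :=
  Submodule.mapQ _ _
    (β.restrict (p := LinearMap.ker g) (q := LinearMap.ker g') fun x hx => by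
      rw [LinearMap.mem_ker] at hx ⊢
      rw [← hg, hx, map_zero])
    (by
      rintro ⟨_, _⟩ ⟨x, rfl⟩
      exact ⟨α x, (hf x).symm⟩)

lemma homologyMap_surjective (hγ : Function.Injective γ) (hfg' : ∀ x, g' (f' x) = 0)
    (hV : ∀ y, g' y ∈ LinearMap.range γ → ∃ x, y - f' x ∈ LinearMap.range β) :
    Function.Surjective (homologyMap hf hg) := by
  intro y
  obtain ⟨⟨y, hy⟩, rfl⟩ := Submodule.mkQ_surjective _ y
  rw [LinearMap.mem_ker] at hy
  obtain ⟨u, x, hx⟩ := hV y (hy ▸ zero_mem _)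
  have hgx : g x = 0 := hγ (by rw [hg, hx, map_sub, hy, hfg', sub_zero, map_zero])
  exact ⟨Submodule.mkQ _ ⟨x, hgx⟩, (Submodule.Quotient.eq _).2 ⟨-u, by simp [hx]⟩⟩

lemma homologyMap_injective {T' : Type*} [AddCommGroup T'] [Module k T'] {e' : T' →ₗ[k] U'}
    (hβ : Function.Injective β) (hef' : ∀ x, f' (e' x) = 0)
    (hU : ∀ y, f' y ∈ LinearMap.range β → ∃ x, y - e' x ∈ LinearMap.range α) :
    Function.Injective (homologyMap hf hg) := by
  rw [injective_iff_map_eq_zero]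
  intro x hx
  obtain ⟨⟨x, hgx⟩, rfl⟩ := Submodule.mkQ_surjective _ x
  obtain ⟨u, hu : f' u = β x⟩ := (Submodule.Quotient.mk_eq_zero _).1 hx
  obtain ⟨s, y, hy⟩ := hU u (hu ▸ ⟨x, rfl⟩)
  exact (Submodule.Quotient.mk_eq_zero _).2
    ⟨y, hβ (by rw [hf, hy, map_sub, hef', sub_zero, hu]; rfl)⟩

lemma nonempty_homology_equiv {T' : Type*} [AddCommGroup T'] [Module k T'] (e' : T' →ₗ[k] U')
    (hf : ∀ x, β (f x) = f' (α x)) (hg : ∀ x, γ (g x) = g' (β x))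
    (hef' : ∀ x, f' (e' x) = 0) (hfg' : ∀ x, g' (f' x) = 0)
    (hβ : Function.Injective β) (hγ : Function.Injective γ)
    (hU : ∀ y, f' y ∈ LinearMap.range β → ∃ x, y - e' x ∈ LinearMap.range α)
    (hV : ∀ y, g' y ∈ LinearMap.range γ → ∃ x, y - f' x ∈ LinearMap.range β) :
    Nonempty (Homology f g ≃ₗ[k] Homology f' g') :=
  ⟨.ofBijective (homologyMap hf hg) ⟨homologyMap_injective hf hg hβ hef' hU,
    homologyMap_surjective hf hg hγ hfg' hV⟩⟩

end homologyMap

namespace TripleDiagram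

variable {k : Type*} [CommRing k] {𝓧 : TripleDiagram k} {S : Set ℤ} {n m l : ℤ}

lemma IsTripleComplex.totD_totD (h𝓧 : 𝓧.IsTripleComplex) (h : m + 1 = n) (h' : n + 1 = l)
    (z : 𝓧.Tot l) : 𝓧.totD h (𝓧.totD h' z) = 0 := by
  funext ⟨(u, v, w), hi⟩
  simp only at hi
  have hh := LinearMap.congr_fun (h𝓧.dh_dh u v w) (z ⟨(u + 1 + 1, v, w), by simp only; omega⟩)
  have vv := LinearMap.congr_fun (h𝓧.dv_dv u v w)
    (z ⟨(u, v + 1 + 1, w), by simp only; push_cast; omega⟩)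
  have dd := LinearMap.congr_fun (h𝓧.dd_dd u v w)
    (z ⟨(u, v, w + 1 + 1), by simp only; push_cast; omega⟩)
  have hv := LinearMap.congr_fun (h𝓧.dh_dv u v w)
    (z ⟨(u + 1, v + 1, w), by simp only; push_cast; omega⟩)
  have hd := LinearMap.congr_fun (h𝓧.dh_dd u v w)
    (z ⟨(u + 1, v, w + 1), by simp only; push_cast; omega⟩)
  have vd := LinearMap.congr_fun (h𝓧.dv_dd u v w)
    (z ⟨(u, v + 1, w + 1), by simp only; push_cast; omega⟩)
  simp only [LinearMap.add_apply, LinearMap.comp_apply, LinearMap.zero_apply] at hh vv dd hv hd vd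
  simp only [totD, LinearMap.pi_apply, LinearMap.add_apply, LinearMap.comp_apply,
    LinearMap.proj_apply, map_add, hh, vv, dd, Pi.zero_apply, zero_add, add_zero]
  have hsum := congrArg₂ (· + ·) (congrArg₂ (· + ·) hv hd) vd
  simp only [add_zero] at hsum
  refine Eq.trans ?_ hsum
  abel

variable (𝓧 S) in
/-- The inclusion of the total complex of a truncation; it is a map of graded modules, but commutes
with the differential only in the columns that are kept. -/
def truncIncl (n : ℤ) : (𝓧.trunc S).Tot n →ₗ[k] 𝓧.Tot n :=
  LinearMap.pi fun i => (𝓧.truncMod S i.1.1 i.1.2.1 i.1.2.2).subtype ∘ₗ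
    (LinearMap.proj i : (𝓧.trunc S).Tot n →ₗ[k] (𝓧.trunc S).X i.1.1 i.1.2.1 i.1.2.2)

lemma truncIncl_injective : Function.Injective (𝓧.truncIncl S n) := fun _ _ h =>
  funext fun i => Subtype.ext (congrFun h i)

lemma truncIncl_of_notMem (z : (𝓧.trunc S).Tot n) {i : TotIdx n} (hi : i.1.1 ∉ S) :
    𝓧.truncIncl S n z i = 0 :=
  (z i).2 hi

lemma truncIncl_univ_surjective : Function.Surjective (𝓧.truncIncl Set.univ n) := fun z =>
  ⟨fun i => (⟨z i, fun hi => absurd (Set.mem_univ _) hi⟩ :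
    𝓧.truncMod Set.univ i.1.1 i.1.2.1 i.1.2.2), rfl⟩

open Classical in
lemma coe_truncMap {u u' : ℤ} {v v' w w' : ℕ} (f : 𝓧.X u v w →ₗ[k] 𝓧.X u' v' w') (hu : u' ∈ S)
    (x : 𝓧.truncMod S u v w) : (𝓧.truncMap S f x : 𝓧.X u' v' w') = f x :=
  LinearMap.congr_fun (if_pos hu : ite (u' ∈ S) (f ∘ₗ (𝓧.truncMod S u v w).subtype) 0 = _) x

lemma truncIncl_totD (h : m + 1 = n) (z : (𝓧.trunc S).Tot n) {u : ℤ} {v w : ℕ}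
    (hi : u + v + w = m) (hu : u ∈ S) :
    𝓧.truncIncl S m ((𝓧.trunc S).totD h z) ⟨(u, v, w), hi⟩ =
      𝓧.totD h (𝓧.truncIncl S n z) ⟨(u, v, w), hi⟩ := by
  have coe_add_truncMap (x₁ : 𝓧.truncMod S (u + 1) v w) (x₂ : 𝓧.truncMod S u (v + 1) w)
      (x₃ : 𝓧.truncMod S u v (w + 1)) :
      ((𝓧.truncMap S (𝓧.dh u v w) x₁ + 𝓧.truncMap S (𝓧.dv u v w) x₂ +
        𝓧.truncMap S (𝓧.dd u v w) x₃ : 𝓧.truncMod S u v w) : 𝓧.X u v w) =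
      𝓧.dh u v w x₁ + 𝓧.dv u v w x₂ + 𝓧.dd u v w x₃ := by
    rw [Submodule.coe_add, Submodule.coe_add, coe_truncMap _ hu, coe_truncMap _ hu,
      coe_truncMap _ hu]
  exact coe_add_truncMap _ _ _

lemma IsTripleComplex.nonempty_homology_trunc_univ_equiv (h𝓧 : 𝓧.IsTripleComplex) (n : ℤ) :
    Nonempty ((𝓧.trunc Set.univ).H n ≃ₗ[k] 𝓧.H n) := by
  have hcomm {m n : ℤ} (h : m + 1 = n) (z : (𝓧.trunc Set.univ).Tot n) :
      𝓧.truncIncl Set.univ m ((𝓧.trunc Set.univ).totD h z) =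
        𝓧.totD h (𝓧.truncIncl Set.univ n z) :=
    funext fun ⟨(u, _, _), hi⟩ => truncIncl_totD h z hi (Set.mem_univ u)
  exact nonempty_homology_equiv (𝓧.totD (n := n + 1 + 1) rfl) (hcomm _) (hcomm _)
    (h𝓧.totD_totD _ _) (h𝓧.totD_totD _ _) truncIncl_injective truncIncl_injective
    (fun _ _ => ⟨0, truncIncl_univ_surjective _⟩) (fun _ _ => ⟨0, truncIncl_univ_surjective _⟩)

end TripleDiagram

namespace MixedDiagram

variable {k : Type*} [CommRing k] (𝓜 : MixedDiagram k) {S : Set ℤ} {n m l : ℤ}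

/-- The conditions under which a mixed diagram is a mixed complex: `b` and `B` have square zero and
anticommute. -/
structure IsMixedComplex : Prop where
  b_b : ∀ q z, 𝓜.b q (𝓜.b (q + 1) z) = 0
  b_zero_B_zero : ∀ z, 𝓜.b 0 (𝓜.B 0 z) = 0
  b_B : ∀ q z, 𝓜.b (q + 1) (𝓜.B (q + 1) z) + 𝓜.B q (𝓜.b q z) = 0
  B_B : ∀ q z, 𝓜.B (q + 1) (𝓜.B q z) = 0

open Classical in
/-- The component in `X_q uⁱ` of a chain of total degree `n`; zero unless `i ∈ S` and
`2 * i + q = n`. -/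
def component (S : Set ℤ) (n i : ℤ) (q : ℕ) : 𝓜.Tot S n →ₗ[k] 𝓜.X q :=
  if h : i ∈ S ∧ 2 * i + q = n then
    LinearMap.proj (φ := fun i : TotIdx S n => 𝓜.X i.1.2) ⟨(i, q), h⟩
  else 0

variable {𝓜}

lemma component_apply (c : 𝓜.Tot S n) {i : ℤ} {q : ℕ} (h : i ∈ S ∧ 2 * i + q = n) :
    𝓜.component S n i q c = c ⟨(i, q), h⟩ := by
  rw [component, dif_pos h, LinearMap.proj_apply]

lemma component_of_notMem (c : 𝓜.Tot S n) {i : ℤ} (q : ℕ) (h : i ∉ S) :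
    𝓜.component S n i q c = 0 := by
  rw [component, dif_neg fun h' => h h'.1, LinearMap.zero_apply]

lemma ext_component {c c' : 𝓜.Tot S n} (h : ∀ i (q : ℕ), i ∈ S → 2 * i + q = n →
    𝓜.component S n i q c = 𝓜.component S n i q c') : c = c' := by
  funext ⟨(i, q), hi⟩
  rw [← component_apply c hi, ← component_apply c' hi, h i q hi.1 hi.2]

lemma component_totD_zero (h : m + 1 = n) (c : 𝓜.Tot S n) {i : ℤ} (hi : i ∈ S)
    (hm : 2 * i = m) :
    𝓜.component S m i 0 (𝓜.totD S h c) = 𝓜.b 0 (𝓜.component S n i 1 c) := by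
  rw [component_apply _ ⟨hi, by simpa using hm⟩, component_apply c ⟨hi, by push_cast; omega⟩]
  exact add_zero _

lemma component_totD_succ (h : m + 1 = n) (c : 𝓜.Tot S n) {i : ℤ} {q : ℕ} (hi : i ∈ S)
    (hm : 2 * i + (q + 1 : ℕ) = m) :
    𝓜.component S m i (q + 1) (𝓜.totD S h c) =
      𝓜.b (q + 1) (𝓜.component S n i (q + 2) c) + 𝓜.B q (𝓜.component S n (i + 1) q c) := by
  have totB_apply : 𝓜.totB S h ⟨(i, q + 1), hi, hm⟩ c = 𝓜.B q (𝓜.component S n (i + 1) q c) := by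
    by_cases hS : i + 1 ∈ S
    · rw [totB, dif_pos hS, component_apply c ⟨hS, by push_cast at hm; omega⟩]
      rfl
    · rw [totB, dif_neg hS, component_of_notMem c q hS, map_zero, LinearMap.zero_apply]
  rw [component_apply _ ⟨hi, hm⟩, ← totB_apply,
    component_apply (q := q + 2) c ⟨hi, by push_cast at hm ⊢; omega⟩]
  rfl

lemma IsMixedComplex.B_component_totD (h𝓜 : 𝓜.IsMixedComplex) (h : m + 1 = n) (c : 𝓜.Tot S n)
    {i : ℤ} {q : ℕ} (hm : 2 * i + q = m) :
    𝓜.B q (𝓜.component S m i q (𝓜.totD S h c)) =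
      𝓜.B q (𝓜.b q (𝓜.component S n i (q + 1) c)) := by
  by_cases hS : i ∈ S
  · cases q with
    | zero => rw [component_totD_zero h c hS (by simpa using hm)]
    | succ q => rw [component_totD_succ h c hS hm, map_add, h𝓜.B_B, add_zero]
  · rw [component_of_notMem _ _ hS, component_of_notMem _ _ hS, map_zero, map_zero, map_zero]

lemma IsMixedComplex.totD_totD (h𝓜 : 𝓜.IsMixedComplex) (h : m + 1 = n) (h' : n + 1 = l)
    (c : 𝓜.Tot S l) : 𝓜.totD S h (𝓜.totD S h' c) = 0 := by
  refine ext_component fun i q hi hq => ?_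
  rw [map_zero]
  cases q with
  | zero =>
    rw [component_totD_zero h _ hi (by simpa using hq),
      component_totD_succ (q := 0) h' c hi (by push_cast at hq ⊢; omega), map_add, h𝓜.b_b,
      h𝓜.b_zero_B_zero, add_zero]
  | succ q =>
    rw [component_totD_succ h _ hi hq, h𝓜.B_component_totD h' c (by push_cast at hq; omega),
      component_totD_succ (q := q + 1) h' c hi (by push_cast at hq ⊢; omega), map_add, h𝓜.b_b,
      zero_add, h𝓜.b_B]

end MixedDiagram

section relativeMixed

variable {k C D : Type*} [CommRing k] [Ring C] [Algebra k C] [Ring D] [Algebra k D]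
  {K : Subalgebra k C} {L : Subalgebra k D}

lemma isMixedComplex_relativeMixed (f : C →ₐ[k] D) (hf : ∀ c ∈ K, f c ∈ L) :
    (relativeMixed f hf).IsMixedComplex where
  b_b _ z := Subtype.ext (hochschild_hochschild z.1)
  b_zero_B_zero z := Subtype.ext (hochschild_zero_connes_zero z.1)
  b_B _ z := Subtype.ext <|
    (congrArg (· + _) (hochschild_connes z.1)).trans (neg_add_cancel _)
  B_B _ z := Subtype.ext (connes_connes z.1)

end relativeMixed

/-! ### The comparison map -/

namespace CleftExtension

variable {k A E : Type*} [CommRing k] [Ring A] [Algebra k A] [Ring E] [Algebra k E]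
  (𝓔 : CleftExtension k A E) (K : Subalgebra k A) {S T : Set ℤ} {n m l : ℤ}

section components

/-- The component in position `(u, q - w, w)` of a chain of the total complex, viewed in
`E ⊗ Ē^{⊗ q} ⊗`. -/
def component (n u : ℤ) (q w : ℕ) : (𝓔.diagram K).Tot n →ₗ[k] CycTensor (𝓔.base K) q :=
  if h : w ≤ q ∧ u + q = n then
    (𝓔.X K q w).subtype ∘ₗ 𝓔.castX K (Nat.sub_add_cancel h.1) w ∘ₗ
      (𝓔.diagram K).totProj u (q - w) w (by have := h.1; have := h.2; omega)
  else 0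

variable {K}

lemma castX_apply (z : (𝓔.diagram K).Tot n) (u : ℤ) {v v' w q : ℕ} (hv : v' = v)
    (h : u + v + w = n) (h' : u + v' + w = n) (hq : v + w = q) (hq' : v' + w = q) :
    𝓔.castX K hq' w (z ⟨(u, v', w), h'⟩) = 𝓔.castX K hq w (z ⟨(u, v, w), h⟩) := by
  subst hv
  rfl

lemma component_eq (z : (𝓔.diagram K).Tot n) {u : ℤ} {v w q : ℕ} (h : u + v + w = n)
    (hq : v + w = q) :
    𝓔.component K n u q w z = (𝓔.castX K hq w (z ⟨(u, v, w), h⟩) : 𝓔.X K q w) := by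
  rw [component, dif_pos ⟨by omega, by omega⟩]
  exact congrArg Subtype.val (𝓔.castX_apply z u (by omega) h _ hq _)

lemma component_mem (z : (𝓔.diagram K).Tot n) (u : ℤ) (q w : ℕ) :
    𝓔.component K n u q w z ∈ 𝓔.X K q w := by
  unfold component
  split_ifs
  · exact Subtype.property _
  · exact zero_mem _

lemma eq_of_mem_X_of_lt {q w : ℕ} (h : q < w) {x y : CycTensor (𝓔.base K) q}
    (hx : x ∈ 𝓔.X K q w) (hy : y ∈ 𝓔.X K q w) : x = y := by
  rw [𝓔.X_eq_bot K h, Submodule.mem_bot] at hx hy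
  rw [hx, hy]

lemma component_totD (h : m + 1 = n) (z : (𝓔.diagram K).Tot n) {u : ℤ} {v w : ℕ}
    (hm : u + v + w = m) :
    ∃ (z₁ : 𝓔.X K (v + w) w) (z₂ : 𝓔.X K (v + w + 1) w) (z₃ : 𝓔.X K (v + w + 1) (w + 1)),
      𝓔.component K n (u + 1) (v + w) w z = z₁ ∧
      𝓔.component K n u (v + w + 1) w z = z₂ ∧
      𝓔.component K n u (v + w + 1) (w + 1) z = z₃ ∧
      𝓔.component K m u (v + w) w ((𝓔.diagram K).totD h z) =
        (𝓔.hMap K u (v + w) w z₁ + 𝓔.vMap K u (v + w) w z₂ + 𝓔.dMap K u (v + w) w z₃ :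
          𝓔.X K (v + w) w) := by
  refine ⟨_, _, _, 𝓔.component_eq z (by omega) rfl,
    𝓔.component_eq z (v := v + 1) (by push_cast; omega) (by omega),
    𝓔.component_eq z (v := v) (w := w + 1) (by push_cast; omega) rfl, ?_⟩
  rw [𝓔.component_eq _ hm rfl]
  rfl

lemma component_totD_even (h : m + 1 = n) (z : (𝓔.diagram K).Tot n) {u : ℤ} (hu : Even u)
    {q : ℕ} (hq : u + q = m) (w : ℕ) :
    𝓔.component K m u q w ((𝓔.diagram K).totD h z) =
      (𝓔.component K n (u + 1) q w z - 𝓔.t K q (𝓔.component K n (u + 1) q w z)) +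
        𝓔.b K q (𝓔.component K n u (q + 1) w z) +
          𝓔.d K q (𝓔.component K n u (q + 1) (w + 1) z) := by
  rcases lt_or_ge q w with hw | hw
  · exact 𝓔.eq_of_mem_X_of_lt hw (𝓔.component_mem _ _ _ _) (add_mem (add_mem (sub_mem
      (𝓔.component_mem _ _ _ _) (𝓔.t_mem K _ _ _ (𝓔.component_mem _ _ _ _)))
      (𝓔.b_mem K _ _ _ (𝓔.component_mem _ _ _ _))) (𝓔.d_mem K _ _ _ (𝓔.component_mem _ _ _ _)))
  · obtain ⟨v, rfl⟩ := Nat.exists_eq_add_of_le' hw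
    obtain ⟨z₁, z₂, z₃, h₁, h₂, h₃, hz⟩ :=
      𝓔.component_totD h z (u := u) (v := v) (w := w) (by push_cast at hq; omega)
    rw [hz, h₁, h₂, h₃, hMap, vMap, dMap, if_pos hu, if_pos hu, if_pos hu]
    rfl

lemma component_totD_odd (h : m + 1 = n) (z : (𝓔.diagram K).Tot n) {u : ℤ} (hu : ¬ Even u)
    {q : ℕ} (hq : u + q = m) (w : ℕ) :
    𝓔.component K m u q w ((𝓔.diagram K).totD h z) =
      𝓔.Nw K q w (𝓔.component K n (u + 1) q w z) -
        𝓔.b K q (𝓔.component K n u (q + 1) w z) -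
          𝓔.d' K q (𝓔.component K n u (q + 1) (w + 1) z) := by
  rcases lt_or_ge q w with hw | hw
  · exact 𝓔.eq_of_mem_X_of_lt hw (𝓔.component_mem _ _ _ _) (sub_mem (sub_mem
      (𝓔.Nw_mem _ (𝓔.component_mem _ _ _ _)) (𝓔.b_mem K _ _ _ (𝓔.component_mem _ _ _ _)))
      (𝓔.d'_mem K _ _ _ (𝓔.component_mem _ _ _ _)))
  · obtain ⟨v, rfl⟩ := Nat.exists_eq_add_of_le' hw
    obtain ⟨z₁, z₂, z₃, h₁, h₂, h₃, hz⟩ :=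
      𝓔.component_totD h z (u := u) (v := v) (w := w) (by push_cast at hq; omega)
    rw [hz, h₁, h₂, h₃, hMap, vMap, dMap, if_neg hu, if_neg hu, if_neg hu, sub_eq_add_neg,
      sub_eq_add_neg, ← coe_NX]
    rfl

variable (K) in
/-- The sum over `w` of the components in column `u` of a chain of the total complex, viewed in
`E ⊗ Ē^{⊗ q} ⊗`. -/
def column (n u : ℤ) (q : ℕ) : (𝓔.diagram K).Tot n →ₗ[k] CycTensor (𝓔.base K) q :=
  ∑ w ∈ Finset.range (q + 1), 𝓔.component K n u q w

lemma column_apply (u : ℤ) (q : ℕ) (z : (𝓔.diagram K).Tot n) :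
    𝓔.column K n u q z = ∑ w ∈ Finset.range (q + 1), 𝓔.component K n u q w z := by
  rw [column, LinearMap.sum_apply]

lemma column_mem_F (z : (𝓔.diagram K).Tot n) (u : ℤ) (q : ℕ) : 𝓔.column K n u q z ∈ 𝓔.F K q := by
  rw [column_apply]
  exact Submodule.sum_mem _ fun w _ => 𝓔.X_le_F K _ _ (𝓔.component_mem _ _ _ _)

lemma gradeProj_column (z : (𝓔.diagram K).Tot n) (u : ℤ) {q w : ℕ} (hw : w ≤ q) :
    𝓔.gradeProj K q (w + 1) (𝓔.column K n u q z) = 𝓔.component K n u q w z := by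
  rw [column_apply, map_sum, Finset.sum_eq_single_of_mem w (Finset.mem_range.2 (by omega)),
    𝓔.gradeProj_self (𝓔.component_mem _ _ _ _)]
  exact fun w' _ hw' => 𝓔.gradeProj_of_ne (𝓔.component_mem _ _ _ _) (by omega)

lemma column_congr {z z' : (𝓔.diagram K).Tot n} {u : ℤ}
    (h : ∀ (v w : ℕ) (hi : u + v + w = n), z ⟨(u, v, w), hi⟩ = z' ⟨(u, v, w), hi⟩) (q : ℕ) :
    𝓔.column K n u q z = 𝓔.column K n u q z' := by
  rw [column_apply, column_apply]
  refine Finset.sum_congr rfl fun w hw => ?_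
  obtain ⟨v, rfl⟩ := Nat.exists_eq_add_of_le' (Nat.lt_succ_iff.1 (Finset.mem_range.1 hw))
  by_cases hn : u + v + w = n
  · rw [𝓔.component_eq z hn rfl, 𝓔.component_eq z' hn rfl, h]
  · rw [component, dif_neg (by push_cast; omega)]
    rfl

lemma b_component_last (z : (𝓔.diagram K).Tot n) (u : ℤ) (q : ℕ) :
    𝓔.b K q (𝓔.component K n u (q + 1) (q + 1) z) = 0 :=
  𝓔.eq_of_mem_X_of_lt q.lt_succ_self (𝓔.b_mem K _ _ _ (𝓔.component_mem _ _ _ _)) (zero_mem _)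

lemma column_totD_even (h : m + 1 = n) (z : (𝓔.diagram K).Tot n) {u : ℤ} (hu : Even u)
    {q : ℕ} (hq : u + q = m) :
    𝓔.column K m u q ((𝓔.diagram K).totD h z) =
      (𝓔.column K n (u + 1) q z - 𝓔.t K q (𝓔.column K n (u + 1) q z)) +
        hochschild (𝓔.base K) q (𝓔.column K n u (q + 1) z) := by
  simp only [column_apply, 𝓔.component_totD_even h z hu hq, Finset.sum_add_distrib,
    Finset.sum_sub_distrib, hochschild_apply, map_sum]
  rw [Finset.sum_range_succ (fun w => 𝓔.b K q (𝓔.component K n u (q + 1) w z)) (q + 1),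
    Finset.sum_range_succ' (fun w => 𝓔.d K q (𝓔.component K n u (q + 1) w z)) (q + 1),
    𝓔.d_of_mem_X_zero (𝓔.component_mem z u (q + 1) 0), b_component_last, add_zero, add_zero,
    add_assoc]

lemma phi_column_totD_odd (h : m + 1 = n) (z : (𝓔.diagram K).Tot n) {u : ℤ}
    (hu : ¬ Even u) {q : ℕ} (hq : u + q = m) :
    𝓔.phi K q (𝓔.column K m u q ((𝓔.diagram K).totD h z)) =
      connes (𝓔.base K) q (𝓔.column K n (u + 1) q z) -
        𝓔.phi K q (𝓔.b K q (𝓔.column K n u (q + 1) z) + 𝓔.d' K q (𝓔.column K n u (q + 1) z)) := by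
  simp only [column_apply, 𝓔.component_totD_odd h z hu hq, Finset.sum_sub_distrib, map_sum,
    map_sub, map_add]
  rw [Finset.sum_range_succ (fun w => 𝓔.phi K q (𝓔.b K q (𝓔.component K n u (q + 1) w z))) (q + 1),
    Finset.sum_range_succ'
      (fun w => 𝓔.phi K q (𝓔.d' K q (𝓔.component K n u (q + 1) w z))) (q + 1),
    𝓔.d'_of_mem_X_zero (𝓔.component_mem z u (q + 1) 0), b_component_last, map_zero, add_zero,
    add_zero, sub_sub]
  congr 1
  exact Finset.sum_congr rfl fun w _ =>
    (𝓔.connes_eq_phi_Nw (𝓔.component_mem z (u + 1) q w)).symm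

end components

section thetaComponent

/-- The component in degree `q` and column `i` of the comparison map: the even columns of the triple
complex are embedded as they are, the odd ones by `Φ`. -/
def thetaComponent (n i : ℤ) : (q : ℕ) → (𝓔.diagram K).Tot n →ₗ[k] CycTensor (𝓔.base K) q
  | 0 => 𝓔.column K n (2 * i) 0
  | q + 1 => 𝓔.column K n (2 * i) (q + 1) + 𝓔.phi K q ∘ₗ 𝓔.column K n (2 * i + 1) q

variable {K}

lemma thetaComponent_succ (i : ℤ) (q : ℕ) (z : (𝓔.diagram K).Tot n) :
    𝓔.thetaComponent K n i (q + 1) z =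
      𝓔.column K n (2 * i) (q + 1) z + 𝓔.phi K q (𝓔.column K n (2 * i + 1) q z) := rfl

lemma thetaComponent_mem_imTheta (i : ℤ) (q : ℕ) (z : (𝓔.diagram K).Tot n) :
    𝓔.thetaComponent K n i q z ∈ 𝓔.imTheta K q := by
  cases q with
  | zero => exact 𝓔.column_mem_F z _ _
  | succ q =>
    exact add_mem (𝓔.F_le_imTheta _ (𝓔.column_mem_F z _ _))
      (𝓔.phi_mem_imTheta (𝓔.column_mem_F z _ _))

lemma mapCyc_p_of_mem_imTheta {q : ℕ} {y : CycTensor (𝓔.base K) q} (hy : y ∈ 𝓔.imTheta K q) :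
    mapCyc 𝓔.p (𝓔.p_base K) q y = 0 := by
  cases q with
  | zero => exact 𝓔.mapCyc_p_of_mem_F hy
  | succ q =>
    obtain ⟨f, hf, -, ⟨g, hg, rfl⟩, rfl⟩ := Submodule.mem_sup.1 hy
    rw [map_add, 𝓔.mapCyc_p_of_mem_F hf, mapCyc_phi, 𝓔.mapCyc_p_of_mem_F hg, map_zero, add_zero]

lemma phi_mem_imTheta_of_mem_imTheta {q : ℕ} {y : CycTensor (𝓔.base K) q}
    (hy : y ∈ 𝓔.imTheta K q) : 𝓔.phi K q y ∈ 𝓔.imTheta K (q + 1) := by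
  cases q with
  | zero => exact 𝓔.phi_mem_imTheta hy
  | succ q =>
    obtain ⟨f, hf, -, ⟨g, -, rfl⟩, rfl⟩ := Submodule.mem_sup.1 hy
    rw [map_add, phi_phi, add_zero]
    exact 𝓔.phi_mem_imTheta hf

lemma connes_thetaComponent (i : ℤ) (q : ℕ) (z : (𝓔.diagram K).Tot n) :
    connes (𝓔.base K) q (𝓔.thetaComponent K n i q z) =
      connes (𝓔.base K) q (𝓔.column K n (2 * i) q z) := by
  cases q with
  | zero => rfl
  | succ q => rw [thetaComponent_succ, map_add, connes_phi, add_zero]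

lemma thetaComponent_totD_zero (h : m + 1 = n) (z : (𝓔.diagram K).Tot n) {i : ℤ}
    (hm : 2 * i = m) :
    𝓔.thetaComponent K m i 0 ((𝓔.diagram K).totD h z) =
      hochschild (𝓔.base K) 0 (𝓔.thetaComponent K n i 1 z) := by
  rw [thetaComponent, 𝓔.column_totD_even h z (even_two_mul i) (by simpa using hm),
    𝓔.t_zero (𝓔.mapCyc_p_of_mem_F (𝓔.column_mem_F z _ _)), sub_self, zero_add,
    thetaComponent_succ, map_add, hochschild_zero_phi_zero, add_zero]

lemma thetaComponent_totD_succ (h : m + 1 = n) (z : (𝓔.diagram K).Tot n) {i : ℤ} {q : ℕ}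
    (hm : 2 * i + (q + 1 : ℕ) = m) :
    𝓔.thetaComponent K m i (q + 1) ((𝓔.diagram K).totD h z) =
      hochschild (𝓔.base K) (q + 1) (𝓔.thetaComponent K n i (q + 2) z) +
        connes (𝓔.base K) q (𝓔.thetaComponent K n (i + 1) q z) := by
  rw [connes_thetaComponent, show 2 * (i + 1) = 2 * i + 1 + 1 by ring, thetaComponent_succ,
    thetaComponent_succ, 𝓔.column_totD_even h z (even_two_mul i) hm,
    𝓔.phi_column_totD_odd h z (Int.not_even_two_mul_add_one i) (by push_cast at hm; omega),
    map_add (hochschild (𝓔.base K) (q + 1)),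
    𝓔.hochschild_phi_of_mem_F (𝓔.column_mem_F z _ _)]
  abel

end thetaComponent

section mixedComponent

/-- The component in `X_q uⁱ` of a chain of the relative mixed complex, viewed in
`E ⊗ Ē^{⊗ q} ⊗`. -/
def mixedComponent (S : Set ℤ) (n i : ℤ) (q : ℕ) :
    (𝓔.relMixed K).Tot S n →ₗ[k] CycTensor (𝓔.base K) q :=
  (LinearMap.ker (mapCyc 𝓔.p (𝓔.p_base K) q)).subtype ∘ₗ (𝓔.relMixed K).component S n i q

variable {K}

lemma mapCyc_p_mixedComponent (c : (𝓔.relMixed K).Tot S n) (i : ℤ) (q : ℕ) :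
    mapCyc 𝓔.p (𝓔.p_base K) q (𝓔.mixedComponent K S n i q c) = 0 :=
  ((𝓔.relMixed K).component S n i q c : LinearMap.ker (mapCyc 𝓔.p (𝓔.p_base K) q)).2

lemma mixedComponent_of_notMem (c : (𝓔.relMixed K).Tot S n) {i : ℤ} (q : ℕ) (h : i ∉ S) :
    𝓔.mixedComponent K S n i q c = 0 :=
  congrArg Subtype.val (MixedDiagram.component_of_notMem c q h)

variable {𝓔} in
lemma ext_mixedComponent {c c' : (𝓔.relMixed K).Tot S n}
    (h : ∀ i (q : ℕ), i ∈ S → 2 * i + q = n →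
      𝓔.mixedComponent K S n i q c = 𝓔.mixedComponent K S n i q c') : c = c' :=
  MixedDiagram.ext_component fun i q hi hq => Subtype.ext (h i q hi hq)

lemma mixedComponent_totD_zero (h : m + 1 = n) (c : (𝓔.relMixed K).Tot S n) {i : ℤ} (hi : i ∈ S)
    (hm : 2 * i = m) :
    𝓔.mixedComponent K S m i 0 ((𝓔.relMixed K).totD S h c) =
      hochschild (𝓔.base K) 0 (𝓔.mixedComponent K S n i 1 c) :=
  congrArg Subtype.val (MixedDiagram.component_totD_zero h c hi hm)

lemma mixedComponent_totD_succ (h : m + 1 = n) (c : (𝓔.relMixed K).Tot S n) {i : ℤ} {q : ℕ}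
    (hi : i ∈ S) (hm : 2 * i + (q + 1 : ℕ) = m) :
    𝓔.mixedComponent K S m i (q + 1) ((𝓔.relMixed K).totD S h c) =
      hochschild (𝓔.base K) (q + 1) (𝓔.mixedComponent K S n i (q + 2) c) +
        connes (𝓔.base K) q (𝓔.mixedComponent K S n (i + 1) q c) :=
  congrArg Subtype.val (MixedDiagram.component_totD_succ h c hi hm)

end mixedComponent

section theta

lemma two_mul_ediv_two (i : ℤ) : 2 * i / 2 = i := by omega

lemma two_mul_add_one_ediv_two (i : ℤ) : (2 * i + 1) / 2 = i := by omega

/-- The comparison map `Θ` from the columns `2i` and `2i + 1`, `i ∈ S`, of the triple complex to the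
columns `i ∈ S` of the relative mixed complex. -/
def theta (S : Set ℤ) (n : ℤ) :
    ((𝓔.diagram K).trunc {u | u / 2 ∈ S}).Tot n →ₗ[k] (𝓔.relMixed K).Tot S n :=
  LinearMap.pi fun i => LinearMap.codRestrict (LinearMap.ker (mapCyc 𝓔.p (𝓔.p_base K) i.1.2))
    (𝓔.thetaComponent K n i.1.1 i.1.2 ∘ₗ (𝓔.diagram K).truncIncl {u | u / 2 ∈ S} n)
    fun _ => 𝓔.mapCyc_p_of_mem_imTheta (𝓔.thetaComponent_mem_imTheta _ _ _)

variable {K}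

lemma column_truncIncl_of_notMem (z : ((𝓔.diagram K).trunc T).Tot n) {u : ℤ} (hu : u ∉ T)
    (q : ℕ) : 𝓔.column K n u q ((𝓔.diagram K).truncIncl T n z) = 0 := by
  rw [𝓔.column_congr (z' := 0) (fun v w hi => TripleDiagram.truncIncl_of_notMem z hu) q, map_zero]

lemma column_truncIncl_totD (h : m + 1 = n) (z : ((𝓔.diagram K).trunc T).Tot n) {u : ℤ}
    (hu : u ∈ T) (q : ℕ) :
    𝓔.column K m u q ((𝓔.diagram K).truncIncl T m (((𝓔.diagram K).trunc T).totD h z)) =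
      𝓔.column K m u q ((𝓔.diagram K).totD h ((𝓔.diagram K).truncIncl T n z)) :=
  𝓔.column_congr (fun _ _ hi => TripleDiagram.truncIncl_totD h z hi hu) q

lemma thetaComponent_truncIncl_of_notMem (z : ((𝓔.diagram K).trunc {u | u / 2 ∈ S}).Tot n)
    {i : ℤ} (hi : i ∉ S) (q : ℕ) :
    𝓔.thetaComponent K n i q ((𝓔.diagram K).truncIncl {u | u / 2 ∈ S} n z) = 0 := by
  have h_even : 2 * i ∉ {u : ℤ | u / 2 ∈ S} := by rwa [Set.mem_ofPred_eq, two_mul_ediv_two]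
  have h_odd : 2 * i + 1 ∉ {u : ℤ | u / 2 ∈ S} := by
    rwa [Set.mem_ofPred_eq, two_mul_add_one_ediv_two]
  cases q with
  | zero => exact 𝓔.column_truncIncl_of_notMem z h_even 0
  | succ q =>
    rw [thetaComponent_succ, 𝓔.column_truncIncl_of_notMem z h_even,
      𝓔.column_truncIncl_of_notMem z h_odd, map_zero, add_zero]

lemma thetaComponent_truncIncl_totD (h : m + 1 = n)
    (z : ((𝓔.diagram K).trunc {u | u / 2 ∈ S}).Tot n) {i : ℤ} (hi : i ∈ S) (q : ℕ) :
    𝓔.thetaComponent K m i q ((𝓔.diagram K).truncIncl {u | u / 2 ∈ S} m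
      (((𝓔.diagram K).trunc {u | u / 2 ∈ S}).totD h z)) =
    𝓔.thetaComponent K m i q ((𝓔.diagram K).totD h
      ((𝓔.diagram K).truncIncl {u | u / 2 ∈ S} n z)) := by
  have h_even : 2 * i ∈ {u : ℤ | u / 2 ∈ S} := by rwa [Set.mem_ofPred_eq, two_mul_ediv_two]
  have h_odd : 2 * i + 1 ∈ {u : ℤ | u / 2 ∈ S} := by
    rwa [Set.mem_ofPred_eq, two_mul_add_one_ediv_two]
  cases q with
  | zero => exact 𝓔.column_truncIncl_totD h z h_even 0
  | succ q =>
    rw [thetaComponent_succ, thetaComponent_succ, 𝓔.column_truncIncl_totD h z h_even,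
      𝓔.column_truncIncl_totD h z h_odd]

lemma mixedComponent_theta (z : ((𝓔.diagram K).trunc {u | u / 2 ∈ S}).Tot n) {i : ℤ} {q : ℕ}
    (h : 2 * i + q = n) : 𝓔.mixedComponent K S n i q (𝓔.theta K S n z) =
      𝓔.thetaComponent K n i q ((𝓔.diagram K).truncIncl {u | u / 2 ∈ S} n z) := by
  by_cases hi : i ∈ S
  · exact congrArg Subtype.val (MixedDiagram.component_apply (𝓔.theta K S n z) ⟨hi, h⟩)
  · rw [𝓔.mixedComponent_of_notMem _ _ hi, 𝓔.thetaComponent_truncIncl_of_notMem z hi]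

lemma theta_totD (h : m + 1 = n) (z : ((𝓔.diagram K).trunc {u | u / 2 ∈ S}).Tot n) :
    𝓔.theta K S m (((𝓔.diagram K).trunc {u | u / 2 ∈ S}).totD h z) =
      (𝓔.relMixed K).totD S h (𝓔.theta K S n z) := by
  refine ext_mixedComponent fun i q hi hq => ?_
  rw [𝓔.mixedComponent_theta _ hq, 𝓔.thetaComponent_truncIncl_totD h z hi]
  cases q with
  | zero =>
    rw [𝓔.thetaComponent_totD_zero h _ (by simpa using hq),
      𝓔.mixedComponent_totD_zero h _ hi (by simpa using hq),
      𝓔.mixedComponent_theta z (by push_cast at hq ⊢; omega)]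
  | succ q =>
    rw [𝓔.thetaComponent_totD_succ h _ hq, 𝓔.mixedComponent_totD_succ h _ hi hq,
      𝓔.mixedComponent_theta z (by push_cast at hq ⊢; omega),
      𝓔.mixedComponent_theta z (by push_cast at hq ⊢; omega)]

lemma eq_zero_of_column_eq_zero {z : (𝓔.diagram K).Tot n}
    (h : ∀ (u : ℤ) (q : ℕ), u + q = n → 𝓔.column K n u q z = 0) : z = 0 := by
  funext ⟨(u, v, w), hi⟩
  have hz := 𝓔.gradeProj_column z u (Nat.le_add_left w v)
  rw [h u (v + w) (by push_cast; simp only at hi; omega), map_zero, 𝓔.component_eq z hi rfl] at hz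
  exact Subtype.ext hz.symm

lemma column_eq_zero_of_thetaComponent_eq_zero {z : (𝓔.diagram K).Tot n}
    (h : ∀ (i : ℤ) (q : ℕ), 2 * i + q = n → 𝓔.thetaComponent K n i q z = 0) {u : ℤ} {q : ℕ}
    (hq : u + q = n) : 𝓔.column K n u q z = 0 := by
  have columns_eq_zero (i : ℤ) (q : ℕ) (hq : 2 * i + (q + 1 : ℕ) = n) :
      𝓔.column K n (2 * i) (q + 1) z = 0 ∧ 𝓔.column K n (2 * i + 1) q z = 0 :=
    𝓔.eq_zero_of_add_phi_eq_zero (𝓔.column_mem_F z _ _) (𝓔.column_mem_F z _ _) (h i (q + 1) hq)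
  rcases Int.even_or_odd' u with ⟨i, rfl | rfl⟩
  · cases q with
    | zero => exact h i 0 hq
    | succ q => exact (columns_eq_zero i q hq).1
  · exact (columns_eq_zero i q (by push_cast; omega)).2

lemma theta_injective : Function.Injective (𝓔.theta K S n) := by
  rw [injective_iff_map_eq_zero]
  intro z hz
  refine TripleDiagram.truncIncl_injective ((𝓔.eq_zero_of_column_eq_zero fun u q hq =>
    𝓔.column_eq_zero_of_thetaComponent_eq_zero (fun i q hq => ?_) hq).trans (map_zero _).symm)
  rw [← 𝓔.mixedComponent_theta z hq, hz, map_zero]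

end theta

section range

variable {K}

/-- The column `u`, in degree `q`, of the preimage under `Θ` of a chain `c` in its range. -/
def preimageColumn (c : (𝓔.relMixed K).Tot S n) (u : ℤ) (q : ℕ) : CycTensor (𝓔.base K) q :=
  if Even u then 𝓔.projF K q (𝓔.mixedComponent K S n (u / 2) q c)
  else 𝓔.eps K q (𝓔.mixedComponent K S n (u / 2) (q + 1) c)

lemma preimageColumn_even (c : (𝓔.relMixed K).Tot S n) (i : ℤ) (q : ℕ) :
    𝓔.preimageColumn c (2 * i) q = 𝓔.projF K q (𝓔.mixedComponent K S n i q c) := by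
  rw [preimageColumn, if_pos (even_two_mul i), two_mul_ediv_two]

lemma preimageColumn_odd (c : (𝓔.relMixed K).Tot S n) (i : ℤ) (q : ℕ) :
    𝓔.preimageColumn c (2 * i + 1) q = 𝓔.eps K q (𝓔.mixedComponent K S n i (q + 1) c) := by
  rw [preimageColumn, if_neg (Int.not_even_two_mul_add_one i), two_mul_add_one_ediv_two]

lemma preimageColumn_mem_F (c : (𝓔.relMixed K).Tot S n) (u : ℤ) (q : ℕ) :
    𝓔.preimageColumn c u q ∈ 𝓔.F K q := by
  unfold preimageColumn
  split_ifs
  exacts [𝓔.projF_mem_F K _, 𝓔.eps_mem_F _]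

lemma preimageColumn_of_notMem (c : (𝓔.relMixed K).Tot S n) {u : ℤ} (hu : u / 2 ∉ S) (q : ℕ) :
    𝓔.preimageColumn c u q = 0 := by
  unfold preimageColumn
  rw [𝓔.mixedComponent_of_notMem c _ hu, 𝓔.mixedComponent_of_notMem c _ hu, map_zero, map_zero,
    ite_self]

/-- The chain of the truncated triple complex with columns `preimageColumn c`. -/
def preimage (c : (𝓔.relMixed K).Tot S n) : ((𝓔.diagram K).trunc {u | u / 2 ∈ S}).Tot n :=
  fun ⟨(u, v, w), _⟩ =>
    (⟨(⟨𝓔.gradeProj K (v + w) (w + 1) (𝓔.preimageColumn c u (v + w)),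
        𝓔.gradeProj_mem_X w (𝓔.preimageColumn_mem_F c _ _)⟩ : 𝓔.X K (v + w) w),
      fun hu => Subtype.ext ((congrArg _ (𝓔.preimageColumn_of_notMem c hu _)).trans
        (map_zero (𝓔.gradeProj K (v + w) (w + 1))))⟩ :
      (𝓔.diagram K).truncMod {u | u / 2 ∈ S} u v w)

lemma column_truncIncl_preimage (c : (𝓔.relMixed K).Tot S n) {u : ℤ} {q : ℕ} (hq : u + q = n) :
    𝓔.column K n u q ((𝓔.diagram K).truncIncl {u | u / 2 ∈ S} n (𝓔.preimage c)) =
      𝓔.preimageColumn c u q := by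
  rw [column_apply, ← 𝓔.sum_gradeProj_of_mem_F (𝓔.preimageColumn_mem_F c u q)]
  refine Finset.sum_congr rfl fun w hw => ?_
  obtain ⟨v, rfl⟩ := Nat.exists_eq_add_of_le' (Nat.lt_succ_iff.1 (Finset.mem_range.1 hw))
  rw [𝓔.component_eq _ (show u + v + w = n by push_cast at hq; omega) rfl]
  rfl

lemma mem_range_theta_iff {c : (𝓔.relMixed K).Tot S n} :
    c ∈ LinearMap.range (𝓔.theta K S n) ↔
      ∀ i (q : ℕ), i ∈ S → 2 * i + q = n → 𝓔.mixedComponent K S n i q c ∈ 𝓔.imTheta K q := by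
  constructor
  · rintro ⟨z, rfl⟩ i q - hq
    rw [𝓔.mixedComponent_theta z hq]
    exact 𝓔.thetaComponent_mem_imTheta _ _ _
  · intro hc
    refine ⟨𝓔.preimage c, ext_mixedComponent fun i q hi hq => ?_⟩
    rw [𝓔.mixedComponent_theta _ hq]
    cases q with
    | zero =>
      rw [thetaComponent, 𝓔.column_truncIncl_preimage c hq, preimageColumn_even,
        𝓔.projF_of_mem_F (hc i 0 hi hq)]
    | succ q =>
      rw [thetaComponent_succ, 𝓔.column_truncIncl_preimage c hq,
        𝓔.column_truncIncl_preimage c (by push_cast at hq; omega), preimageColumn_even,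
        preimageColumn_odd, 𝓔.projF_add_phi_eps (hc i (q + 1) hi hq)]

end range

section homotopy

variable {K}

/-- The chain with component `Φ c` in every column; `Φ` is a contracting homotopy of the cokernel
of `Θ`. -/
def mixedPhi (l : ℤ) (c : (𝓔.relMixed K).Tot S n) : (𝓔.relMixed K).Tot S l
  | ⟨(_, 0), _⟩ => (0 : LinearMap.ker (mapCyc 𝓔.p (𝓔.p_base K) 0))
  | ⟨(i, q + 1), _⟩ => (⟨𝓔.phi K q (𝓔.mixedComponent K S n i q c), by
      rw [LinearMap.mem_ker, mapCyc_phi, mapCyc_p_mixedComponent, map_zero]⟩ :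
      LinearMap.ker (mapCyc 𝓔.p (𝓔.p_base K) (q + 1)))

lemma mixedComponent_mixedPhi_succ (h : n + 1 = l) (c : (𝓔.relMixed K).Tot S n) {i : ℤ} {q : ℕ}
    (hq : 2 * i + q = n) :
    𝓔.mixedComponent K S l i (q + 1) (𝓔.mixedPhi l c) =
      𝓔.phi K q (𝓔.mixedComponent K S n i q c) := by
  by_cases hi : i ∈ S
  · exact congrArg Subtype.val
      (MixedDiagram.component_apply (𝓔.mixedPhi l c) ⟨hi, by push_cast; omega⟩)
  · rw [𝓔.mixedComponent_of_notMem _ _ hi, 𝓔.mixedComponent_of_notMem _ _ hi, map_zero]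

lemma connes_mixedComponent_mixedPhi (h : n + 1 = l) (c : (𝓔.relMixed K).Tot S n) {i : ℤ} {q : ℕ}
    (hq : 2 * i + q = l) :
    connes (𝓔.base K) q (𝓔.mixedComponent K S l i q (𝓔.mixedPhi l c)) = 0 := by
  cases q with
  | zero =>
    by_cases hi : i ∈ S
    · exact (congrArg _ (congrArg Subtype.val
        (MixedDiagram.component_apply (𝓔.mixedPhi l c) ⟨hi, hq⟩))).trans (map_zero _)
    · rw [𝓔.mixedComponent_of_notMem _ _ hi, map_zero]
  | succ q =>
    rw [𝓔.mixedComponent_mixedPhi_succ h c (by push_cast at hq; omega), connes_phi]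

lemma phi_mixedComponent_totD (h : m + 1 = n) (c : (𝓔.relMixed K).Tot S n) {i : ℤ} {q : ℕ}
    (hq : 2 * i + q = m) :
    𝓔.phi K q (𝓔.mixedComponent K S m i q ((𝓔.relMixed K).totD S h c)) =
      𝓔.phi K q (hochschild (𝓔.base K) q (𝓔.mixedComponent K S n i (q + 1) c)) := by
  by_cases hi : i ∈ S
  · cases q with
    | zero => rw [𝓔.mixedComponent_totD_zero h c hi (by simpa using hq)]
    | succ q => rw [𝓔.mixedComponent_totD_succ h c hi hq, map_add, phi_connes, add_zero]
  · rw [𝓔.mixedComponent_of_notMem _ _ hi, 𝓔.mixedComponent_of_notMem _ _ hi, map_zero, map_zero,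
      map_zero]

lemma sub_totD_mixedPhi_mem_range_theta (h : m + 1 = n) (h' : n + 1 = l)
    {c : (𝓔.relMixed K).Tot S n}
    (hc : (𝓔.relMixed K).totD S h c ∈ LinearMap.range (𝓔.theta K S m)) :
    c - (𝓔.relMixed K).totD S h' (𝓔.mixedPhi l c) ∈ LinearMap.range (𝓔.theta K S n) := by
  refine 𝓔.mem_range_theta_iff.2 fun i q hi hq => ?_
  cases q with
  | zero => exact 𝓔.mem_F_zero (𝓔.mapCyc_p_mixedComponent _ _ _)
  | succ q =>
    have hm : 2 * i + (q : ℤ) = m := by push_cast at hq; omega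
    have phi_hochschild_mem : 𝓔.phi K q (hochschild (𝓔.base K) q
        (𝓔.mixedComponent K S n i (q + 1) c)) ∈ 𝓔.imTheta K (q + 1) := by
      rw [← 𝓔.phi_mixedComponent_totD h c hm]
      exact 𝓔.phi_mem_imTheta_of_mem_imTheta (𝓔.mem_range_theta_iff.1 hc i q hi hm)
    rw [map_sub, 𝓔.mixedComponent_totD_succ h' _ hi hq,
      𝓔.connes_mixedComponent_mixedPhi h' c (by push_cast at hq; omega), add_zero,
      𝓔.mixedComponent_mixedPhi_succ (q := q + 1) h' c hq]
    convert sub_mem phi_hochschild_mem (𝓔.hochschild_phi_add_phi_hochschild_sub_mem_imTheta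
      (𝓔.mapCyc_p_mixedComponent c i (q + 1))) using 1
    abel

end homotopy

lemma nonempty_homology_trunc_equiv (hT : ∀ u, u ∈ T ↔ u / 2 ∈ S) (n : ℤ) :
    Nonempty ((𝓔.relMixed K).H S n ≃ₗ[k] ((𝓔.diagram K).trunc T).H n) := by
  obtain rfl : T = {u | u / 2 ∈ S} := Set.ext hT
  have h𝓜 : (𝓔.relMixed K).IsMixedComplex := isMixedComplex_relativeMixed 𝓔.p (𝓔.p_base K)
  have cokernel_acyclic {m n l : ℤ} (h : m + 1 = n) (h' : n + 1 = l) (c : (𝓔.relMixed K).Tot S n)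
      (hc : (𝓔.relMixed K).totD S h c ∈ LinearMap.range (𝓔.theta K S m)) :
      ∃ c', c - (𝓔.relMixed K).totD S h' c' ∈ LinearMap.range (𝓔.theta K S n) :=
    ⟨_, 𝓔.sub_totD_mixedPhi_mem_range_theta h h' hc⟩
  obtain ⟨e⟩ := nonempty_homology_equiv ((𝓔.relMixed K).totD S (n := n + 1 + 1) rfl)
    (𝓔.theta_totD (m := n) rfl) (𝓔.theta_totD (m := n - 1) (by omega)) (h𝓜.totD_totD _ _)
    (h𝓜.totD_totD _ _) 𝓔.theta_injective 𝓔.theta_injective (cokernel_acyclic _ _)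
    (cokernel_acyclic _ _)
  exact ⟨e.symm⟩

end CleftExtension

end Cleft

end

theorem mainTheorem2_general {k A E : Type*} [CommRing k] [Ring A] [Algebra k A] [Ring E]
    [Algebra k E] (𝓔 : Cleft.CleftExtension k A E) (K : Subalgebra k A) :
    (𝓔.diagram K).IsTripleComplex ∧
    ∀ n : ℤ,
      Nonempty ((𝓔.relMixed K).HH n ≃ₗ[k] ((𝓔.diagram K).trunc (Set.Icc 0 1)).H n) ∧
      Nonempty ((𝓔.relMixed K).HC n ≃ₗ[k] ((𝓔.diagram K).trunc (Set.Ici 0)).H n) ∧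
      Nonempty ((𝓔.relMixed K).HP n ≃ₗ[k] (𝓔.diagram K).H n) ∧
      Nonempty ((𝓔.relMixed K).HN n ≃ₗ[k] ((𝓔.diagram K).trunc (Set.Iic 1)).H n) := by
  refine ⟨𝓔.isTripleComplex K, fun n => ⟨?_, ?_, ?_, ?_⟩⟩
  · exact 𝓔.nonempty_homology_trunc_equiv K
      (fun u => by rw [Set.mem_Icc, Set.mem_singleton_iff]; omega) n
  · exact 𝓔.nonempty_homology_trunc_equiv K (fun u => by rw [Set.mem_Ici, Set.mem_Ici]; omega) n
  · obtain ⟨e⟩ := 𝓔.nonempty_homology_trunc_equiv K (S := Set.univ) (T := Set.univ)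
      (fun u => by simp) n
    obtain ⟨e'⟩ := (𝓔.isTripleComplex K).nonempty_homology_trunc_univ_equiv n
    exact ⟨e.trans e'⟩
  · exact 𝓔.nonempty_homology_trunc_equiv K (fun u => by rw [Set.mem_Iic, Set.mem_Iic]; omega) n

theorem mainTheorem2 {k A E : Type*} [CommRing k] [Algebra ℚ k] [Ring A] [Algebra k A] [Ring E]
    [Algebra k E] (𝓔 : Cleft.CleftExtension k A E) (K : Subalgebra k A) :
    (𝓔.diagram K).IsTripleComplex ∧
    ∀ n : ℤ,
      Nonempty ((𝓔.relMixed K).HH n ≃ₗ[k] ((𝓔.diagram K).trunc (Set.Icc 0 1)).H n) ∧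
      Nonempty ((𝓔.relMixed K).HC n ≃ₗ[k] ((𝓔.diagram K).trunc (Set.Ici 0)).H n) ∧
      Nonempty ((𝓔.relMixed K).HP n ≃ₗ[k] (𝓔.diagram K).H n) ∧
      Nonempty ((𝓔.relMixed K).HN n ≃ₗ[k] ((𝓔.diagram K).trunc (Set.Iic 1)).H n) :=
  mainTheorem2_general 𝓔 K
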